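/- \textbf{The affinity-scheduling system.} Let $N\ge 1$, $\mu_1>\mu_2>0$, and let $\lambda_S\ge 0$ for every $S\subseteq\{1,\dots,N\}$, with $\lambda_\emptyset=0$; put $\mathcal S=\{S:\lambda_S>0\}$. Jobs with primary selection $S$ arrive according to independent Poisson processes of rates $\lambda_S$. On arrival such a job is sent to an idle server of $S$ (as a type I job) if there is one; otherwise to an idle server of $S^c$ (as a type II job) if there is one; otherwise (as a type I job) to a server of $S$ with the smallest number of type I jobs, ties being broken in favour of the smallest number of type II jobs. The choice among the servers that are still eligible is made by an arbitrary fixed, possibly randomised, rule depending on the current configuration and $S$. Type I and type II jobs have independent exponential service times with parameters $\mu_1$ and $\mu_2$; each server serves one job at a time, with preemptive priority for type I jobs. The configuration of all servers (the numbers of type I and type II jobs at each server) is then a continuous-time Markov chain on $(\mathbb N^2)^N$. \textbf{The reference system.} Let \[ \lambda_0=\min_{(p_{Sn})}\ \max_{1\le n\le N}\ \sum_{S\in\mathcal S:\,n\in S}\lambda_S\,p_{Sn}, \] the minimum (which is attained) being over all $(p_{Sn})_{S\in\mathcal S,\,n\in S}$ with $p_{Sn}\ge 0$ and $\sum_{n\in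 S}p_{Sn}=1$ for every $S\in\mathcal S$. In the reference system (random assignment, RA) with $N$ servers, jobs arrive at total rate $\lambda_0N$, each joins a server chosen uniformly at random, and every non-empty server completes jobs at rate $\mu_1$. Its configuration is a continuous-time Markov chain on $\mathbb N^N$. Let $\overline Q_i^{\mathrm{aff}}(t)$ be the number of servers with at least $i$ type I jobs at time $t$ in the affinity-scheduling system, and $\overline Q_i^{\mathrm{RA}}(t)$ the number of servers with at least $i$ jobs at time $t$ in the reference system; put $\overline Q_{m+}(t)=\sum_{i\ge m}\overline Q_i(t)$ for $m\ge1$. The paths are right-continuous with left limits, and both Markov chains exist for every initial law. \textbf{Theorem.} (1) If the (possibly random) initial configurations satisfy $(\overline Q_{m+}^{\mathrm{aff}}(0))_{m\ge1}\le_{\mathrm{st}}(\overline Q_{m+}^{\mathrm{RA}}(0))_{m\ge1}$ (in particular if they are deterministic and $\overline Q_{m+}^{\mathrm{aff}}(0)\le\overline Q_{m+}^{\mathrm{RA}}(0)$ for all $m\ge 1$), then \[ \{(\overline Q_{m+}^{\mathrm{aff}}(t))_{m\ge1}\}_{t\ge0}\ \le_{\mathrm{st}}\ \{(\overline Q_{m+}^{\mathrm{RA}}(t))_{m\ge1}\}_{t\ge0}.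 \] Here vectors are ordered coordinatewise, and $\le_{\mathrm{st}}$ means that there are versions with the same laws on a common probability space (for processes: the same laws as random functions of time, with right-continuous paths that have left limits) for which, almost surely, the inequality holds (for processes: at all times $t\ge0$ simultaneously). (2) If $\lambda_0<\mu_1$, then the affinity-scheduling system, including its type II jobs, is stable: its Markov chain has a unique stationary distribution, and from every initial configuration it converges in distribution to it as $t\to\infty$. -/

import Mathlib

open MeasureTheory ProbabilityTheory Filter Topology
open scoped NNReal Nat

noncomputable section

/-! ### Continuous-time Markov chains with bounded rates on a countable state space -/

section MarkovChains

/-- A (candidate) generator: it maps `f` to `L f`, where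
`(L f) x = ∑ rate(x → y) * (f y - f x)`. -/
abbrev Generator (E : Type*) := (E → ℝ) → E → ℝ

/-- The transition probabilities `p_t(x, y) = (e^{tL} 1_{y})(x)` of the continuous-time Markov
chain with generator `L`, as the exponential series.  All generators below have bounded jump rates,
so that the series converges absolutely. -/
def transProb {E : Type*} (L : Generator E) (t : ℝ≥0) (x y : E) : ℝ :=
  ∑' k : ℕ, (t : ℝ) ^ k / (k ! : ℝ) * (L^[k] (Set.indicator {y} 1)) x

/-- The process `X` on `(Ω, P)` is a Markov jump process with generator `L`: its paths are
right-continuous with left limits (for the discrete topology of the state space), and, for its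
natural filtration, it is a time-homogeneous Markov process with transition probabilities
`transProb L`.  The initial law is arbitrary. -/
structure IsMarkovJumpProcess {E Ω : Type*} [MeasurableSpace E] [TopologicalSpace E]
    [MeasurableSpace Ω] (L : Generator E) (P : Measure Ω) (X : ℝ≥0 → Ω → E) : Prop where
  measurable : ∀ t, Measurable (X t)
  cadlag : ∀ᵐ ω ∂P, ∀ t,
    ContinuousWithinAt (fun s => X s ω) (Set.Ioi t) t ∧
      ∃ l, Tendsto (fun s => X s ω) (𝓝[<] t) (𝓝 l)
  markov : ∀ (s h : ℝ≥0) (y : E),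
    P[(X (s + h) ⁻¹' {y}).indicator (fun _ => (1 : ℝ)) |
        ⨆ u : Set.Iic s, MeasurableSpace.comap (X u) inferInstance]
      =ᵐ[P] fun ω => transProb L h (X s ω) y

/-- `π` is a stationary distribution of the chain with generator `L`. -/
structure IsStationaryLaw {E : Type*} (L : Generator E) (π : E → ℝ) : Prop where
  nonneg : ∀ x, 0 ≤ π x
  hasSum_one : HasSum π 1
  invariant : ∀ (t : ℝ≥0) (y : E), HasSum (fun x => π x * transProb L t x y) (π y)

/-- Stability (ergodicity): there is a unique stationary distribution, and the chain converges to
it in distribution from every initial state. -/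
def IsErgodicallyStable {E : Type*} (L : Generator E) : Prop :=
  ∃ π : E → ℝ, IsStationaryLaw L π ∧ (∀ π' : E → ℝ, IsStationaryLaw L π' → π' = π) ∧
    ∀ x y, Tendsto (fun t : ℝ≥0 => transProb L t x y) atTop (𝓝 (π y))

end MarkovChains

/-! ### Stochastic dominance, through couplings -/

section Dominance

/-- Stochastic dominance `μ ≤_st ν` of probability laws on an ordered space. -/
def StochLE {α : Type*} [MeasurableSpace α] [Preorder α] (μ ν : Measure α) : Prop :=
  ∃ ρ : Measure (α × α), ρ.map Prod.fst = μ ∧ ρ.map Prod.snd = ν ∧ ∀ᵐ z ∂ρ, z.1 ≤ z.2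

/-- Stochastic dominance `{A(t)}_{t ≥ 0} ≤_st {B(t)}_{t ≥ 0}` of processes: on some common
probability space there are processes `A'`, `B'` with right-continuous paths that have left limits,
such that `A'` has the same law as `A` and `B'` the same law as `B` (as random functions of time),
and almost surely `A' t ≤ B' t` at all times `t` simultaneously. -/
def ProcessStochLE {α Ω₁ Ω₂ : Type*} [MeasurableSpace α] [TopologicalSpace α] [Preorder α]
    [MeasurableSpace Ω₁] [MeasurableSpace Ω₂]
    (P₁ : Measure Ω₁) (A : ℝ≥0 → Ω₁ → α) (P₂ : Measure Ω₂) (B : ℝ≥0 → Ω₂ → α) : Prop :=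
  ∃ (Ω : Type) (_ : MeasurableSpace Ω) (P : Measure Ω) (A' B' : ℝ≥0 → Ω → α),
    IsProbabilityMeasure P ∧
    (∀ t, Measurable (A' t)) ∧ (∀ t, Measurable (B' t)) ∧
    P.map (fun ω t => A' t ω) = P₁.map (fun ω t => A t ω) ∧
    P.map (fun ω t => B' t ω) = P₂.map (fun ω t => B t ω) ∧
    (∀ᵐ ω ∂P, ∀ t,
      ContinuousWithinAt (fun s => A' s ω) (Set.Ioi t) t ∧
      (∃ l, Tendsto (fun s => A' s ω) (𝓝[<] t) (𝓝 l)) ∧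
      ContinuousWithinAt (fun s => B' s ω) (Set.Ioi t) t ∧
      (∃ l, Tendsto (fun s => B' s ω) (𝓝[<] t) (𝓝 l)) ∧
      A' t ω ≤ B' t ω)

end Dominance

/-! ### The min–max rate -/

section Rates

variable {N : ℕ}

/-- `p S n` is the fraction of the jobs with server selection `S` that is assigned to `n ∈ S`. -/
def IsSplit (lam : Finset (Fin N) → ℝ) (p : Finset (Fin N) → Fin N → ℝ) : Prop :=
  ∀ S, 0 < lam S → (∀ n ∈ S, 0 ≤ p S n) ∧ ∑ n ∈ S, p S n = 1

/-- The arrival rate `∑_{S ∋ n} λ_S p_{Sn}` at server `n`, the sum being over the selections with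
a strictly positive rate. -/
def splitRate (lam : Finset (Fin N) → ℝ) (p : Finset (Fin N) → Fin N → ℝ) (n : Fin N) : ℝ :=
  ∑ S : Finset (Fin N) with 0 < lam S ∧ n ∈ S, lam S * p S n

/-- The values `max_n ∑_{S ∋ n} λ_S p_{Sn}`, over all splits `p`. -/
def maxRates (lam : Finset (Fin N) → ℝ) : Set ℝ :=
  {r | ∃ p, IsSplit lam p ∧ r = ⨆ n, splitRate lam p n}

/-- `λ_0 = min_p max_n ∑_{S ∋ n} λ_S p_{Sn}`. -/
def minMaxRate (lam : Finset (Fin N) → ℝ) : ℝ := sInf (maxRates lam)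

end Rates

/-! ### The two queueing systems -/

section Systems

variable {N : ℕ}

/-- A configuration of the affinity-scheduling system: `x n = (i, j)` if server `n` has
`i` type I and `j` type II jobs. -/
abbrev AffState (N : ℕ) := Fin N → ℕ × ℕ

/-- A configuration of the reference system: the number of jobs at every server. -/
abbrev RefState (N : ℕ) := Fin N → ℕ

/-- The servers to which the allocation strategy may send a job with primary selection `S`:
an idle server of `S` if there is one; else an idle server outside `S` if there is one; else a
server of `S` with the smallest number of type I jobs, ties being broken in favour of the
smallest number of type II jobs. -/
def Eligible (x : AffState N) (S : Finset (Fin N)) (n : Fin N) : Prop :=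
  ((∃ k ∈ S, x k = (0, 0)) ∧ n ∈ S ∧ x n = (0, 0)) ∨
  ((¬ ∃ k ∈ S, x k = (0, 0)) ∧ (∃ k ∉ S, x k = (0, 0)) ∧ n ∉ S ∧ x n = (0, 0)) ∨
  ((¬ ∃ k, x k = (0, 0)) ∧ n ∈ S ∧
    ∀ k ∈ S, (x n).1 < (x k).1 ∨ ((x n).1 = (x k).1 ∧ (x n).2 ≤ (x k).2))

/-- `alloc x S n` is the probability that a job with primary selection `S` that finds the
configuration `x` is sent to server `n`.  The choice among several eligible servers is arbitrary,
possibly randomised. -/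
structure IsAllocationRule (alloc : AffState N → Finset (Fin N) → Fin N → ℝ) : Prop where
  nonneg : ∀ x S n, S.Nonempty → 0 ≤ alloc x S n
  sum_eq_one : ∀ x S, S.Nonempty → ∑ n, alloc x S n = 1
  eligible : ∀ x S n, S.Nonempty → alloc x S n ≠ 0 → Eligible x S n

/-- The configuration after a job with primary selection `S` has joined server `n`: as a type I job
if `n ∈ S`, and as a type II job otherwise. -/
def joinServer (x : AffState N) (S : Finset (Fin N)) (n : Fin N) : AffState N :=
  Function.update x n
    (if n ∈ S then ((x n).1 + 1, (x n).2) else ((x n).1, (x n).2 + 1))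

/-- Generator of the affinity-scheduling system: jobs with selection `S` arrive at rate `lam S`;
a server with type I jobs completes one of them at rate `μ₁`, a server with only type II jobs
completes one of them at rate `μ₂` (preemptive priority for type I). -/
def affGenerator (μ₁ μ₂ : ℝ) (lam : Finset (Fin N) → ℝ)
    (alloc : AffState N → Finset (Fin N) → Fin N → ℝ) : Generator (AffState N) :=
  fun f x =>
    (∑ S, lam S * ∑ n, alloc x S n * (f (joinServer x S n) - f x)) +
    ∑ n, (if 0 < (x n).1 then
            μ₁ * (f (Function.update x n ((x n).1 - 1, (x n).2)) - f x)
          else if 0 < (x n).2 then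
            μ₂ * (f (Function.update x n ((x n).1, (x n).2 - 1)) - f x)
          else 0)

/-- Generator of the reference system under random assignment: jobs arrive at total rate `r * N`
and each joins a server chosen uniformly at random; every non-empty server completes jobs at
rate `μ₁`. -/
def raGenerator (μ₁ r : ℝ) : Generator (RefState N) :=
  fun f y =>
    ((r * N) * ∑ n, (N : ℝ)⁻¹ * (f (Function.update y n (y n + 1)) - f y)) +
    ∑ n, (if 0 < y n then μ₁ * (f (Function.update y n (y n - 1)) - f y) else 0)

/-- The number of type I jobs at every server. -/
def typeI (x : AffState N) : Fin N → ℕ := fun n => (x n).1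

/-- `Q̄_i`: the number of servers with at least `i` jobs (of the type counted by `c`). -/
def occupancy (c : Fin N → ℕ) (i : ℕ) : ℕ := (Finset.univ.filter fun n => i ≤ c n).card

/-- The tail-sum vector `(∑_{i ≥ m} Q̄_i)_{m ≥ 1}`; the sum has finitely many non-zero terms. -/
def tailSums (c : Fin N → ℕ) : ℕ+ → ℕ := fun m => ∑' i : ℕ, occupancy c (m + i)

end Systems

end

set_option linter.unusedSectionVars false

/-! Dominance comes from a coupling of the two chains by ranks. Let `p` be a split attaining the
min–max rate. When a job with selection `S` arrives and is sent to a server `n`, draw in addition a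
server `k ∈ S` with probabilities `p S k`, and let the reference job join the server whose rank in
the reference system is that of `k` among the type I counts. If `n ∈ S`, eligibility says that `n`
has no more type I jobs than `k`, and adding one job at `n` and one at the partner of `k` keeps the
tail sums ordered (`tailSums_le_inc`). If `n ∉ S`, only the reference system gains a counted job.
Further reference arrivals, at rate `r - splitRate lam p k ≥ 0` for each `k`, bring the rate at
every reference server up to `r`. Potential departures at rate `μ₁` are matched by rank too
(`tailSums_le_dec`), and departures of type II jobs are not seen by the tail sums. So the ordered
pairs form an invariant set (`coupledStep_mem`), while both marginal generators are the right ones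
(`coupled_fst`, `coupled_snd`). A coupling of the initial tail sums lifts to one of the initial
configurations by conditional sampling (`exists_coupling_of_map`).

Generators become processes by uniformization: all rates are bounded, so `L = γ (K - 1)` with a
Markov operator `K`, and the process follows the chain of `K` at the jumps of a Poisson clock of
rate `γ`. `exists_jumpProcess` constructs it from i.i.d. noise, `jumpProb_eq_transProb` identifies
the transition probabilities of its images, and `IsMarkovJumpProcess.map_eq` shows that generator
and initial law determine the law of the process.

Stability does not use the coupling, but a Lyapunov function and Harris' theorem (`exists_lyapunov`,
`IsMarkovOp.exists_stationary`). Write `T` for the number of type I jobs, `W = ∑ z ^ (x n).1` and `J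
= ∑ ((x n).2 - 1)`. Sending jobs to the shortest queue of `S` is at least as good for `W` as
splitting them by `p`, so `W` has geometric drift when `r < μ₁`. Type II jobs join idle servers
only, so `J` never increases, and it decreases at rate at least `μ₂` when `T = 0 < J`. The function
is `(C + η W - ρ ^ T) 2 ^ J`: the term `-ρ ^ T` makes the drift of the first factor negative at
every `T ≠ 0`, however small, so that large `J` does no harm there; at `T = 0` the possible decrease
of `J` compensates. The empty configuration is the reachable atom. -/

noncomputable section

/-! ### Concatenation of i.i.d. sequences -/

section Glue
variable {M : Type*} [MeasurableSpace M]

/-- The sequence that follows the first argument up to time `k` and the second one afterwards. -/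
def glue (k : ℕ) (p : (ℕ → M) × (ℕ → M)) : ℕ → M :=
  fun i => if i < k then p.1 i else p.2 (i - k)

lemma measurable_glue (k : ℕ) : Measurable (glue (M := M) k) := by
  refine measurable_pi_lambda _ fun i => ?_
  unfold glue
  split_ifs <;> fun_prop

/-- A product measure is determined by finite rectangles. The preimage of a rectangle is a product
of two: the factors with index below `k`, and the others shifted down by `k`. -/
lemma map_glue (μ : Measure M) [IsProbabilityMeasure μ] (k : ℕ) :
    ((Measure.infinitePi fun _ : ℕ => μ).prod (Measure.infinitePi fun _ : ℕ => μ)).map (glue k)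
      = Measure.infinitePi fun _ : ℕ => μ := by
  refine Measure.eq_infinitePi _ fun s t ht => ?_
  have hpre : glue k ⁻¹' (Set.pi s t) =
      (Set.pi (s.filter (· < k) : Finset ℕ) t) ×ˢ
        (Set.pi ((s.filter (¬ · < k)).image (· - k) : Finset ℕ) fun i => t (i + k)) := by
    ext ⟨a, b⟩
    simp only [Set.mem_preimage, Set.mem_pi, Finset.mem_coe, Set.mem_prod, Finset.mem_filter,
      Finset.mem_image, glue]
    constructor
    · intro h
      refine ⟨fun i hi => by simpa [hi.2] using h i hi.1, ?_⟩
      rintro _ ⟨i, hi, rfl⟩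
      have := h i hi.1
      rw [if_neg hi.2] at this
      simpa [Nat.sub_add_cancel (not_lt.1 hi.2)] using this
    · rintro ⟨h1, h2⟩ i hi
      split_ifs with hik
      · exact h1 i ⟨hi, hik⟩
      · have := h2 (i - k) ⟨i, ⟨hi, hik⟩, rfl⟩
        simpa [Nat.sub_add_cancel (not_lt.1 hik)] using this
  rw [Measure.map_apply (measurable_glue k)
    (MeasurableSet.pi s.countable_toSet fun i _ => ht i), hpre, Measure.prod_prod,
    Measure.infinitePi_pi _ (fun i _ => ht i), Measure.infinitePi_pi _ (fun i _ => ht _),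
    Finset.prod_image, ← Finset.prod_filter_mul_prod_filter_not s (· < k)]
  · congr 1
    refine Finset.prod_congr rfl fun i hi => ?_
    rw [Nat.sub_add_cancel (not_lt.1 (Finset.mem_filter.1 hi).2)]
  · intro i hi j hj h
    simp only [Finset.coe_filter, Set.mem_ofPred_eq, not_lt] at hi hj
    simp only at h
    omega

end Glue

/-! ### The exponential law and its lack of memory -/

section Exponential

lemma expMeasure_Ioi {γ : ℝ} (hγ : 0 < γ) {a : ℝ} (ha : 0 ≤ a) :
    expMeasure γ (Set.Ioi a) = ENNReal.ofReal (Real.exp (-(γ * a))) := by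
  have := isProbabilityMeasure_expMeasure hγ
  have h := cdf_expMeasure_eq hγ a
  rw [if_pos ha, cdf_eq_real] at h
  have h2 : (expMeasure γ).real (Set.Ioi a) = Real.exp (-(γ * a)) := by
    rw [← Set.compl_Iic, probReal_compl_eq_one_sub measurableSet_Iic, h]; ring
  rw [← h2, ofReal_measureReal]

lemma expMeasure_Iic_zero {γ : ℝ} (hγ : 0 < γ) : expMeasure γ (Set.Iic 0) = 0 := by
  have := isProbabilityMeasure_expMeasure hγ
  have h := cdf_expMeasure_eq hγ 0
  rw [if_pos le_rfl, cdf_eq_real] at h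
  simpa [measureReal_eq_zero_iff] using h

/-- Half-lines suffice. For `a ≥ 0` the left side is the mass `exp(-γ r) - exp(-γ (a + r))` of `(r,
a + r]`, which factors; for `a ≤ 0` both sides vanish. -/
lemma expMeasure_memoryless {γ : ℝ} (hγ : 0 < γ) {r : ℝ} (hr : 0 ≤ r) :
    ((expMeasure γ).restrict (Set.Ioi r)).map (fun x => x - r)
      = ENNReal.ofReal (Real.exp (-(γ * r))) • expMeasure γ := by
  have := isProbabilityMeasure_expMeasure hγ
  have key : ∀ a : ℝ, 0 ≤ a → expMeasure γ (Set.Iic a) = 1 - ENNReal.ofReal (Real.exp (-(γ * a))) := by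
    intro a ha
    rw [← expMeasure_Ioi hγ ha, ← Set.compl_Iic, prob_compl_eq_one_sub measurableSet_Iic]
    exact (ENNReal.sub_sub_cancel (by simp) prob_le_one).symm
  refine Measure.ext_of_Iic _ _ fun a => ?_
  rw [Measure.map_apply (by fun_prop) measurableSet_Iic, Measure.restrict_apply
    (measurableSet_Iic.preimage (by fun_prop)), Measure.smul_apply, smul_eq_mul]
  have hset : (fun x : ℝ => x - r) ⁻¹' Set.Iic a ∩ Set.Ioi r = Set.Ioc r (a + r) := by
    ext x
    simp only [Set.mem_inter_iff, Set.mem_preimage, Set.mem_Iic, Set.mem_Ioi, Set.mem_Ioc,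
      sub_le_iff_le_add]
    tauto
  rw [hset]
  rcases le_total 0 a with ha | ha
  · have : Set.Ioc r (a + r) = Set.Ioi r \ Set.Ioi (a + r) := by
      ext x; simp
    rw [this, measure_sdiff (Set.Ioi_subset_Ioi (by linarith)) measurableSet_Ioi.nullMeasurableSet
      (by simp), expMeasure_Ioi hγ hr, expMeasure_Ioi hγ (by linarith), key a ha,
      ENNReal.mul_sub (fun _ _ => by simp), mul_one, ← ENNReal.ofReal_mul (by positivity),
      ← Real.exp_add]
    ring_nf
  · have h0 : expMeasure γ (Set.Iic a) = 0 :=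
      measure_mono_null (Set.Iic_subset_Iic.2 ha) (expMeasure_Iic_zero hγ)
    rw [h0, mul_zero, Set.Ioc_eq_empty (by simpa using ha), measure_empty]

end Exponential

/-! ### A jump process driven by waiting times and random maps -/

section Clock
variable {E : Type*}

/-- The time of the `n`-th jump, for noise `ω` that consists of the waiting times and the
random maps applied at the jumps. -/
def jumpTime (ω : ℕ → ℝ × (E → E)) (n : ℕ) : ℝ := ∑ i ∈ Finset.range n, (ω i).1

/-- The successive states, from the initial state `x`. -/
def skeleton (x : E) (ω : ℕ → ℝ × (E → E)) : ℕ → E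
  | 0 => x
  | n + 1 => (ω n).2 (skeleton x ω n)

/-- The number of jumps up to time `t`. -/
def jumpCount (ω : ℕ → ℝ × (E → E)) (t : ℝ) : ℕ := sInf {n | t < jumpTime ω (n + 1)}

/-- The event that there are `k` jumps up to time `t`. -/
def countEvent (E : Type*) (k : ℕ) (t : ℝ) : Set (ℕ → ℝ × (E → E)) :=
  {ω | (∀ j < k, jumpTime ω (j + 1) ≤ t) ∧ t < jumpTime ω (k + 1)}

/-- The state at time `t`. -/
def jumpPath (x : E) (ω : ℕ → ℝ × (E → E)) (t : ℝ) : E := skeleton x ω (jumpCount ω t)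

lemma jumpCount_of_mem {ω : ℕ → ℝ × (E → E)} {k : ℕ} {t : ℝ} (h : ω ∈ countEvent E k t) :
    jumpCount ω t = k := by
  refine le_antisymm (Nat.sInf_le h.2) (le_csInf ⟨k, h.2⟩ fun n hn => ?_)
  by_contra hlt
  exact absurd (h.1 n (not_le.1 hlt)) (not_le.2 hn)

lemma mem_countEvent_jumpCount {ω : ℕ → ℝ × (E → E)} {t : ℝ} (h : ∃ n, t < jumpTime ω (n + 1)) :
    ω ∈ countEvent E (jumpCount ω t) t :=
  ⟨fun _ hj => not_lt.1 (Nat.notMem_of_lt_sInf hj), Nat.sInf_mem h⟩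

lemma countEvent_disjoint {t : ℝ} : Pairwise (Function.onFun Disjoint fun k => countEvent E k t) := by
  intro i j hij
  refine Set.disjoint_left.2 fun ω hi hj => hij ?_
  rw [← jumpCount_of_mem hi, jumpCount_of_mem hj]

lemma jumpTime_succ_glue (a b : ℕ → ℝ × (E → E)) (n : ℕ) :
    jumpTime (glue 1 (a, b)) (n + 1) = (a 0).1 + jumpTime b n := by
  simp [jumpTime, Finset.sum_range_succ', glue, add_comm]

lemma skeleton_succ_glue (x : E) (a b : ℕ → ℝ × (E → E)) (n : ℕ) :
    skeleton x (glue 1 (a, b)) (n + 1) = skeleton ((a 0).2 x) b n := by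
  induction n with
  | zero => simp [skeleton, glue]
  | succ n ih =>
    rw [skeleton, ih, skeleton]
    simp [glue]

variable [Countable E] [MeasurableSpace E] [MeasurableSingletonClass E]

lemma measurable_jumpTime (n : ℕ) : Measurable fun ω : ℕ → ℝ × (E → E) => jumpTime ω n := by
  unfold jumpTime
  fun_prop

lemma measurable_skeleton (n : ℕ) :
    Measurable fun p : E × (ℕ → ℝ × (E → E)) => skeleton p.1 p.2 n := by
  induction n with
  | zero => exact measurable_fst
  | succ n ih =>
    -- Evaluation is jointly measurable because the state space is countable.
    have he : Measurable fun q : (E → E) × E => q.1 q.2 :=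
      measurable_from_prod_countable_left fun y => measurable_pi_apply y
    exact he.comp ((((measurable_pi_apply n).comp measurable_snd).snd).prodMk ih)

lemma measurableSet_countEvent (k : ℕ) (t : ℝ) : MeasurableSet (countEvent E k t) := by
  have : countEvent E k t = (⋂ j ∈ Set.Iio k, {ω | jumpTime ω (j + 1) ≤ t}) ∩
      {ω | t < jumpTime ω (k + 1)} := by
    ext ω; simp [countEvent]
  rw [this]
  exact (MeasurableSet.biInter (Set.to_countable _) fun j _ =>
    measurableSet_le (measurable_jumpTime _) measurable_const).inter
      (measurableSet_lt measurable_const (measurable_jumpTime _))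

lemma measurable_jumpCount (t : ℝ) : Measurable fun ω : ℕ → ℝ × (E → E) => jumpCount ω t := by
  have hno : MeasurableSet {ω : ℕ → ℝ × (E → E) | ¬ ∃ n, t < jumpTime ω (n + 1)} := by
    simp only [not_exists, not_lt, Set.ofPred_forall]
    exact MeasurableSet.iInter fun n => measurableSet_le (measurable_jumpTime _) measurable_const
  refine measurable_to_countable' fun k => ?_
  -- Since `sInf ∅ = 0`, noise whose jump times never exceed `t` is counted under `k = 0`.
  have : (fun ω : ℕ → ℝ × (E → E) => jumpCount ω t) ⁻¹' {k} =
      countEvent E k t ∪ {ω | (¬ ∃ n, t < jumpTime ω (n + 1)) ∧ k = 0} := by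
    ext ω
    simp only [Set.mem_preimage, Set.mem_singleton_iff, Set.mem_union, Set.mem_ofPred_eq]
    constructor
    · rintro rfl
      by_cases h : ∃ n, t < jumpTime ω (n + 1)
      · exact Or.inl (mem_countEvent_jumpCount h)
      · refine Or.inr ⟨h, ?_⟩
        have : {n | t < jumpTime ω (n + 1)} = ∅ := by
          ext n; simpa using fun hn => h ⟨n, hn⟩
        rw [jumpCount, this, Nat.sInf_empty]
    · rintro (h | ⟨h, rfl⟩)
      · exact jumpCount_of_mem h
      · have : {n | t < jumpTime ω (n + 1)} = ∅ := by
          ext n; simpa using fun hn => h ⟨n, hn⟩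
        rw [jumpCount, this, Nat.sInf_empty]
  rw [this]
  refine (measurableSet_countEvent k t).union ?_
  by_cases hk : k = 0 <;> simp [hk]
  simpa using hno

lemma measurable_jumpPath (t : ℝ) :
    Measurable fun p : E × (ℕ → ℝ × (E → E)) => jumpPath p.1 p.2 t := by
  have h : Measurable fun q : (E × (ℕ → ℝ × (E → E))) × ℕ => skeleton q.1.1 q.1.2 q.2 :=
    measurable_from_prod_countable_left fun n => measurable_skeleton n
  exact h.comp (measurable_id.prodMk ((measurable_jumpCount t).comp measurable_snd))

/-- The law of one waiting time and one random map. -/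
def noiseLaw (γ : ℝ) (κ : E → Measure E) : Measure (ℝ × (E → E)) :=
  (expMeasure γ).prod (Measure.infinitePi κ)

/-- The law of the noise. -/
def noiseSeqLaw (γ : ℝ) (κ : E → Measure E) : Measure (ℕ → ℝ × (E → E)) :=
  Measure.infinitePi fun _ => noiseLaw γ κ

/-- The Poisson probabilities. -/
def poissonWeight (γ : ℝ) (k : ℕ) (t : ℝ) : ℝ := Real.exp (-(γ * t)) * (γ * t) ^ k / k !

/-- The `k`-step transition probabilities to a set. -/
def stepProb (κ : E → Measure E) (B : Set E) : ℕ → E → ENNReal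
  | 0 => B.indicator 1
  | k + 1 => fun x => ∫⁻ y, stepProb κ B k y ∂κ x

variable {γ : ℝ} {κ : E → Measure E} [∀ x, IsProbabilityMeasure (κ x)]

lemma isProbabilityMeasure_noiseLaw (hγ : 0 < γ) : IsProbabilityMeasure (noiseLaw γ κ) := by
  have := isProbabilityMeasure_expMeasure hγ
  unfold noiseLaw
  infer_instance

lemma isProbabilityMeasure_noiseSeqLaw (hγ : 0 < γ) : IsProbabilityMeasure (noiseSeqLaw γ κ) := by
  have := isProbabilityMeasure_noiseLaw (κ := κ) hγ
  unfold noiseSeqLaw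
  infer_instance

/-- First-jump decomposition of the Poisson law: `k + 1` jumps by time `t` are a first jump at some
`e ≤ t` and `k` jumps in the remaining `t - e`. The exponentials combine to `exp(-γ t)`, and
integrating `(t - e) ^ k` raises the degree. -/
lemma lintegral_expMeasure_poissonWeight (hγ : 0 < γ) (k : ℕ) {t : ℝ} (ht : 0 ≤ t) :
    ∫⁻ e, (Set.Iic t).indicator (fun e => ENNReal.ofReal (poissonWeight γ k (t - e))) e ∂expMeasure γ
      = ENNReal.ofReal (poissonWeight γ (k + 1) t) := by
  have hmeas : Measurable fun e =>
      (Set.Iic t).indicator (fun e => ENNReal.ofReal (poissonWeight γ k (t - e))) e := by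
    refine Measurable.indicator ?_ measurableSet_Iic
    unfold poissonWeight
    fun_prop
  have hpdf : Measurable (exponentialPDF γ) :=
    ENNReal.measurable_ofReal.comp (measurable_exponentialPDFReal γ)
  change ∫⁻ e, _ ∂(volume.withDensity (exponentialPDF γ)) = _
  rw [lintegral_withDensity_eq_lintegral_mul _ hpdf hmeas]
  have hfun : (exponentialPDF γ * fun e =>
      (Set.Iic t).indicator (fun e => ENNReal.ofReal (poissonWeight γ k (t - e))) e) =
      (Set.Icc 0 t).indicator fun e => ENNReal.ofReal
        (Real.exp (-(γ * t)) * γ ^ (k + 1) / k ! * (t - e) ^ k) := by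
    ext e
    simp only [Pi.mul_apply, Set.indicator_apply, Set.mem_Iic, Set.mem_Icc]
    by_cases h0 : 0 ≤ e
    · rw [exponentialPDF_of_nonneg h0]
      by_cases h1 : e ≤ t
      · simp only [h0, h1, if_true, and_self]
        rw [← ENNReal.ofReal_mul (by positivity), poissonWeight, mul_pow]
        congr 1
        have : Real.exp (-(γ * t)) = Real.exp (-(γ * e)) * Real.exp (-(γ * (t - e))) := by
          rw [← Real.exp_add]; ring_nf
        rw [this]
        ring
      · simp [h1]
    · rw [exponentialPDF_of_neg (not_le.1 h0)]
      simp [h0]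
  rw [hfun, lintegral_indicator measurableSet_Icc, ← ofReal_integral_eq_lintegral_ofReal,
    integral_Icc_eq_integral_Ioc, ← intervalIntegral.integral_of_le ht,
    intervalIntegral.integral_const_mul,
    intervalIntegral.integral_comp_sub_left (fun x => x ^ k) t, sub_self, sub_zero, integral_pow]
  · congr 1
    rw [poissonWeight, Nat.factorial_succ]
    push_cast
    field_simp
    simp [mul_pow]
  · exact (Continuous.integrableOn_Icc (by fun_prop))
  · refine (ae_restrict_mem measurableSet_Icc).mono fun e he => ?_
    have : 0 ≤ t - e := sub_nonneg.2 he.2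
    positivity

/-- Induction on `k` by conditioning on the first noise entry `(e, m)`: the event turns into the one
with `k` jumps by time `t - e` from the state `m x`. Waiting time and map are independent, so the
integral splits into the recursion of the Poisson weights and that of `stepProb`. -/
lemma noiseSeqLaw_countEvent (hγ : 0 < γ) (B : Set E) (k : ℕ) :
    ∀ (x : E) {t : ℝ}, 0 ≤ t → noiseSeqLaw γ κ (countEvent E k t ∩ {ω | skeleton x ω k ∈ B})
      = ENNReal.ofReal (poissonWeight γ k t) * stepProb κ B k x := by
  have := isProbabilityMeasure_noiseLaw (κ := κ) hγ
  have := isProbabilityMeasure_noiseSeqLaw (κ := κ) hγ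
  have := isProbabilityMeasure_expMeasure hγ
  induction k with
  | zero =>
    intro x t ht
    have h1 : countEvent E 0 t ∩ {ω | skeleton x ω 0 ∈ B} =
        (fun ω => ω 0) ⁻¹' (Set.Ioi t ×ˢ {_m | x ∈ B}) := by
      ext ω; simp [countEvent, jumpTime, skeleton]
    rw [h1, noiseSeqLaw, ← Measure.map_apply (by fun_prop) (measurableSet_Ioi.prod (by simp)),
      Measure.infinitePi_map_eval (fun _ => noiseLaw γ κ) 0, noiseLaw, Measure.prod_prod,
      expMeasure_Ioi hγ ht]
    by_cases hx : x ∈ B <;> simp [poissonWeight, stepProb, hx]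
  | succ k ih =>
    intro x t ht
    have hm : MeasurableSet (countEvent E (k + 1) t ∩ {ω | skeleton x ω (k + 1) ∈ B}) :=
      (measurableSet_countEvent _ _).inter
        (((measurable_skeleton (k + 1)).comp measurable_prodMk_left) (.of_discrete (s := B)))
    have hpre : ∀ a : ℕ → ℝ × (E → E), Prod.mk a ⁻¹' (glue 1 ⁻¹'
        (countEvent E (k + 1) t ∩ {ω | skeleton x ω (k + 1) ∈ B})) =
        {b | (a 0).1 ≤ t} ∩ (countEvent E k (t - (a 0).1) ∩ {ω | skeleton ((a 0).2 x) ω k ∈ B}) := by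
      intro a
      ext b
      simp only [countEvent, Set.mem_preimage, Set.mem_inter_iff, Set.mem_ofPred_eq,
        jumpTime_succ_glue, skeleton_succ_glue, le_sub_iff_add_le', sub_lt_iff_lt_add']
      constructor
      · rintro ⟨⟨h1, h2⟩, h3⟩
        refine ⟨by simpa [jumpTime] using h1 0 (by omega), ⟨fun j hj => h1 (j + 1) (by omega), h2⟩, h3⟩
      · rintro ⟨h0, ⟨h1, h2⟩, h3⟩
        refine ⟨⟨fun j hj => ?_, h2⟩, h3⟩
        rcases j with _ | j
        · simpa [jumpTime] using h0
        · exact h1 j (by omega)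
    have hslice : ∀ a : ℕ → ℝ × (E → E), noiseSeqLaw γ κ (Prod.mk a ⁻¹' (glue 1 ⁻¹'
        (countEvent E (k + 1) t ∩ {ω | skeleton x ω (k + 1) ∈ B}))) =
        (fun p : ℝ × (E → E) =>
          (Set.Iic t).indicator (fun e => ENNReal.ofReal (poissonWeight γ k (t - e))) p.1 *
            stepProb κ B k (p.2 x)) (a 0) := by
      intro a
      rw [hpre]
      by_cases h0 : (a 0).1 ≤ t
      · simp only [h0, Set.ofPred_true, Set.univ_inter, Set.mem_Iic, Set.indicator_of_mem]
        rw [ih _ (sub_nonneg.2 h0)]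
      · simp [h0]
    have hmeas : Measurable fun e =>
        (Set.Iic t).indicator (fun e => ENNReal.ofReal (poissonWeight γ k (t - e))) e := by
      refine Measurable.indicator ?_ measurableSet_Iic
      unfold poissonWeight
      fun_prop
    have hmeas2 : Measurable fun m : E → E => stepProb κ B k (m x) :=
      (Measurable.of_discrete (f := stepProb κ B k)).comp (measurable_pi_apply x)
    conv_lhs => rw [noiseSeqLaw, ← map_glue (noiseLaw γ κ) 1]
    rw [Measure.map_apply (measurable_glue 1) hm, Measure.prod_apply (measurable_glue 1 hm)]
    change ∫⁻ a, noiseSeqLaw γ κ _ ∂noiseSeqLaw γ κ = _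
    simp_rw [hslice]
    rw [noiseSeqLaw, ← lintegral_map (f := fun p : ℝ × (E → E) =>
          (Set.Iic t).indicator (fun e => ENNReal.ofReal (poissonWeight γ k (t - e))) p.1 *
            stepProb κ B k (p.2 x)) (g := fun a : ℕ → ℝ × (E → E) => a 0)
          ((hmeas.comp measurable_fst).mul (hmeas2.comp measurable_snd)) (by fun_prop),
      Measure.infinitePi_map_eval (fun _ => noiseLaw γ κ) 0, noiseLaw,
      lintegral_prod_mul hmeas.aemeasurable hmeas2.aemeasurable,
      lintegral_expMeasure_poissonWeight hγ k ht, stepProb]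
    congr 1
    -- Only the coordinate of the random map at the current state matters, and its law is `κ x`.
    rw [← lintegral_map (f := stepProb κ B k) (g := fun m : E → E => m x) .of_discrete
      (measurable_pi_apply x), Measure.infinitePi_map_eval κ x]

end Clock

/-! ### Past and future of the noise at a fixed time -/

section Regeneration
variable {E : Type*}

/-- The noise in which the first waiting time is reduced by `r`. -/
def shiftFirst (r : ℝ) (b : ℕ → ℝ × (E → E)) : ℕ → ℝ × (E → E) :=
  Function.update b 0 ((b 0).1 - r, (b 0).2)

/-- The noise before the `k`-th jump, continued by a jump after time `s`. -/
def pastNoise (k : ℕ) (s : ℝ) (ω : ℕ → ℝ × (E → E)) : ℕ → ℝ × (E → E) :=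
  fun i => if i < k then ω i else (s + 1 - jumpTime ω k, id)

/-- The noise after time `s`, if there are `k` jumps up to time `s`. -/
def futureNoise (k : ℕ) (s : ℝ) (ω : ℕ → ℝ × (E → E)) : ℕ → ℝ × (E → E) :=
  shiftFirst (s - jumpTime ω k) fun i => ω (k + i)

lemma jumpTime_congr {ω ω' : ℕ → ℝ × (E → E)} {n : ℕ} (h : ∀ i < n, ω i = ω' i) :
    jumpTime ω n = jumpTime ω' n :=
  Finset.sum_congr rfl fun i hi => by rw [h i (Finset.mem_range.1 hi)]

lemma skeleton_congr {ω ω' : ℕ → ℝ × (E → E)} {n : ℕ} (h : ∀ i < n, ω i = ω' i) (x : E) :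
    skeleton x ω n = skeleton x ω' n := by
  induction n with
  | zero => rfl
  | succ n ih => rw [skeleton, skeleton, h n (by omega), ih fun i hi => h i (by omega)]

lemma glue_of_lt (a b : ℕ → ℝ × (E → E)) {k i : ℕ} (h : i < k) : glue k (a, b) i = a i := if_pos h

lemma glue_add (a b : ℕ → ℝ × (E → E)) (k i : ℕ) : glue k (a, b) (k + i) = b i := by
  simp [glue]

lemma jumpTime_glue (a b : ℕ → ℝ × (E → E)) {k j : ℕ} (h : j ≤ k) :
    jumpTime (glue k (a, b)) j = jumpTime a j :=
  jumpTime_congr fun _ hi => glue_of_lt a b (hi.trans_le h)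

lemma pastNoise_glue (a b : ℕ → ℝ × (E → E)) (k : ℕ) (s : ℝ) :
    pastNoise k s (glue k (a, b)) = pastNoise k s a := by
  funext i
  unfold pastNoise
  rw [jumpTime_glue a b le_rfl]
  split_ifs with h
  · exact glue_of_lt a b h
  · rfl

lemma futureNoise_glue (a b : ℕ → ℝ × (E → E)) (k : ℕ) (s : ℝ) :
    futureNoise k s (glue k (a, b)) = shiftFirst (s - jumpTime a k) b := by
  unfold futureNoise
  rw [jumpTime_glue a b le_rfl]
  simp only [glue_add]

lemma jumpTime_succ_last (ω : ℕ → ℝ × (E → E)) (k : ℕ) :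
    jumpTime ω (k + 1) = jumpTime ω k + (ω k).1 := Finset.sum_range_succ _ _

lemma mem_countEvent_glue {a b : ℕ → ℝ × (E → E)} {k : ℕ} {s : ℝ} :
    glue k (a, b) ∈ countEvent E k s ↔
      (∀ j < k, jumpTime a (j + 1) ≤ s) ∧ s - jumpTime a k < (b 0).1 := by
  have h1 : glue k (a, b) k = b 0 := glue_add a b k 0
  unfold countEvent
  rw [Set.mem_ofPred_eq, jumpTime_succ_last, jumpTime_glue a b le_rfl, h1, sub_lt_iff_lt_add']
  refine and_congr (forall₂_congr fun j hj => ?_) Iff.rfl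
  rw [jumpTime_glue a b hj]

lemma jumpTime_futureNoise (ω : ℕ → ℝ × (E → E)) (k : ℕ) (s : ℝ) (j : ℕ) :
    jumpTime (futureNoise k s ω) (j + 1) = jumpTime ω (k + (j + 1)) - s := by
  induction j with
  | zero =>
    have : jumpTime ω (k + (0 + 1)) = jumpTime ω k + (ω k).1 := jumpTime_succ_last ω k
    rw [this]
    simp [jumpTime, futureNoise, shiftFirst]
    ring
  | succ j ih =>
    have : jumpTime ω (k + (j + 1 + 1)) = jumpTime ω (k + (j + 1)) + (ω (k + (j + 1))).1 :=
      jumpTime_succ_last ω _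
    rw [jumpTime_succ_last, ih, this]
    simp [futureNoise, shiftFirst]
    ring

lemma skeleton_futureNoise (ω : ℕ → ℝ × (E → E)) (k : ℕ) (s : ℝ) (x : E) (j : ℕ) :
    skeleton (skeleton x ω k) (futureNoise k s ω) j = skeleton x ω (k + j) := by
  induction j with
  | zero => rfl
  | succ j ih =>
    rw [skeleton, ih, ← add_assoc, skeleton]
    rcases j with _ | j <;> simp [futureNoise, shiftFirst]

/-- Restarting the clock at `s` lowers every jump time after the `k`-th by `s`, so `m` jumps by time
`s + h` become `m - k` jumps by time `h`. -/
lemma jumpPath_futureNoise {ω : ℕ → ℝ × (E → E)} {k : ℕ} {s h : ℝ} (hh : 0 ≤ h)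
    (hω : ω ∈ countEvent E k s) (hex : ∃ n, s + h < jumpTime ω (n + 1)) (x : E) :
    jumpPath x ω (s + h) = jumpPath (skeleton x ω k) (futureNoise k s ω) h := by
  have hm := mem_countEvent_jumpCount hex
  set m := jumpCount ω (s + h) with hmdef
  have hkm : k ≤ m := by
    by_contra hlt
    have := hω.1 m (not_le.1 hlt)
    have := hm.2
    linarith
  have : futureNoise k s ω ∈ countEvent E (m - k) h := by
    refine ⟨fun j hj => ?_, ?_⟩
    · rw [jumpTime_futureNoise]
      have := hm.1 (k + j) (by omega)
      rw [← add_assoc]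
      linarith
    · rw [jumpTime_futureNoise, ← add_assoc, Nat.add_sub_cancel' hkm]
      have := hm.2
      linarith
  rw [jumpPath, jumpPath, jumpCount_of_mem this, skeleton_futureNoise, Nat.add_sub_cancel' hkm]

/-- Up to time `s` the path reads only the first `k` noise entries; the artificial next jump falls
at `s + 1`, too late to be seen. -/
lemma jumpPath_pastNoise {ω : ℕ → ℝ × (E → E)} {k : ℕ} {s u : ℝ} (hu : u ≤ s)
    (hω : ω ∈ countEvent E k s) (x : E) :
    jumpPath x (pastNoise k s ω) u = jumpPath x ω u := by
  have hpast : ∀ i < k, pastNoise k s ω i = ω i := fun i hi => if_pos hi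
  have hex : ∃ n, u < jumpTime ω (n + 1) := ⟨k, hu.trans_lt hω.2⟩
  have hm := mem_countEvent_jumpCount hex
  have hle : jumpCount ω u ≤ k := Nat.sInf_le (hu.trans_lt hω.2)
  set m := jumpCount ω u with hmdef
  have : pastNoise k s ω ∈ countEvent E m u := by
    refine ⟨fun j hj => ?_, ?_⟩
    · rw [jumpTime_congr (ω' := ω) fun i hi => hpast i (by omega)]
      exact hm.1 j hj
    · rcases hle.lt_or_eq with hlt | heq
      · rw [jumpTime_congr (ω' := ω) fun i hi => hpast i (by omega)]
        exact hm.2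
      · rw [heq, jumpTime_succ_last, jumpTime_congr (ω' := ω) hpast]
        simp only [pastNoise, lt_irrefl, if_false]
        linarith
  rw [jumpPath, jumpPath, jumpCount_of_mem this, skeleton_congr fun i hi => hpast i (by omega)]

variable [Countable E] [MeasurableSpace E] [MeasurableSingletonClass E]

lemma measurable_shiftFirst : Measurable fun p : ℝ × (ℕ → ℝ × (E → E)) => shiftFirst p.1 p.2 := by
  refine measurable_pi_lambda _ fun i => ?_
  unfold shiftFirst
  rcases i with _ | i <;> simp <;> fun_prop

lemma measurable_pastNoise (k : ℕ) (s : ℝ) : Measurable (pastNoise (E := E) k s) := by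
  refine measurable_pi_lambda _ fun i => ?_
  have := measurable_jumpTime (E := E) k
  unfold pastNoise
  split_ifs <;> fun_prop

lemma measurable_futureNoise (k : ℕ) (s : ℝ) : Measurable (futureNoise (E := E) k s) := by
  have := measurable_jumpTime (E := E) k
  exact measurable_shiftFirst.comp (Measurable.prodMk (by fun_prop) (by fun_prop))

variable {γ : ℝ} {κ : E → Measure E} [∀ x, IsProbabilityMeasure (κ x)]

lemma noiseLaw_memoryless (hγ : 0 < γ) {r : ℝ} (hr : 0 ≤ r) {S : Set (ℝ × (E → E))}
    (hS : MeasurableSet S) :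
    noiseLaw γ κ {m | r < m.1 ∧ (m.1 - r, m.2) ∈ S} =
      ENNReal.ofReal (Real.exp (-(γ * r))) * noiseLaw γ κ S := by
  have := isProbabilityMeasure_expMeasure hγ
  have hm : MeasurableSet {m : ℝ × (E → E) | r < m.1 ∧ (m.1 - r, m.2) ∈ S} :=
    (measurableSet_lt measurable_const measurable_fst).inter
      (hS.preimage (f := fun m : ℝ × (E → E) => (m.1 - r, m.2)) (by fun_prop))
  rw [noiseLaw, Measure.prod_apply_symm hm, Measure.prod_apply_symm hS,
    ← lintegral_const_mul _ (measurable_measure_prodMk_right hS)]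
  refine lintegral_congr fun f => ?_
  have hsec : MeasurableSet ((fun e : ℝ => (e, f)) ⁻¹' S) := hS.preimage (by fun_prop)
  have h := congrArg (fun μ : Measure ℝ => μ ((fun e : ℝ => (e, f)) ⁻¹' S))
    (expMeasure_memoryless hγ hr)
  simp only [Measure.smul_apply, smul_eq_mul] at h
  rw [Measure.map_apply (by fun_prop) hsec, Measure.restrict_apply (hsec.preimage (by fun_prop))] at h
  rw [← h]
  congr 1
  ext e
  simp [and_comm]

lemma map_cons_noise (hγ : 0 < γ) :
    ((noiseLaw γ κ).prod (noiseSeqLaw γ κ)).map (fun p => glue 1 (fun _ => p.1, p.2)) =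
      noiseSeqLaw γ κ := by
  have := isProbabilityMeasure_noiseLaw (κ := κ) hγ
  have := isProbabilityMeasure_noiseSeqLaw (κ := κ) hγ
  have hcons : Measurable fun p : (ℝ × (E → E)) × (ℕ → ℝ × (E → E)) =>
      glue 1 ((fun _ => p.1 : ℕ → ℝ × (E → E)), p.2) :=
    (measurable_glue 1).comp (by fun_prop)
  have h0 : (noiseSeqLaw γ κ).map (fun a => a 0) = noiseLaw γ κ :=
    Measure.infinitePi_map_eval (fun _ => noiseLaw γ κ) 0
  have h1 : (noiseSeqLaw γ κ).map id = noiseSeqLaw γ κ := Measure.map_id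
  conv_lhs => rw [← h0, ← h1, Measure.map_prod_map _ _ (by fun_prop) measurable_id]
  rw [Measure.map_map hcons (by fun_prop)]
  conv_rhs => rw [noiseSeqLaw, ← map_glue (noiseLaw γ κ) 1]
  change _ = ((noiseSeqLaw γ κ).prod (noiseSeqLaw γ κ)).map (glue 1)
  rw [Measure.map_id]
  congr 1
  funext ⟨a, b⟩ i
  rcases i with _ | i <;> simp [glue]

/-- Only the first waiting time is altered, so this is the one-entry statement integrated over the
remaining entries. -/
lemma noiseSeqLaw_memoryless (hγ : 0 < γ) {r : ℝ} (hr : 0 ≤ r) {G : Set (ℕ → ℝ × (E → E))}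
    (hG : MeasurableSet G) :
    noiseSeqLaw γ κ {b | r < (b 0).1 ∧ shiftFirst r b ∈ G} =
      ENNReal.ofReal (Real.exp (-(γ * r))) * noiseSeqLaw γ κ G := by
  have := isProbabilityMeasure_noiseLaw (κ := κ) hγ
  have := isProbabilityMeasure_noiseSeqLaw (κ := κ) hγ
  have hcons : Measurable fun p : (ℝ × (E → E)) × (ℕ → ℝ × (E → E)) =>
      glue 1 ((fun _ => p.1 : ℕ → ℝ × (E → E)), p.2) :=
    (measurable_glue 1).comp (by fun_prop)
  have hm : MeasurableSet {b : ℕ → ℝ × (E → E) | r < (b 0).1 ∧ shiftFirst r b ∈ G} :=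
    (measurableSet_lt (f := fun _ => r) (g := fun b : ℕ → ℝ × (E → E) => (b 0).1)
      measurable_const (by fun_prop)).inter
      (hG.preimage (measurable_shiftFirst.comp (measurable_prodMk_left (x := r))))
  conv_lhs => rw [← map_cons_noise (κ := κ) hγ]
  conv_rhs => rw [← map_cons_noise (κ := κ) hγ]
  rw [Measure.map_apply hcons hm, Measure.map_apply hcons hG, Measure.prod_apply_symm (hcons hm),
    Measure.prod_apply_symm (hcons hG), ← lintegral_const_mul _
      (measurable_measure_prodMk_right (hcons hG))]
  refine lintegral_congr fun b => ?_
  rw [← noiseLaw_memoryless hγ hr ((hcons hG).preimage measurable_prodMk_right)]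
  congr 1
  ext m
  have : shiftFirst r (glue 1 ((fun _ => m : ℕ → ℝ × (E → E)), b)) =
      glue 1 ((fun _ => (m.1 - r, m.2) : ℕ → ℝ × (E → E)), b) := by
    funext i
    rcases i with _ | i <;> simp [glue, shiftFirst]
  simp [this]
  simp [glue]

/-- Independence of past and future, given `k` jumps by time `s`. With the first `k` entries fixed,
what remains is that the next waiting time exceeds `s - jumpTime a k` and that the shortened noise
lies in `G`; by lack of memory this has probability `exp(-γ (s - jumpTime a k))` times the law of
`G`. -/
lemma noiseSeqLaw_regeneration (hγ : 0 < γ) (k : ℕ) {s : ℝ} (hs : 0 ≤ s)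
    {A G : Set (ℕ → ℝ × (E → E))} (hA : MeasurableSet A) (hG : MeasurableSet G) :
    noiseSeqLaw γ κ (pastNoise k s ⁻¹' A ∩ countEvent E k s ∩ futureNoise k s ⁻¹' G) =
      noiseSeqLaw γ κ (pastNoise k s ⁻¹' A ∩ countEvent E k s) * noiseSeqLaw γ κ G := by
  have := isProbabilityMeasure_noiseLaw (κ := κ) hγ
  have := isProbabilityMeasure_noiseSeqLaw (κ := κ) hγ
  have key : ∀ G : Set (ℕ → ℝ × (E → E)), MeasurableSet G →
      noiseSeqLaw γ κ (pastNoise k s ⁻¹' A ∩ countEvent E k s ∩ futureNoise k s ⁻¹' G) =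
        (∫⁻ a, ({a | pastNoise k s a ∈ A ∧ ∀ j < k, jumpTime a (j + 1) ≤ s}.indicator
          (fun a => ENNReal.ofReal (Real.exp (-(γ * (s - jumpTime a k))))) a) ∂noiseSeqLaw γ κ) *
          noiseSeqLaw γ κ G := by
    intro G hG
    have hm : MeasurableSet (pastNoise k s ⁻¹' A ∩ countEvent E k s ∩ futureNoise k s ⁻¹' G) :=
      ((measurable_pastNoise k s hA).inter (measurableSet_countEvent k s)).inter
        (measurable_futureNoise k s hG)
    conv_lhs => rw [noiseSeqLaw, ← map_glue (noiseLaw γ κ) k]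
    rw [Measure.map_apply (measurable_glue k) hm, Measure.prod_apply (measurable_glue k hm),
      ← lintegral_mul_const']
    swap; · exact measure_ne_top _ _
    refine lintegral_congr fun a => ?_
    by_cases ha : pastNoise k s a ∈ A ∧ ∀ j < k, jumpTime a (j + 1) ≤ s
    · rw [Set.indicator_of_mem (by exact ha)]
      have hr : 0 ≤ s - jumpTime a k := by
        rcases k with _ | k
        · simpa [jumpTime] using hs
        · exact sub_nonneg.2 (ha.2 k (by omega))
      rw [← noiseSeqLaw_memoryless hγ hr hG]
      change noiseSeqLaw γ κ _ = _
      congr 1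
      ext b
      simp only [Set.mem_preimage, Set.mem_inter_iff, mem_countEvent_glue, pastNoise_glue,
        futureNoise_glue, ha.1, true_and, Set.mem_ofPred_eq]
      exact ⟨fun h => ⟨h.1.2, h.2⟩, fun h => ⟨⟨ha.2, h.1⟩, h.2⟩⟩
    · rw [Set.indicator_of_notMem (by exact ha), zero_mul]
      have hempty : Prod.mk a ⁻¹' (glue k ⁻¹'
          (pastNoise k s ⁻¹' A ∩ countEvent E k s ∩ futureNoise k s ⁻¹' G)) = ∅ := by
        ext b
        simp only [Set.mem_preimage, Set.mem_inter_iff, mem_countEvent_glue, pastNoise_glue,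
          Set.mem_empty_iff_false, iff_false]
        exact fun h => ha ⟨h.1.1, h.1.2.1⟩
      rw [hempty, measure_empty]
  -- The case of the full set identifies the integral as the probability of the past event.
  have h1 := key Set.univ MeasurableSet.univ
  rw [Set.preimage_univ, Set.inter_univ, measure_univ, mul_one] at h1
  rw [key G hG, h1]

end Regeneration

/-! ### Regularity and invariance of the paths -/

section PathProperties
variable {E : Type*}

lemma jumpTime_strictMono {ω : ℕ → ℝ × (E → E)} (hpos : ∀ i, 0 < (ω i).1) :
    StrictMono (jumpTime ω) :=
  strictMono_nat_of_lt_succ fun n => by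
    rw [jumpTime_succ_last]
    linarith [hpos n]

lemma jumpCount_eq {ω : ℕ → ℝ × (E → E)} (hpos : ∀ i, 0 < (ω i).1) {k : ℕ} {t : ℝ}
    (h1 : jumpTime ω k ≤ t) (h2 : t < jumpTime ω (k + 1)) : jumpCount ω t = k :=
  jumpCount_of_mem ⟨fun _ hj => ((jumpTime_strictMono hpos).monotone hj).trans h1, h2⟩

lemma jumpPath_cadlag [TopologicalSpace E] {ω : ℕ → ℝ × (E → E)} (hpos : ∀ i, 0 < (ω i).1)
    (hinf : ∀ n : ℕ, ∃ k, (n : ℝ) < jumpTime ω (k + 1)) (x : E) (t : ℝ≥0) :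
    ContinuousWithinAt (fun s : ℝ≥0 => jumpPath x ω s) (Set.Ioi t) t ∧
      ∃ l, Tendsto (fun s : ℝ≥0 => jumpPath x ω s) (𝓝[<] t) (𝓝 l) := by
  have hex : ∃ k, (t : ℝ) < jumpTime ω (k + 1) := by
    obtain ⟨n, hn⟩ := exists_nat_gt (t : ℝ)
    obtain ⟨k, hk⟩ := hinf n
    exact ⟨k, hn.trans hk⟩
  have hmono := jumpTime_strictMono hpos
  have hm := mem_countEvent_jumpCount hex
  set k := jumpCount ω (t : ℝ) with hk
  have hle : jumpTime ω k ≤ t := by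
    rcases hk' : k with _ | j
    · simp [jumpTime]
    · exact hm.1 j (by omega)
  constructor
  · have hev : ∀ᶠ s : ℝ≥0 in 𝓝[>] t, jumpPath x ω s = jumpPath x ω t := by
      have h1 : ∀ᶠ s : ℝ≥0 in 𝓝[>] t, (s : ℝ) < jumpTime ω (k + 1) :=
        nhdsWithin_le_nhds ((NNReal.continuous_coe.tendsto t).eventually_lt_const hm.2)
      filter_upwards [h1, self_mem_nhdsWithin] with s hs hts
      rw [jumpPath, jumpPath, jumpCount_eq hpos (hle.trans (NNReal.coe_le_coe.2 (le_of_lt hts))) hs]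
    exact tendsto_nhds_of_eventually_eq hev
  -- At `t = 0` there are no earlier times, so any state serves as a left limit.
  · rcases eq_or_lt_of_le (zero_le (a := t)) with h0 | h0
    · refine ⟨x, ?_⟩
      have : Set.Iio t = ∅ := by rw [← h0]; ext s; simp
      simp [this]
    -- The left limit is the state held up to the jump time that reaches or passes `t`; if `t` is
    -- itself a jump time, this is the state before the jump.
    · have hleft : ∃ j, jumpTime ω j < t ∧ (t : ℝ) ≤ jumpTime ω (j + 1) := by
        rcases hle.lt_or_eq with hlt | heq
        · exact ⟨k, hlt, hm.2.le⟩
        · rcases hk' : k with _ | j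
          · rw [hk'] at heq
            simp only [jumpTime, Finset.range_zero, Finset.sum_empty] at heq
            exact absurd (NNReal.coe_pos.2 h0) (by rw [← heq]; exact lt_irrefl _)
          · rw [hk'] at heq
            exact ⟨j, heq ▸ hmono (Nat.lt_succ_self j), heq.ge⟩
      obtain ⟨j, hj1, hj2⟩ := hleft
      refine ⟨skeleton x ω j, tendsto_nhds_of_eventually_eq ?_⟩
      have h1 : ∀ᶠ s : ℝ≥0 in 𝓝[<] t, jumpTime ω j < s :=
        nhdsWithin_le_nhds ((NNReal.continuous_coe.tendsto t).eventually_const_lt hj1)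
      filter_upwards [h1, self_mem_nhdsWithin] with s hs hts
      rw [jumpPath, jumpCount_eq hpos hs.le ((NNReal.coe_lt_coe.2 hts).trans_le hj2)]

lemma skeleton_mem {ω : ℕ → ℝ × (E → E)} {R : Set E} (hR : ∀ i, ∀ x ∈ R, (ω i).2 x ∈ R)
    {x : E} (hx : x ∈ R) (n : ℕ) : skeleton x ω n ∈ R := by
  induction n with
  | zero => exact hx
  | succ n ih => exact hR n _ ih

end PathProperties

/-! ### Markov property and existence for every initial law -/

section Existence
variable {E : Type*} [Nonempty E] [Countable E] [MeasurableSpace E] [MeasurableSingletonClass E]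
variable {γ : ℝ} {κ : E → Measure E} [∀ x, IsProbabilityMeasure (κ x)]

/-- The probability that the jump process started at `x` is in `B` at time `t`. -/
def jumpProb (γ : ℝ) (κ : E → Measure E) (t : ℝ) (B : Set E) (x : E) : ENNReal :=
  ∑' k, ENNReal.ofReal (poissonWeight γ k t) * stepProb κ B k x

lemma stepProb_univ (k : ℕ) (x : E) : stepProb κ Set.univ k x = 1 := by
  induction k generalizing x with
  | zero => simp [stepProb]
  | succ k ih => simp [stepProb, ih]

lemma hasSum_poissonWeight (hγ : 0 < γ) {t : ℝ} (ht : 0 ≤ t) :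
    HasSum (fun k => poissonWeight γ k t) 1 :=
  hasSum_one_poissonMeasure ⟨γ * t, by positivity⟩

lemma poissonWeight_nonneg (hγ : 0 < γ) {t : ℝ} (ht : 0 ≤ t) (k : ℕ) : 0 ≤ poissonWeight γ k t := by
  unfold poissonWeight
  positivity

/-- No explosion: the events of exactly `k` jumps by time `t` are disjoint and their Poisson
probabilities add up to one. -/
lemma ae_exists_lt_jumpTime (hγ : 0 < γ) {t : ℝ} (ht : 0 ≤ t) :
    ∀ᵐ ω ∂noiseSeqLaw γ κ, ∃ n, t < jumpTime ω (n + 1) := by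
  have := isProbabilityMeasure_noiseSeqLaw (κ := κ) hγ
  have h1 : noiseSeqLaw γ κ (⋃ k, countEvent E k t) = 1 := by
    rw [measure_iUnion countEvent_disjoint fun k => measurableSet_countEvent k t]
    have : ∀ k, noiseSeqLaw γ κ (countEvent E k t) = ENNReal.ofReal (poissonWeight γ k t) := by
      intro k
      have h := noiseSeqLaw_countEvent (κ := κ) hγ Set.univ k (Classical.arbitrary E) ht
      simpa [stepProb_univ] using h
    simp_rw [this]
    rw [← ENNReal.ofReal_tsum_of_nonneg (poissonWeight_nonneg hγ ht) (hasSum_poissonWeight hγ ht).summable,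
      (hasSum_poissonWeight hγ ht).tsum_eq, ENNReal.ofReal_one]
  have h2 : ∀ᵐ ω ∂noiseSeqLaw γ κ, ω ∈ ⋃ k, countEvent E k t := by
    rw [← prob_compl_eq_zero_iff (MeasurableSet.iUnion fun k => measurableSet_countEvent k t)] at h1
    exact h1
  filter_upwards [h2] with ω hω
  obtain ⟨k, hk⟩ := Set.mem_iUnion.1 hω
  exact ⟨k, hk.2⟩

lemma ae_noise (hγ : 0 < γ) {S : Set (ℝ × (E → E))} (h : ∀ᵐ m ∂noiseLaw γ κ, m ∈ S) :
    ∀ᵐ ω ∂noiseSeqLaw γ κ, ∀ i, ω i ∈ S := by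
  have := isProbabilityMeasure_noiseLaw (κ := κ) hγ
  refine ae_all_iff.2 fun i => ?_
  exact (measurePreserving_eval_infinitePi (fun _ : ℕ => noiseLaw γ κ) i).quasiMeasurePreserving.ae h

lemma ae_gap_pos (hγ : 0 < γ) : ∀ᵐ ω ∂noiseSeqLaw γ κ, ∀ i, 0 < (ω i).1 := by
  have := isProbabilityMeasure_expMeasure hγ
  refine ae_noise hγ (S := {m | 0 < m.1}) ?_
  have h : ∀ᵐ e ∂expMeasure γ, 0 < e := by
    refine (ae_iff.trans ?_).2 (expMeasure_Iic_zero hγ)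
    simp only [not_lt]
    rfl
  exact (Measure.quasiMeasurePreserving_fst (μ := expMeasure γ) (ν := Measure.infinitePi κ)).ae h

/-- This is how invariance of a set under the kernel becomes invariance along whole paths: `R` is
countable, so one null set works for all its points. -/
lemma ae_map_mem (hγ : 0 < γ) {R : Set E} (hR : ∀ x ∈ R, κ x Rᶜ = 0) :
    ∀ᵐ ω ∂noiseSeqLaw γ κ, ∀ i, ∀ x ∈ R, (ω i).2 x ∈ R := by
  have := isProbabilityMeasure_expMeasure hγ
  refine ae_noise hγ (S := {m | ∀ x ∈ R, m.2 x ∈ R}) ?_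
  have h : ∀ᵐ m ∂Measure.infinitePi κ, ∀ x ∈ R, m x ∈ R := by
    refine (ae_ball_iff (Set.to_countable R)).2 fun x hx => ?_
    exact (measurePreserving_eval_infinitePi κ x).quasiMeasurePreserving.ae
      (p := fun y => y ∈ R) (hR x hx)
  exact (Measure.quasiMeasurePreserving_snd (μ := expMeasure γ) (ν := Measure.infinitePi κ)).ae h

lemma noiseSeqLaw_jumpPath (hγ : 0 < γ) (B : Set E) (x : E) {t : ℝ} (ht : 0 ≤ t) :
    noiseSeqLaw γ κ {ω | jumpPath x ω t ∈ B} = jumpProb γ κ t B x := by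
  have hae : {ω | jumpPath x ω t ∈ B} =ᵐ[noiseSeqLaw γ κ]
      ⋃ k, countEvent E k t ∩ {ω | skeleton x ω k ∈ B} := by
    filter_upwards [ae_exists_lt_jumpTime (κ := κ) hγ ht] with ω hω
    refine propext ?_
    change jumpPath x ω t ∈ B ↔ ω ∈ ⋃ k, countEvent E k t ∩ {ω | skeleton x ω k ∈ B}
    simp only [Set.mem_iUnion, Set.mem_inter_iff, Set.mem_ofPred_eq]
    constructor
    · intro h
      exact ⟨_, mem_countEvent_jumpCount hω, h⟩
    · rintro ⟨k, h1, h2⟩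
      rwa [jumpPath, jumpCount_of_mem h1]
  rw [measure_congr hae, measure_iUnion]
  · exact tsum_congr fun k => noiseSeqLaw_countEvent hγ B k x ht
  · exact fun i j hij => (countEvent_disjoint hij).mono Set.inter_subset_left Set.inter_subset_left
  · exact fun k => (measurableSet_countEvent _ _).inter
      (((measurable_skeleton k).comp measurable_prodMk_left) (.of_discrete (s := B)))

/-- Decompose by the state `z` after `k` jumps, which the past noise determines. For each `z` the
future event concerns the path restarted at `z`, and regeneration gives a product. -/
lemma noiseSeqLaw_markov (hγ : 0 < γ) (k : ℕ) {s h : ℝ} (hs : 0 ≤ s) (hh : 0 ≤ h)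
    {A : Set (ℕ → ℝ × (E → E))} (hA : MeasurableSet A) (B : Set E) (x : E) :
    noiseSeqLaw γ κ (pastNoise k s ⁻¹' A ∩ countEvent E k s ∩ {ω | jumpPath x ω (s + h) ∈ B}) =
      ∫⁻ ω in pastNoise k s ⁻¹' A ∩ countEvent E k s, jumpProb γ κ h B (jumpPath x ω s)
        ∂noiseSeqLaw γ κ := by
  have := isProbabilityMeasure_noiseSeqLaw (κ := κ) hγ
  have hsk : Measurable fun ω : ℕ → ℝ × (E → E) => skeleton x ω k :=
    (measurable_skeleton k).comp measurable_prodMk_left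
  have hpastsk : ∀ ω, skeleton x (pastNoise k s ω) k = skeleton x ω k := fun ω =>
    skeleton_congr (fun i hi => if_pos hi) x
  have hAB : MeasurableSet (pastNoise k s ⁻¹' A ∩ countEvent E k s) :=
    (measurable_pastNoise k s hA).inter (measurableSet_countEvent k s)
  have hjp : ∀ z, MeasurableSet {ω : ℕ → ℝ × (E → E) | jumpPath z ω h ∈ B} := fun z =>
    ((measurable_jumpPath h).comp measurable_prodMk_left) (.of_discrete (s := B))
  have hae : (pastNoise k s ⁻¹' A ∩ countEvent E k s ∩ {ω | jumpPath x ω (s + h) ∈ B} : Set _)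
      =ᵐ[noiseSeqLaw γ κ] ⋃ z : E, pastNoise k s ⁻¹' (A ∩ {ω | skeleton x ω k = z}) ∩
        countEvent E k s ∩ futureNoise k s ⁻¹' {ω | jumpPath z ω h ∈ B} := by
    filter_upwards [ae_exists_lt_jumpTime (κ := κ) hγ (add_nonneg hs hh)] with ω hω
    refine propext ?_
    change ω ∈ (pastNoise k s ⁻¹' A ∩ countEvent E k s ∩ {ω | jumpPath x ω (s + h) ∈ B} : Set _) ↔
      ω ∈ ⋃ z : E, pastNoise k s ⁻¹' (A ∩ {ω | skeleton x ω k = z}) ∩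
        countEvent E k s ∩ futureNoise k s ⁻¹' {ω | jumpPath z ω h ∈ B}
    simp only [Set.mem_iUnion, Set.mem_inter_iff, Set.mem_ofPred_eq, Set.mem_preimage, hpastsk]
    constructor
    · rintro ⟨⟨h1, h2⟩, h3⟩
      rw [jumpPath_futureNoise hh h2 hω] at h3
      exact ⟨_, ⟨⟨h1, rfl⟩, h2⟩, h3⟩
    · rintro ⟨z, ⟨⟨h1, rfl⟩, h2⟩, h3⟩
      refine ⟨⟨h1, h2⟩, ?_⟩
      rwa [jumpPath_futureNoise hh h2 hω]
  have hrhs : ∫⁻ ω in pastNoise k s ⁻¹' A ∩ countEvent E k s, jumpProb γ κ h B (jumpPath x ω s)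
        ∂noiseSeqLaw γ κ = ∫⁻ ω in pastNoise k s ⁻¹' A ∩ countEvent E k s,
          jumpProb γ κ h B (skeleton x ω k) ∂noiseSeqLaw γ κ := by
    refine setLIntegral_congr_fun hAB fun ω hω => ?_
    simp only [jumpPath, jumpCount_of_mem hω.2]
  rw [measure_congr hae, hrhs, ← lintegral_map (f := jumpProb γ κ h B) .of_discrete hsk,
    lintegral_countable', measure_iUnion]
  · refine tsum_congr fun z => ?_
    have hA' : MeasurableSet (A ∩ {ω | skeleton x ω k = z}) :=
      hA.inter (hsk (measurableSet_singleton z))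
    rw [noiseSeqLaw_regeneration hγ k hs hA' (hjp z), noiseSeqLaw_jumpPath hγ B z hh, mul_comm,
      Measure.map_apply hsk (measurableSet_singleton z),
      Measure.restrict_apply (hsk (measurableSet_singleton z))]
    congr 2
    ext ω
    simp only [Set.mem_inter_iff, Set.mem_preimage, Set.mem_ofPred_eq, hpastsk,
      Set.mem_singleton_iff]
    tauto
  · intro z z' hzz'
    refine Set.disjoint_left.2 fun ω h1 h2 => hzz' ?_
    exact (h1.1.1.2).symm.trans h2.1.1.2
  · intro z
    exact (((measurable_pastNoise k s) (hA.inter (hsk (measurableSet_singleton z)))).inter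
      (measurableSet_countEvent k s)).inter (measurable_futureNoise k s (hjp z))

variable (ν : Measure E) [IsProbabilityMeasure ν]

/-- The past up to time `s`, on the event of `k` jumps, is determined by the first `k` jumps. -/
lemma exists_pastNoise_of_measurable (k : ℕ) (s : ℝ≥0) {F : Set (E × (ℕ → ℝ × (E → E)))}
    (hF : MeasurableSet[⨆ u : Set.Iic s, MeasurableSpace.comap
      (fun p : E × (ℕ → ℝ × (E → E)) => jumpPath p.1 p.2 ((u : ℝ≥0) : ℝ)) inferInstance] F) :
    ∃ F' : Set (E × (ℕ → ℝ × (E → E))), MeasurableSet F' ∧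
      F ∩ {p | p.2 ∈ countEvent E k s} =
        {p | (p.1, pastNoise k s p.2) ∈ F'} ∩ {p | p.2 ∈ countEvent E k s} := by
  set D : Set (E × (ℕ → ℝ × (E → E))) := {p | p.2 ∈ countEvent E k s} with hD
  let restr : D → E × (ℕ → ℝ × (E → E)) := fun p => (p.1.1, pastNoise k s p.1.2)
  -- On `D` each path value up to time `s` is a function of the initial state and the past noise, so
  -- the history traced on `D` is contained in the σ-algebra pulled back by `restr`.
  have hle : (⨆ u : Set.Iic s, MeasurableSpace.comap
      (fun p : E × (ℕ → ℝ × (E → E)) => jumpPath p.1 p.2 ((u : ℝ≥0) : ℝ)) inferInstance) ≤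
      (MeasurableSpace.comap restr inferInstance).map (Subtype.val : D → _) := by
    refine iSup_le fun u => ?_
    rintro _ ⟨B, hB, rfl⟩
    refine MeasurableSpace.map_def.2 ?_
    refine ⟨_, measurable_jumpPath ((u : ℝ≥0) : ℝ) hB, ?_⟩
    ext ⟨p, hp⟩
    simp only [Set.mem_preimage, restr]
    rw [jumpPath_pastNoise (NNReal.coe_le_coe.2 u.2) hp]
  obtain ⟨F', hF', h⟩ := hle F hF
  refine ⟨F', hF', ?_⟩
  ext p
  simp only [Set.mem_inter_iff, Set.mem_ofPred_eq]
  refine and_congr_left fun hp => ?_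
  have := congrArg (fun S : Set D => (⟨p, hp⟩ : D) ∈ S) h
  exact (iff_of_eq this).symm

/-- Sum over the number of jumps by time `s`; on each piece the history is an event of the past
noise, and Fubini in the initial state reduces to a fixed starting point. -/
lemma measure_inter_jumpPath (hγ : 0 < γ) (s h : ℝ≥0) (B : Set E) {F : Set (E × (ℕ → ℝ × (E → E)))}
    (hF : MeasurableSet[⨆ u : Set.Iic s, MeasurableSpace.comap
      (fun p : E × (ℕ → ℝ × (E → E)) => jumpPath p.1 p.2 ((u : ℝ≥0) : ℝ)) inferInstance] F) :
    (ν.prod (noiseSeqLaw γ κ)) (F ∩ {p | jumpPath p.1 p.2 ((s + h : ℝ≥0) : ℝ) ∈ B}) =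
      ∫⁻ p in F, jumpProb γ κ h B (jumpPath p.1 p.2 s) ∂(ν.prod (noiseSeqLaw γ κ)) := by
  have := isProbabilityMeasure_noiseSeqLaw (κ := κ) hγ
  have hFm : MeasurableSet F := by
    refine (iSup_le fun u => ?_ : (⨆ u : Set.Iic s, MeasurableSpace.comap
      (fun p : E × (ℕ → ℝ × (E → E)) => jumpPath p.1 p.2 ((u : ℝ≥0) : ℝ)) inferInstance) ≤ _) F hF
    exact (measurable_jumpPath _).comap_le
  set D : ℕ → Set (E × (ℕ → ℝ × (E → E))) := fun k => {p | p.2 ∈ countEvent E k s} with hD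
  have hDm : ∀ k, MeasurableSet (D k) := fun k => measurable_snd (measurableSet_countEvent k s)
  have hDd : Pairwise (Function.onFun Disjoint D) := fun i j hij =>
    (countEvent_disjoint hij).preimage Prod.snd
  have hBm : MeasurableSet {p : E × (ℕ → ℝ × (E → E)) | jumpPath p.1 p.2 ((s + h : ℝ≥0) : ℝ) ∈ B} :=
    measurable_jumpPath _ (.of_discrete (s := B))
  have hgm : Measurable fun p : E × (ℕ → ℝ × (E → E)) => jumpProb γ κ h B (jumpPath p.1 p.2 s) :=
    (Measurable.of_discrete (f := jumpProb γ κ h B)).comp (measurable_jumpPath _)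
  have hfull : ∀ᵐ p ∂(ν.prod (noiseSeqLaw γ κ)), p ∈ ⋃ k, D k := by
    refine (Measure.quasiMeasurePreserving_snd (μ := ν) (ν := noiseSeqLaw γ κ)).ae
      (p := fun ω => ∃ n, (s : ℝ) < jumpTime ω (n + 1))
      (ae_exists_lt_jumpTime hγ s.coe_nonneg) |>.mono fun p hp => ?_
    exact Set.mem_iUnion.2 ⟨_, mem_countEvent_jumpCount hp⟩
  have hsplit : ∀ S : Set (E × (ℕ → ℝ × (E → E))), S =ᵐ[ν.prod (noiseSeqLaw γ κ)] ⋃ k, S ∩ D k := by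
    intro S
    filter_upwards [hfull] with p hp
    refine propext ?_
    change p ∈ S ↔ p ∈ ⋃ k, S ∩ D k
    rw [← Set.inter_iUnion]
    exact ⟨fun h => ⟨h, hp⟩, fun h => h.1⟩
  have hdisj : ∀ S : Set (E × (ℕ → ℝ × (E → E))), Pairwise (Function.onFun Disjoint fun k => S ∩ D k) :=
    fun S i j hij => (hDd hij).mono Set.inter_subset_right Set.inter_subset_right
  rw [measure_congr (hsplit _), measure_iUnion (hdisj _) fun k => (hFm.inter hBm).inter (hDm k),
    setLIntegral_congr (hsplit F), lintegral_iUnion (fun k => hFm.inter (hDm k)) (hdisj _)]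
  refine tsum_congr fun k => ?_
  obtain ⟨F', hF', hFF⟩ := exists_pastNoise_of_measurable k s hF
  have hset : F ∩ {p | jumpPath p.1 p.2 ((s + h : ℝ≥0) : ℝ) ∈ B} ∩ D k =
      {p | (p.1, pastNoise k s p.2) ∈ F'} ∩ D k ∩ {p | jumpPath p.1 p.2 ((s + h : ℝ≥0) : ℝ) ∈ B} := by
    rw [← hFF]
    ext p
    simp only [Set.mem_inter_iff]
    tauto
  have hF'm : MeasurableSet ({p : E × (ℕ → ℝ × (E → E)) | (p.1, pastNoise k s p.2) ∈ F'} ∩ D k) :=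
    (hF'.preimage (measurable_fst.prodMk ((measurable_pastNoise k s).comp measurable_snd))).inter
      (hDm k)
  rw [hset, hFF, Measure.prod_apply (hF'm.inter hBm), ← lintegral_indicator hF'm,
    lintegral_prod _ (hgm.indicator hF'm).aemeasurable]
  refine lintegral_congr fun x => ?_
  have hx : MeasurableSet (Prod.mk x ⁻¹' F') := hF'.preimage measurable_prodMk_left
  have hmk := noiseSeqLaw_markov (κ := κ) hγ k s.coe_nonneg h.coe_nonneg hx B x
  have hm : MeasurableSet (pastNoise k (s : ℝ) ⁻¹' (Prod.mk x ⁻¹' F') ∩ countEvent E k s) :=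
    (measurable_pastNoise k s hx).inter (measurableSet_countEvent k s)
  rw [← lintegral_indicator hm] at hmk
  exact hmk

/-- Existence of the jump process with jump rate `γ` and jump law `κ`, from every initial law. -/
theorem exists_jumpProcess {E : Type} [Nonempty E] [Countable E] [MeasurableSpace E]
    [MeasurableSingletonClass E] [TopologicalSpace E] {κ : E → Measure E}
    [∀ x, IsProbabilityMeasure (κ x)] (ν : Measure E) [IsProbabilityMeasure ν] (hγ : 0 < γ) :
    ∃ (Ω : Type) (_ : MeasurableSpace Ω) (P : Measure Ω) (X : ℝ≥0 → Ω → E),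
      IsProbabilityMeasure P ∧ P.map (X 0) = ν ∧ (∀ t, Measurable (X t)) ∧
      (∀ᵐ ω ∂P, ∀ t, ContinuousWithinAt (fun s => X s ω) (Set.Ioi t) t ∧
        ∃ l, Tendsto (fun s => X s ω) (𝓝[<] t) (𝓝 l)) ∧
      (∀ (s h : ℝ≥0) (B : Set E),
        P[(X (s + h) ⁻¹' B).indicator (fun _ => (1 : ℝ)) |
            ⨆ u : Set.Iic s, MeasurableSpace.comap (X u) inferInstance]
          =ᵐ[P] fun ω => (jumpProb γ κ h B (X s ω)).toReal) ∧
      ∀ R : Set E, (∀ x ∈ R, κ x Rᶜ = 0) → ν Rᶜ = 0 → ∀ᵐ ω ∂P, ∀ t, X t ω ∈ R := by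
  have hQ := isProbabilityMeasure_noiseSeqLaw (κ := κ) hγ
  set P := ν.prod (noiseSeqLaw γ κ) with hP
  have hsnd : ∀ {p : (ℕ → ℝ × (E → E)) → Prop}, (∀ᵐ ω ∂noiseSeqLaw γ κ, p ω) →
      ∀ᵐ z ∂P, p z.2 := fun h =>
    (Measure.quasiMeasurePreserving_snd (μ := ν) (ν := noiseSeqLaw γ κ)).ae h
  have hinf : ∀ᵐ ω ∂noiseSeqLaw γ κ, ∀ n : ℕ, ∃ k, (n : ℝ) < jumpTime ω (k + 1) :=
    ae_all_iff.2 fun n => ae_exists_lt_jumpTime hγ n.cast_nonneg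
  have hmeas : ∀ t : ℝ≥0, Measurable fun p : E × (ℕ → ℝ × (E → E)) => jumpPath p.1 p.2 t :=
    fun t => measurable_jumpPath _
  refine ⟨E × (ℕ → ℝ × (E → E)), inferInstance, P, fun t p => jumpPath p.1 p.2 t,
    inferInstance, ?_, hmeas, ?_, ?_, ?_⟩
  · have hae : (fun p : E × (ℕ → ℝ × (E → E)) => jumpPath p.1 p.2 ((0 : ℝ≥0) : ℝ)) =ᵐ[P] Prod.fst := by
      filter_upwards [hsnd (ae_gap_pos (κ := κ) hγ)] with p hp
      have h1 : jumpTime p.2 0 ≤ ((0 : ℝ≥0) : ℝ) := by simp [jumpTime]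
      have h2 : ((0 : ℝ≥0) : ℝ) < jumpTime p.2 (0 + 1) := by simpa [jumpTime] using hp 0
      rw [jumpPath, jumpCount_eq hp h1 h2, skeleton]
    rw [Measure.map_congr hae, hP]
    exact measurePreserving_fst.map_eq
  · filter_upwards [hsnd (ae_gap_pos (κ := κ) hγ), hsnd hinf] with p h1 h2 t
    exact jumpPath_cadlag h1 h2 p.1 t
  · intro s h B
    have hle : (⨆ u : Set.Iic s, MeasurableSpace.comap
        (fun p : E × (ℕ → ℝ × (E → E)) => jumpPath p.1 p.2 ((u : ℝ≥0) : ℝ)) inferInstance) ≤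
        (inferInstance : MeasurableSpace (E × (ℕ → ℝ × (E → E)))) :=
      iSup_le fun u => (hmeas u).comap_le
    have hBm : MeasurableSet ((fun p : E × (ℕ → ℝ × (E → E)) =>
        jumpPath p.1 p.2 ((s + h : ℝ≥0) : ℝ)) ⁻¹' B) := hmeas _ (.of_discrete (s := B))
    have hle1 : ∀ x, jumpProb γ κ h B x ≤ 1 := fun x => by
      rw [← noiseSeqLaw_jumpPath hγ B x h.coe_nonneg]
      exact prob_le_one
    have hgm : Measurable fun x => (jumpProb γ κ h B x).toReal := .of_discrete
    have hint : Integrable (fun p : E × (ℕ → ℝ × (E → E)) =>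
        (jumpProb γ κ h B (jumpPath p.1 p.2 s)).toReal) P := by
      refine Integrable.of_bound (hgm.comp (hmeas s)).aestronglyMeasurable 1 (ae_of_all _ fun p => ?_)
      rw [Real.norm_of_nonneg ENNReal.toReal_nonneg]
      exact ENNReal.toReal_le_of_le_ofReal zero_le_one (by simpa using hle1 _)
    symm
    -- The conditional expectation is characterised by its integrals over events of the history.
    refine ae_eq_condExp_of_forall_setIntegral_eq hle ((integrable_const _).indicator hBm)
      (fun _ _ _ => hint.integrableOn) ?_ ?_
    · intro F hF _
      have hFm := hle F hF
      rw [integral_indicator hBm, Measure.restrict_restrict hBm, setIntegral_const, smul_eq_mul,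
        mul_one, integral_toReal]
      · rw [← measure_inter_jumpPath ν hγ s h B hF, Measure.real, Set.inter_comm]
        rfl
      · exact ((Measurable.of_discrete (f := jumpProb γ κ h B)).comp (hmeas s)).aemeasurable
      · exact ae_of_all _ fun p => (hle1 _).trans_lt ENNReal.one_lt_top
    · have h1 : Measurable[⨆ u : Set.Iic s, MeasurableSpace.comap
          (fun p : E × (ℕ → ℝ × (E → E)) => jumpPath p.1 p.2 ((u : ℝ≥0) : ℝ)) inferInstance]
          (fun p : E × (ℕ → ℝ × (E → E)) => jumpPath p.1 p.2 (s : ℝ)) :=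
        measurable_iff_comap_le.2 (le_iSup (fun u : Set.Iic s => MeasurableSpace.comap
          (fun p : E × (ℕ → ℝ × (E → E)) => jumpPath p.1 p.2 ((u : ℝ≥0) : ℝ)) inferInstance)
          ⟨s, le_refl s⟩)
      exact (hgm.comp h1).stronglyMeasurable.aestronglyMeasurable
  · intro R hR hν
    have hfst : ∀ᵐ z ∂P, z.1 ∈ R :=
      (Measure.quasiMeasurePreserving_fst (μ := ν) (ν := noiseSeqLaw γ κ)).ae
        (p := fun x => x ∈ R) hν
    filter_upwards [hfst, hsnd (ae_map_mem hγ hR)] with p h1 h2 t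
    exact skeleton_mem h2 h1 _

end Existence

/-! ### Uniformization of generators with bounded rates -/

section Uniformization
variable {E : Type*}

/-- A Markov operator: linear, positive, with `K 1 = 1`. -/
structure IsMarkovOp (K : (E → ℝ) →ₗ[ℝ] (E → ℝ)) : Prop where
  nonneg : ∀ f, 0 ≤ f → 0 ≤ K f
  map_one : K 1 = 1

namespace IsMarkovOp
variable {K : (E → ℝ) →ₗ[ℝ] (E → ℝ)}

lemma mono (hK : IsMarkovOp K) {f g : E → ℝ} (h : f ≤ g) : K f ≤ K g := by
  have := hK.nonneg (g - f) (sub_nonneg.2 h)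
  rwa [map_sub, sub_nonneg] at this

lemma pow (hK : IsMarkovOp K) (n : ℕ) : IsMarkovOp (K ^ n) := by
  induction n with
  | zero => exact ⟨fun f hf => hf, rfl⟩
  | succ n ih =>
    rw [pow_succ]
    exact ⟨fun f hf => ih.nonneg _ (hK.nonneg f hf), by
      rw [Module.End.mul_apply, hK.map_one, ih.map_one]⟩

lemma map_const (hK : IsMarkovOp K) (c : ℝ) : K (fun _ => c) = fun _ => c := by
  have : (fun _ : E => c) = c • 1 := by ext; simp
  rw [this, map_smul, hK.map_one]

lemma indicator_nonneg (hK : IsMarkovOp K) (B : Set E) (n : ℕ) (x : E) :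
    0 ≤ (K ^ n) (B.indicator 1) x :=
  (hK.pow n).nonneg _ (Set.indicator_nonneg fun _ _ => zero_le_one) x

lemma indicator_le_one (hK : IsMarkovOp K) (B : Set E) (n : ℕ) (x : E) :
    (K ^ n) (B.indicator 1) x ≤ 1 := by
  have h : B.indicator 1 ≤ (1 : E → ℝ) := Set.indicator_le_self' fun _ _ => zero_le_one
  have := (hK.pow n).mono h x
  rwa [(hK.pow n).map_one] at this

end IsMarkovOp

/-- Binomial theorem for `γ (K - 1)`, as `K` commutes with the identity. -/
lemma generator_iterate {K : (E → ℝ) →ₗ[ℝ] (E → ℝ)} {γ : ℝ} {L : Generator E}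
    (hL : ∀ f, L f = γ • (K f - f)) (n : ℕ) (f : E → ℝ) (x : E) :
    (L^[n] f) x = γ ^ n * ∑ p ∈ Finset.HasAntidiagonal.antidiagonal n,
      (n.choose p.1 : ℝ) * ((-1) ^ p.1 * (K ^ p.2) f x) := by
  have h1 : L^[n] f = ((γ • ((-1 : ℝ) • (1 : Module.End ℝ (E → ℝ)) + K)) ^ n) f := by
    induction n generalizing f with
    | zero => rfl
    | succ n ih =>
      rw [Function.iterate_succ_apply, ih, pow_succ, Module.End.mul_apply, hL]
      congr 2
      simp [sub_eq_add_neg, add_comm]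
  have hc : Commute ((-1 : ℝ) • (1 : Module.End ℝ (E → ℝ))) K :=
    (Commute.one_left K).smul_left _
  rw [h1, smul_pow, hc.add_pow']
  simp only [smul_pow, one_pow, LinearMap.smul_apply, LinearMap.sum_apply, Pi.smul_apply,
    Finset.sum_apply, smul_eq_mul, smul_mul_assoc, one_mul, nsmul_eq_mul]
  congr 1
  refine Finset.sum_congr rfl fun p _ => ?_
  rw [← nsmul_eq_mul]
  simp
  ring

/-- The transition probabilities in terms of the uniformized chain. -/
lemma transProb_eq_tsum {K : (E → ℝ) →ₗ[ℝ] (E → ℝ)} (hK : IsMarkovOp K) {γ : ℝ} {L : Generator E}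
    (hL : ∀ f, L f = γ • (K f - f)) (t : ℝ≥0) (x y : E) :
    transProb L t x y = ∑' k, poissonWeight γ k t * (K ^ k) (Set.indicator {y} 1) x := by
  set a : ℕ → ℝ := fun k => (K ^ k) (Set.indicator {y} 1) x with ha
  have hs1 : Summable fun i : ℕ => ‖(-(γ * t)) ^ i / (i ! : ℝ)‖ :=
    NormedSpace.norm_expSeries_div_summable (𝔸 := ℝ) (-(γ * t))
  have hs2 : Summable fun j : ℕ => ‖(γ * t) ^ j / (j ! : ℝ) * a j‖ := by
    refine Summable.of_nonneg_of_le (fun _ => norm_nonneg _) (fun j => ?_)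
      (NormedSpace.norm_expSeries_div_summable (𝔸 := ℝ) (γ * t))
    rw [norm_mul]
    refine mul_le_of_le_one_right (norm_nonneg _) ?_
    rw [Real.norm_of_nonneg (hK.indicator_nonneg _ _ _)]
    exact hK.indicator_le_one _ _ _
  have hexp : Real.exp (-(γ * t)) = ∑' i : ℕ, (-(γ * t)) ^ i / (i ! : ℝ) := by
    rw [Real.exp_eq_exp_ℝ, NormedSpace.exp_eq_tsum_div]
  have hrhs : ∑' k, poissonWeight γ k t * a k =
      (∑' i : ℕ, (-(γ * t)) ^ i / (i ! : ℝ)) * ∑' j : ℕ, (γ * t) ^ j / (j ! : ℝ) * a j := by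
    rw [← hexp, ← tsum_mul_left]
    refine tsum_congr fun k => ?_
    rw [poissonWeight]
    ring
  -- The Cauchy product of the series of `exp(-γ t)` and of `exp(γ t K)` has exactly the binomial
  -- sums of `L^[n]` as its terms.
  rw [hrhs, tsum_mul_tsum_eq_tsum_sum_antidiagonal_of_summable_norm hs1 hs2, transProb]
  refine tsum_congr fun n => ?_
  rw [generator_iterate hL, ← mul_assoc, Finset.mul_sum]
  refine Finset.sum_congr rfl fun p hp => ?_
  have hpn := Finset.HasAntidiagonal.mem_antidiagonal.1 hp
  rw [← hpn, Nat.cast_choose ℝ (Nat.le_add_right _ _), Nat.add_sub_cancel_left]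
  change _ = _ * (_ * (K ^ p.2) _ x)
  have h1 : ((p.1 + p.2)! : ℝ) ≠ 0 := by positivity
  have h2 : (p.1 ! : ℝ) ≠ 0 := by positivity
  have h3 : (p.2 ! : ℝ) ≠ 0 := by positivity
  rw [neg_pow (γ * (t : ℝ))]
  field_simp
  ring

variable {A : Type*} [Fintype A]

/-- The generator under which event `a` occurs at rate `rate x a` and moves the state to
`step x a`. -/
def eventGenerator (rate : E → A → ℝ) (step : E → A → E) : Generator E :=
  fun f x => ∑ a, rate x a * (f (step x a) - f x)

/-- The uniformized operator at rate `γ`. -/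
def uniformized (γ : ℝ) (rate : E → A → ℝ) (step : E → A → E) : (E → ℝ) →ₗ[ℝ] (E → ℝ) where
  toFun f x := f x + γ⁻¹ * ∑ a, rate x a * (f (step x a) - f x)
  map_add' f g := by
    funext x
    simp only [Pi.add_apply]
    rw [add_add_add_comm, ← mul_add, ← Finset.sum_add_distrib]
    congr 2
    exact Finset.sum_congr rfl fun a _ => by ring
  map_smul' c f := by
    funext x
    simp only [Pi.smul_apply, smul_eq_mul, RingHom.id_apply]
    have : ∑ a, rate x a * (c * f (step x a) - c * f x) =
        c * ∑ a, rate x a * (f (step x a) - f x) := by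
      rw [Finset.mul_sum]
      exact Finset.sum_congr rfl fun a _ => by ring
    rw [this]
    ring

lemma uniformized_apply (γ : ℝ) (rate : E → A → ℝ) (step : E → A → E) (f : E → ℝ) (x : E) :
    uniformized γ rate step f x = f x + γ⁻¹ * eventGenerator rate step f x := rfl

lemma eventGenerator_eq {γ : ℝ} (hγ : 0 < γ) (rate : E → A → ℝ) (step : E → A → E) (f : E → ℝ) :
    eventGenerator rate step f = γ • (uniformized γ rate step f - f) := by
  funext x
  simp only [Pi.smul_apply, Pi.sub_apply, uniformized_apply, smul_eq_mul]
  field_simp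
  ring

lemma uniformized_eq_sum (γ : ℝ) (rate : E → A → ℝ) (step : E → A → E) (f : E → ℝ)
    (x : E) : uniformized γ rate step f x =
      ∑ a, rate x a / γ * f (step x a) + (1 - ∑ a, rate x a / γ) * f x := by
  simp only [uniformized_apply, eventGenerator, mul_sub, Finset.sum_sub_distrib, sub_mul,
    Finset.mul_sum, Finset.sum_mul]
  have : ∀ a (c : ℝ), γ⁻¹ * (rate x a * c) = rate x a / γ * c := fun a c => by ring
  simp only [this]
  ring

/-- The law of the state after a jump of the uniformized chain. -/
def eventKernel [MeasurableSpace E] (γ : ℝ) (rate : E → A → ℝ) (step : E → A → E) (x : E) :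
    Measure E :=
  ∑ a, ENNReal.ofReal (rate x a / γ) • Measure.dirac (step x a) +
    ENNReal.ofReal (1 - ∑ a, rate x a / γ) • Measure.dirac x

variable {γ : ℝ} {rate : E → A → ℝ} {step : E → A → E}

lemma sum_rate_div_le_one (hγ : 0 < γ) (hle : ∀ x, ∑ a, rate x a ≤ γ) (x : E) :
    ∑ a, rate x a / γ ≤ 1 := by
  rw [← Finset.sum_div]
  exact (div_le_one hγ).2 (hle x)

lemma isMarkovOp_uniformized (hγ : 0 < γ) (hrate : ∀ x a, 0 ≤ rate x a)
    (hle : ∀ x, ∑ a, rate x a ≤ γ) : IsMarkovOp (uniformized γ rate step) where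
  nonneg f hf x := by
    rw [uniformized_eq_sum]
    refine add_nonneg (Finset.sum_nonneg fun a _ => ?_) ?_
    · exact mul_nonneg (div_nonneg (hrate x a) hγ.le) (hf _)
    · exact mul_nonneg (sub_nonneg.2 (sum_rate_div_le_one hγ hle x)) (hf _)
  map_one := by
    funext x
    simp [uniformized_apply, eventGenerator]

/-- A gap `δ` between the uniformization rate and the total event rate is a holding probability of
at least `δ / γ`. -/
lemma uniformized_ge_self (hγ : 0 < γ) (hrate : ∀ x a, 0 ≤ rate x a) {δ : ℝ}
    (hle : ∀ x, ∑ a, rate x a + δ ≤ γ) {f : E → ℝ} (hf : 0 ≤ f) (x : E) :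
    δ / γ * f x ≤ uniformized γ rate step f x := by
  rw [uniformized_eq_sum]
  have h1 : 0 ≤ ∑ a, rate x a / γ * f (step x a) :=
    Finset.sum_nonneg fun a _ => mul_nonneg (div_nonneg (hrate x a) hγ.le) (hf _)
  have h2 : δ / γ ≤ 1 - ∑ a, rate x a / γ := by
    rw [← Finset.sum_div, le_sub_iff_add_le, ← add_div, div_le_one hγ, add_comm]
    exact hle x
  nlinarith [mul_le_mul_of_nonneg_right h2 (hf x)]

lemma uniformized_ge_step (hγ : 0 < γ) (hrate : ∀ x a, 0 ≤ rate x a)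
    (hle : ∀ x, ∑ a, rate x a ≤ γ) {f : E → ℝ} (hf : 0 ≤ f) (x : E) (a : A) :
    rate x a / γ * f (step x a) ≤ uniformized γ rate step f x := by
  rw [uniformized_eq_sum]
  have h1 : rate x a / γ * f (step x a) ≤ ∑ a, rate x a / γ * f (step x a) :=
    Finset.single_le_sum (f := fun a => rate x a / γ * f (step x a))
      (fun a _ => mul_nonneg (div_nonneg (hrate x a) hγ.le) (hf _)) (Finset.mem_univ a)
  have h2 : 0 ≤ (1 - ∑ a, rate x a / γ) * f x :=
    mul_nonneg (sub_nonneg.2 (sum_rate_div_le_one hγ hle x)) (hf x)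
  linarith

section Kernel
variable [MeasurableSpace E]

lemma isProbabilityMeasure_eventKernel (hγ : 0 < γ) (hrate : ∀ x a, 0 ≤ rate x a)
    (hle : ∀ x, ∑ a, rate x a ≤ γ) (x : E) : IsProbabilityMeasure (eventKernel γ rate step x) := by
  constructor
  simp only [eventKernel, Measure.coe_add, Measure.coe_finsetSum, Measure.coe_smul, Pi.add_apply,
    Finset.sum_apply, Pi.smul_apply, measure_univ, smul_eq_mul, mul_one]
  rw [← ENNReal.ofReal_sum_of_nonneg fun a _ => div_nonneg (hrate x a) hγ.le,
    ← ENNReal.ofReal_add (Finset.sum_nonneg fun a _ => div_nonneg (hrate x a) hγ.le)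
      (sub_nonneg.2 (sum_rate_div_le_one hγ hle x))]
  simp

variable [Countable E] [MeasurableSingletonClass E]

lemma lintegral_eventKernel (hγ : 0 < γ) (hrate : ∀ x a, 0 ≤ rate x a)
    (hle : ∀ x, ∑ a, rate x a ≤ γ) {f : E → ℝ} (hf : 0 ≤ f) (x : E) :
    ∫⁻ y, ENNReal.ofReal (f y) ∂eventKernel γ rate step x =
      ENNReal.ofReal (uniformized γ rate step f x) := by
  have h0 : ∀ a, 0 ≤ rate x a / γ := fun a => div_nonneg (hrate x a) hγ.le
  rw [uniformized_eq_sum, eventKernel, lintegral_add_measure, lintegral_finsetSum_measure,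
    lintegral_smul_measure, lintegral_dirac,
    ENNReal.ofReal_add (Finset.sum_nonneg fun a _ => mul_nonneg (h0 a) (hf _))
      (mul_nonneg (sub_nonneg.2 (sum_rate_div_le_one hγ hle x)) (hf x)),
    ENNReal.ofReal_sum_of_nonneg fun a _ => mul_nonneg (h0 a) (hf _),
    ENNReal.ofReal_mul (sub_nonneg.2 (sum_rate_div_le_one hγ hle x))]
  simp only [lintegral_smul_measure, lintegral_dirac, smul_eq_mul]
  congr 1
  exact Finset.sum_congr rfl fun a _ => (ENNReal.ofReal_mul (h0 a)).symm

lemma eventKernel_compl_eq_zero {R : Set E} {x : E} (hx : x ∈ R)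
    (hR : ∀ a, rate x a ≠ 0 → step x a ∈ R) : eventKernel γ rate step x Rᶜ = 0 := by
  simp only [eventKernel, Measure.coe_add, Measure.coe_finsetSum, Measure.coe_smul, Pi.add_apply,
    Finset.sum_apply, Pi.smul_apply, smul_eq_mul]
  rw [Measure.dirac_apply, Set.indicator_of_notMem (by simpa using hx), mul_zero, add_zero]
  refine Finset.sum_eq_zero fun a _ => ?_
  by_cases ha : rate x a = 0
  · simp [ha]
  · rw [Measure.dirac_apply, Set.indicator_of_notMem (by simpa using hR a ha), mul_zero]

variable {F : Type*}

/-- If `p` intertwines the generator `L` of `F` with an event generator on `E`, the transition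
probabilities of the image under `p` of the jump process are those of `L`. -/
lemma jumpProb_eq_transProb (hγ : 0 < γ) (hrate : ∀ x a, 0 ≤ rate x a)
    (hle : ∀ x, ∑ a, rate x a ≤ γ) {L : Generator F} {K : (F → ℝ) →ₗ[ℝ] (F → ℝ)}
    (hK : IsMarkovOp K) (hL : ∀ f, L f = γ • (K f - f)) (p : E → F)
    (hp : ∀ f x, eventGenerator rate step (f ∘ p) x = L f (p x)) (t : ℝ≥0) (y : F) (x : E) :
    (jumpProb γ (eventKernel γ rate step) t (p ⁻¹' {y}) x).toReal = transProb L t (p x) y := by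
  -- Both generators are uniformized at the same rate `γ`, so the intertwining passes to the Markov
  -- operators and then to their powers.
  have hcomp : ∀ f : F → ℝ, uniformized γ rate step (f ∘ p) = K f ∘ p := by
    intro f
    funext x
    rw [uniformized_apply, hp, hL]
    simp only [Function.comp_apply, Pi.smul_apply, Pi.sub_apply, smul_eq_mul]
    field_simp
    ring
  have hstep : ∀ k x, stepProb (eventKernel γ rate step) (p ⁻¹' {y}) k x =
      ENNReal.ofReal ((K ^ k) (Set.indicator {y} 1) (p x)) := by
    intro k
    induction k with
    | zero =>
      intro x
      by_cases h : p x = y <;> simp [stepProb, h]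
    | succ k ih =>
      intro x
      simp only [stepProb, ih]
      refine (lintegral_eventKernel (f := (K ^ k) (Set.indicator {y} 1) ∘ p) hγ hrate hle
        (fun x => hK.indicator_nonneg _ _ _) x).trans ?_
      rw [hcomp, pow_succ']
      rfl
  have hnn : ∀ k, 0 ≤ poissonWeight γ k t * (K ^ k) (Set.indicator {y} 1) (p x) := fun k =>
    mul_nonneg (poissonWeight_nonneg hγ t.coe_nonneg k) (hK.indicator_nonneg _ _ _)
  rw [transProb_eq_tsum hK hL, jumpProb, ENNReal.tsum_toReal_eq]
  · refine tsum_congr fun k => ?_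
    rw [hstep, ← ENNReal.ofReal_mul (poissonWeight_nonneg hγ t.coe_nonneg k),
      ENNReal.toReal_ofReal (hnn k)]
  · intro k
    rw [hstep]
    exact ENNReal.mul_ne_top ENNReal.ofReal_ne_top ENNReal.ofReal_ne_top

end Kernel
end Uniformization

/-! ### Images of Markov processes and uniqueness in law -/

section Laws

/-- Lumping: the transition probabilities to fibres of `p` depend on the state only through its
image. The image process has a smaller history, and the tower property applies because the
conditional probability given the larger history is already measurable for the smaller one. -/
lemma IsMarkovJumpProcess.comp {E F Ω : Type*} [Countable E] [MeasurableSpace E]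
    [MeasurableSingletonClass E] [TopologicalSpace E] [DiscreteTopology E]
    [Countable F] [MeasurableSpace F] [MeasurableSingletonClass F] [TopologicalSpace F]
    [MeasurableSpace Ω] {P : Measure Ω} [IsProbabilityMeasure P] {X : ℝ≥0 → Ω → E} (p : E → F)
    (hX : ∀ t, Measurable (X t))
    (hcad : ∀ᵐ ω ∂P, ∀ t, ContinuousWithinAt (fun s => X s ω) (Set.Ioi t) t ∧
        ∃ l, Tendsto (fun s => X s ω) (𝓝[<] t) (𝓝 l))
    {g : ℝ≥0 → Set E → E → ℝ}
    (hmarkov : ∀ (s h : ℝ≥0) (B : Set E),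
        P[(X (s + h) ⁻¹' B).indicator (fun _ => (1 : ℝ)) |
            ⨆ u : Set.Iic s, MeasurableSpace.comap (X u) inferInstance]
          =ᵐ[P] fun ω => g h B (X s ω))
    {L : Generator F} (hg : ∀ h y x, g h (p ⁻¹' {y}) x = transProb L h (p x) y) :
    IsMarkovJumpProcess L P fun t ω => p (X t ω) where
  measurable t := (Measurable.of_discrete (f := p)).comp (hX t)
  cadlag := by
    filter_upwards [hcad] with ω hω t
    obtain ⟨h1, l, h2⟩ := hω t
    have hp : Continuous p := continuous_of_discreteTopology
    exact ⟨(hp.tendsto _).comp h1, p l, (hp.tendsto l).comp h2⟩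
  markov s h y := by
    have hle : (⨆ u : Set.Iic s, MeasurableSpace.comap (X u) inferInstance) ≤ _ :=
      iSup_le fun u => (hX u).comap_le
    have hcomp : ∀ u : Set.Iic s, MeasurableSpace.comap (fun ω => p (X u ω)) inferInstance ≤
        MeasurableSpace.comap (X u) inferInstance := fun u => by
      have : (fun ω => p (X u ω)) = p ∘ X u := rfl
      rw [this, ← MeasurableSpace.comap_comp]
      exact MeasurableSpace.comap_mono (Measurable.of_discrete (f := p)).comap_le
    have hle' : (⨆ u : Set.Iic s, MeasurableSpace.comap (fun ω => p (X u ω)) inferInstance) ≤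
        ⨆ u : Set.Iic s, MeasurableSpace.comap (X u) inferInstance := iSup_mono hcomp
    refine (condExp_condExp_of_le hle' hle).symm.trans ?_
    have h1 := hmarkov s h (p ⁻¹' {y})
    simp_rw [hg] at h1
    refine (condExp_congr_ae h1).trans ?_
    have h2 : Measurable[⨆ u : Set.Iic s, MeasurableSpace.comap (fun ω => p (X u ω)) inferInstance]
        fun ω => p (X s ω) :=
      measurable_iff_comap_le.2 (le_iSup (fun u : Set.Iic s =>
        MeasurableSpace.comap (fun ω => p (X u ω)) inferInstance) ⟨s, le_refl s⟩)
    have h3 := ((Measurable.of_discrete (f := fun x => transProb L h x y)).comp h2).stronglyMeasurable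
    refine (condExp_of_stronglyMeasurable (hle'.trans hle) h3 ?_).eventuallyEq
    exact integrable_condExp.congr h1

variable {E Ω₁ Ω₂ : Type*} [MeasurableSpace E] [TopologicalSpace E]
  [MeasurableSpace Ω₁] [MeasurableSpace Ω₂]

lemma IsMarkovJumpProcess.measureReal_inter [MeasurableSingletonClass E] {L : Generator E}
    {P : Measure Ω₁} [IsProbabilityMeasure P]
    {X : ℝ≥0 → Ω₁ → E} (hX : IsMarkovJumpProcess L P X) (s h : ℝ≥0) (z y : E) {F : Set Ω₁}
    (hF : MeasurableSet[⨆ u : Set.Iic s, MeasurableSpace.comap (X u) inferInstance] F)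
    (hz : ∀ ω ∈ F, X s ω = z) :
    P.real (F ∩ {ω | X (s + h) ω = y}) = transProb L h z y * P.real F := by
  have hle : (⨆ u : Set.Iic s, MeasurableSpace.comap (X u) inferInstance) ≤ _ :=
    iSup_le fun u => (hX.measurable u).comap_le
  have hym : MeasurableSet (X (s + h) ⁻¹' {y}) := hX.measurable _ (measurableSet_singleton y)
  have h1 := setIntegral_condExp (μ := P) hle
    (f := (X (s + h) ⁻¹' {y}).indicator fun _ => (1 : ℝ)) ((integrable_const _).indicator hym) hF
  rw [setIntegral_congr_ae (g := fun _ => transProb L h z y) (hle F hF), setIntegral_const,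
    integral_indicator hym, Measure.restrict_restrict hym, setIntegral_const] at h1
  · rw [Set.inter_comm, mul_comm]
    have h2 : P.real (X (s + h) ⁻¹' {y} ∩ F) = P.real F * transProb L h z y := by
      simpa only [smul_eq_mul, mul_one] using h1.symm
    exact h2
  · filter_upwards [hX.markov s h y] with ω hω hωF
    rw [hω, hz ω hωF]

variable [Countable E] [MeasurableSingletonClass E]

/-- Here `s` is the last prescribed time before `a`, or zero, so the state at `s` is constant on the
old cylinder. -/
lemma IsMarkovJumpProcess.measureReal_cylinder_insert {L : Generator E} {P : Measure Ω₁}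
    [IsProbabilityMeasure P] {X : ℝ≥0 → Ω₁ → E} (hX : IsMarkovJumpProcess L P X) (y : ℝ≥0 → E)
    {I : Finset ℝ≥0} {a s : ℝ≥0} (hs : ∀ i ∈ I, i ≤ s) (hsa : s ≤ a) (hsI : s = 0 ∨ s ∈ I) :
    P.real {ω | X 0 ω = y 0 ∧ ∀ i ∈ insert a I, X i ω = y i} =
      transProb L (a - s) (y s) (y a) * P.real {ω | X 0 ω = y 0 ∧ ∀ i ∈ I, X i ω = y i} := by
  rw [← hX.measureReal_inter s (a - s) (y s) (y a), add_tsub_cancel_of_le hsa]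
  · congr 1
    ext ω
    simp only [Finset.mem_insert, forall_eq_or_imp, Set.mem_inter_iff, Set.mem_ofPred_eq]
    tauto
  · have hm : ∀ i ≤ s, MeasurableSet[⨆ u : Set.Iic s, MeasurableSpace.comap (X u) inferInstance]
        {ω | X i ω = y i} := fun i hi =>
      le_iSup (fun u : Set.Iic s => MeasurableSpace.comap (X u) inferInstance) ⟨i, hi⟩ _
        ⟨{y i}, measurableSet_singleton _, rfl⟩
    have : {ω | X 0 ω = y 0 ∧ ∀ i ∈ I, X i ω = y i} =
        {ω | X 0 ω = y 0} ∩ ⋂ i ∈ I, {ω | X i ω = y i} := by ext; simp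
    rw [this]
    exact MeasurableSet.inter (hm 0 (zero_le (a := s)))
      (Finset.measurableSet_biInter I fun i hi => hm i (hs i hi))
  · rintro ω ⟨h1, h2⟩
    rcases hsI with h | h
    · rw [h, h1]
    · exact h2 s h

lemma IsMarkovJumpProcess.measureReal_cylinder_eq {L : Generator E} {P₁ : Measure Ω₁}
    {P₂ : Measure Ω₂} [IsProbabilityMeasure P₁] [IsProbabilityMeasure P₂] {X : ℝ≥0 → Ω₁ → E}
    {Y : ℝ≥0 → Ω₂ → E} (hX : IsMarkovJumpProcess L P₁ X) (hY : IsMarkovJumpProcess L P₂ Y)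
    (h0 : P₁.map (X 0) = P₂.map (Y 0)) (y : ℝ≥0 → E) (I : Finset ℝ≥0) :
    P₁.real {ω | X 0 ω = y 0 ∧ ∀ i ∈ I, X i ω = y i} =
      P₂.real {ω | Y 0 ω = y 0 ∧ ∀ i ∈ I, Y i ω = y i} := by
  have hbase : P₁.real {ω | X 0 ω = y 0} = P₂.real {ω | Y 0 ω = y 0} := by
    have h1 := congrArg (fun μ : Measure E => μ.real {y 0}) h0
    simp only [map_measureReal_apply (hX.measurable 0) (measurableSet_singleton _),
      map_measureReal_apply (hY.measurable 0) (measurableSet_singleton _)] at h1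
    exact h1
  induction I using Finset.induction_on_max with
  | empty => simpa using hbase
  | insert a I ha ih =>
    rcases eq_or_ne a 0 with rfl | ha0
    · have : I = ∅ := Finset.eq_empty_of_forall_notMem fun i hi => not_lt_zero (ha i hi)
      subst this
      simpa using hbase
    · have hs : ∀ i ∈ I, i ≤ I.sup id := fun i hi => Finset.le_sup (f := id) hi
      have hsa : I.sup id ≤ a := Finset.sup_le fun i hi => (ha i hi).le
      have hsI : I.sup id = 0 ∨ I.sup id ∈ I := by
        rcases I.eq_empty_or_nonempty with rfl | hne
        · left; simp
        · right
          obtain ⟨i, hi, h⟩ := Finset.exists_mem_eq_sup I hne id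
          rw [h]
          exact hi
      rw [hX.measureReal_cylinder_insert y hs hsa hsI, ih,
        hY.measureReal_cylinder_insert y hs hsa hsI]

lemma restrict_preimage_singleton {J : Finset ℝ≥0} (hJ : 0 ∈ J) (Z : ℝ≥0 → Ω₁ → E) {f : J → E}
    {y : ℝ≥0 → E} (hy : ∀ i (hi : i ∈ J), y i = f ⟨i, hi⟩) :
    (fun ω => J.restrict (Z · ω)) ⁻¹' {f} = {ω | Z 0 ω = y 0 ∧ ∀ i ∈ J, Z i ω = y i} := by
  ext ω
  simp only [Set.mem_preimage, Set.mem_singleton_iff, funext_iff, Subtype.forall,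
    Set.mem_ofPred_eq, Finset.restrict_def]
  constructor
  · intro h
    have : ∀ i ∈ J, Z i ω = y i := fun i hi => by rw [hy i hi, h i hi]
    exact ⟨this 0 hJ, this⟩
  · rintro ⟨-, h⟩ i hi
    rw [h i hi, hy i hi]

/-- The law of a Markov jump process is determined by its generator and initial law. -/
theorem IsMarkovJumpProcess.map_eq {L : Generator E} {P₁ : Measure Ω₁}
    {P₂ : Measure Ω₂} [IsProbabilityMeasure P₁] [IsProbabilityMeasure P₂] {X : ℝ≥0 → Ω₁ → E}
    {Y : ℝ≥0 → Ω₂ → E} (hX : IsMarkovJumpProcess L P₁ X) (hY : IsMarkovJumpProcess L P₂ Y)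
    (h0 : P₁.map (X 0) = P₂.map (Y 0)) :
    P₁.map (fun ω t => X t ω) = P₂.map (fun ω t => Y t ω) := by
  classical
  have hXm : Measurable fun ω t => X t ω := measurable_pi_lambda _ hX.measurable
  have hYm : Measurable fun ω t => Y t ω := measurable_pi_lambda _ hY.measurable
  -- Time zero is included so that the initial law enters; other finite sets of times follow by
  -- projection.
  have hres : ∀ J : Finset ℝ≥0, 0 ∈ J →
      P₁.map (fun ω => J.restrict (X · ω)) = P₂.map (fun ω => J.restrict (Y · ω)) := by
    intro J hJ
    have hXJ : Measurable fun ω => J.restrict (X · ω) := (Finset.measurable_restrict J).comp hXm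
    have hYJ : Measurable fun ω => J.restrict (Y · ω) := (Finset.measurable_restrict J).comp hYm
    have := Measure.isProbabilityMeasure_map (μ := P₁) hXJ.aemeasurable
    have := Measure.isProbabilityMeasure_map (μ := P₂) hYJ.aemeasurable
    refine Measure.ext_of_singleton fun f => ?_
    let y : ℝ≥0 → E := fun t => if h : t ∈ J then f ⟨t, h⟩ else f ⟨0, hJ⟩
    have key := hX.measureReal_cylinder_eq hY h0 y J
    rw [Measure.map_apply hXJ (measurableSet_singleton f),
      Measure.map_apply hYJ (measurableSet_singleton f)]
    have hy : ∀ i (hi : i ∈ J), y i = f ⟨i, hi⟩ := fun i hi => dif_pos hi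
    rw [restrict_preimage_singleton hJ X hy, restrict_preimage_singleton hJ Y hy]
    exact (measureReal_eq_measureReal_iff).1 key
  have hall : ∀ I : Finset ℝ≥0,
      P₁.map (fun ω => I.restrict (X · ω)) = P₂.map (fun ω => I.restrict (Y · ω)) := by
    intro I
    have h := congrArg (Measure.map (Finset.restrict₂ (π := fun _ => E) (Finset.subset_insert 0 I)))
      (hres (insert 0 I) (Finset.mem_insert_self 0 I))
    have hXJ : Measurable fun ω => (insert 0 I).restrict (X · ω) :=
      (Finset.measurable_restrict _).comp hXm
    have hYJ : Measurable fun ω => (insert 0 I).restrict (Y · ω) :=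
      (Finset.measurable_restrict _).comp hYm
    have hr : Measurable (Finset.restrict₂ (π := fun _ => E) (Finset.subset_insert 0 I)) :=
      Finset.measurable_restrict₂ _
    exact (Measure.map_map hr hXJ).symm.trans (h.trans (Measure.map_map hr hYJ))
  have := Measure.isProbabilityMeasure_map (μ := P₁) hXm.aemeasurable
  have hX' := isProjectiveLimit_map (P := P₁) hXm.aemeasurable
  simp_rw [hall] at hX'
  have hfin : ∀ I : Finset ℝ≥0, IsFiniteMeasure (P₂.map fun ω => I.restrict (Y · ω)) := fun I =>
    inferInstance
  exact hX'.unique (isProjectiveLimit_map hYm.aemeasurable)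

end Laws

/-! ### Harris' theorem -/

section Harris
variable {E : Type*}

/-- One-step contraction of weighted oscillations (Hairer–Mattingly). -/
lemma IsMarkovOp.exists_contraction {T : (E → ℝ) →ₗ[ℝ] (E → ℝ)} (hT : IsMarkovOp T) {V : E → ℝ}
    (hV : 0 ≤ V) {ρ c : ℝ} (hρ0 : 0 ≤ ρ) (hρ1 : ρ < 1) (hc : 0 ≤ c)
    (hdrift : ∀ x, T V x ≤ ρ * V x + c) {R : ℝ} (hR : 4 * c ≤ (1 - ρ) * R) (hR0 : 0 < R)
    (o : E) {α : ℝ} (hα0 : 0 < α)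
    (hminor : ∀ x, V x ≤ R → ∀ g, 0 ≤ g → α * g o ≤ T g x) :
    ∃ β q : ℝ, 0 < β ∧ 0 ≤ q ∧ q < 1 ∧ ∀ (f : E → ℝ) (A : ℝ), 0 ≤ A →
      (∀ x y, f x - f y ≤ A * (2 + β * (V x + V y))) →
      ∀ x y, T f x - T f y ≤ q * A * (2 + β * (V x + V y)) := by
  -- `β` is small enough that the drift constant costs at most `2 β c ≤ α`, half of the gain `2 α`
  -- from minorization.
  set β : ℝ := α / (2 * (c + 1)) with hβ
  have hβ0 : 0 < β := by positivity
  have hβc : 2 * β * c ≤ α := by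
    rw [hβ]
    have : 2 * (α / (2 * (c + 1))) * c = α * (c / (c + 1)) := by field_simp
    rw [this]
    exact mul_le_of_le_one_right hα0.le ((div_le_one (by linarith)).2 (by linarith))
  -- `δ` is the ratio of `(1 - ρ) / 2 * β * s` to `2 + β * s` at `s = R`; the ratio increases in
  -- `s`, so `δ` works for all `s ≥ R`.
  set δ : ℝ := (1 - ρ) / 2 * β * R / (2 + β * R) with hδ
  have hden : 0 < 2 + β * R := by positivity
  have hδ0 : 0 < δ := by
    have : 0 < 1 - ρ := by linarith
    positivity
  set q : ℝ := max (max (1 - α / 2) ρ) (1 - δ) with hq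
  have hq1 : 1 - α / 2 ≤ q := (le_max_left _ _).trans (le_max_left _ _)
  have hq2 : ρ ≤ q := (le_max_right _ _).trans (le_max_left _ _)
  have hq3 : 1 - δ ≤ q := le_max_right _ _
  refine ⟨β, q, hβ0, hρ0.trans hq2, max_lt (max_lt (by linarith) hρ1) (by linarith), ?_⟩
  intro f A hA hf x y
  have : Nonempty E := ⟨o⟩
  have hbdd : ∀ x, ∀ y, f x - A * (1 + β * V x) ≤ f y + A * (1 + β * V y) := fun x y => by
    linarith [hf x y]
  -- Centring: the bound on oscillations is equivalent to `|f - c₀| ≤ A (1 + β V)` for a suitable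
  -- constant, which makes `A w ± g` non-negative and so accessible to a positive operator.
  set c₀ : ℝ := ⨅ y, (f y + A * (1 + β * V y)) with hc₀
  have hup : ∀ y, c₀ ≤ f y + A * (1 + β * V y) := fun y =>
    ciInf_le ⟨f o - A * (1 + β * V o), by rintro _ ⟨z, rfl⟩; exact hbdd o z⟩ y
  have hlo : ∀ x, f x - A * (1 + β * V x) ≤ c₀ := fun x => le_ciInf (hbdd x)
  set w : E → ℝ := 1 + β • V with hw
  set g : E → ℝ := f - fun _ => c₀ with hg
  have hTg : ∀ x, T g x = T f x - c₀ := fun x => by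
    rw [hg, map_sub, hT.map_const]; rfl
  have hTw : ∀ x, T w x = 1 + β * T V x := fun x => by
    rw [hw, map_add, map_smul, hT.map_one]; rfl
  have hp : 0 ≤ A • w - g := fun x => by
    have := hlo x
    simp only [hw, hg, Pi.zero_apply, Pi.sub_apply, Pi.smul_apply, Pi.add_apply, Pi.one_apply,
      smul_eq_mul]
    linarith
  have hn : 0 ≤ A • w + g := fun x => by
    have := hup x
    simp only [hw, hg, Pi.zero_apply, Pi.sub_apply, Pi.smul_apply, Pi.add_apply, Pi.one_apply,
      smul_eq_mul]
    linarith
  have e1 : T (A • w - g) x = A * (1 + β * T V x) - (T f x - c₀) := by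
    rw [map_sub, map_smul, Pi.sub_apply, Pi.smul_apply, hTw, hTg, smul_eq_mul]
  have e2 : T (A • w + g) y = A * (1 + β * T V y) + (T f y - c₀) := by
    rw [map_add, map_smul, Pi.add_apply, Pi.smul_apply, hTw, hTg, smul_eq_mul]
  set s := V x + V y with hs
  have hVx := hV x
  have hVy := hV y
  simp only [Pi.zero_apply] at hVx hVy
  have hTV : T V x + T V y ≤ ρ * s + 2 * c := by
    have := hdrift x
    have := hdrift y
    rw [hs]; linarith
  have hs0 : 0 ≤ s := add_nonneg hVx hVy
  have hβs : 0 ≤ β * s := by positivity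
  rw [mul_comm q A, mul_assoc]
  by_cases hsmall : V x ≤ R ∧ V y ≤ R
  -- Both points lie in the sublevel set: minorization of `A w - g` at `x` and of `A w + g` at `y`
  -- adds up to a gain of at least `2 α A`, since the values of `g` at `o` cancel and `w o ≥ 1`.
  · have h1 := hminor x hsmall.1 _ hp
    have h2 := hminor y hsmall.2 _ hn
    rw [e1] at h1
    rw [e2] at h2
    simp only [Pi.sub_apply, Pi.add_apply, Pi.smul_apply, smul_eq_mul] at h1 h2
    have hwo : 1 ≤ w o := by
      have := hV o
      simp only [hw, Pi.add_apply, Pi.one_apply, Pi.smul_apply, smul_eq_mul, Pi.zero_apply] at this ⊢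
      have := mul_nonneg hβ0.le this
      linarith
    have h3 : α * A ≤ α * (A * w o) :=
      mul_le_mul_of_nonneg_left (le_mul_of_one_le_right hA hwo) hα0.le
    have h4 : T f x - T f y ≤ A * (2 + β * (T V x + T V y) - 2 * α) := by
      linarith
    refine h4.trans (mul_le_mul_of_nonneg_left ?_ hA)
    have h5 : β * (T V x + T V y) ≤ β * (ρ * s + 2 * c) := mul_le_mul_of_nonneg_left hTV hβ0.le
    have h6 : ρ * (β * s) ≤ q * (β * s) := mul_le_mul_of_nonneg_right hq2 hβs
    linarith
  -- One point lies outside, so `R ≤ s`, and by the choice of `R` the drift alone shrinks the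
  -- weighted part.
  · have h1 := hT.nonneg _ hp x
    have h2 := hT.nonneg _ hn y
    rw [e1] at h1
    rw [e2] at h2
    simp only [Pi.zero_apply] at h1 h2
    have h4 : T f x - T f y ≤ A * (2 + β * (T V x + T V y)) := by linarith
    refine h4.trans (mul_le_mul_of_nonneg_left ?_ hA)
    have hsR : R ≤ s := by
      by_contra hlt
      exact hsmall ⟨by linarith [not_le.1 hlt], by linarith [not_le.1 hlt]⟩
    have h5 : β * (T V x + T V y) ≤ β * (ρ * s + 2 * c) := mul_le_mul_of_nonneg_left hTV hβ0.le
    have h6 : 4 * c ≤ (1 - ρ) * s := hR.trans (mul_le_mul_of_nonneg_left hsR (by linarith))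
    have h7 : δ * (2 + β * s) ≤ (1 - ρ) / 2 * (β * s) := by
      have h8 : δ * (2 + β * R) = (1 - ρ) / 2 * β * R := by rw [hδ]; field_simp
      have h9 : 0 ≤ (1 - ρ) / 2 * β := by
        have : 0 < 1 - ρ := by linarith
        positivity
      have h10 : δ * (2 + β * s) * (2 + β * R) ≤ (1 - ρ) / 2 * (β * s) * (2 + β * R) := by
        calc δ * (2 + β * s) * (2 + β * R) = (1 - ρ) / 2 * β * (R * (2 + β * s)) := by
              rw [mul_right_comm, h8]; ring
          _ ≤ (1 - ρ) / 2 * β * (s * (2 + β * R)) :=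
              mul_le_mul_of_nonneg_left (by linarith) h9
          _ = _ := by ring
      exact le_of_mul_le_mul_right h10 hden
    have h11 : (1 - δ) * (2 + β * s) ≤ q * (2 + β * s) :=
      mul_le_mul_of_nonneg_right hq3 (by linarith)
    have h12 : β * (4 * c) ≤ β * ((1 - ρ) * s) := mul_le_mul_of_nonneg_left h6 hβ0.le
    linarith

lemma IsMarkovOp.pow_drift {K : (E → ℝ) →ₗ[ℝ] (E → ℝ)} (hK : IsMarkovOp K) {V : E → ℝ}
    {ρ b : ℝ} (hρ0 : 0 ≤ ρ) (hρ1 : ρ < 1) (hb : 0 ≤ b)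
    (hdrift : ∀ x, K V x ≤ ρ * V x + b) (n : ℕ) (x : E) :
    (K ^ n) V x ≤ ρ ^ n * V x + b / (1 - ρ) := by
  have h1 : 0 < 1 - ρ := by linarith
  induction n generalizing x with
  | zero => simpa using div_nonneg hb h1.le
  | succ n ih =>
    have h2 : K V ≤ ρ • V + fun _ => b := hdrift
    have h3 := (hK.pow n).mono h2 x
    rw [map_add, map_smul, (hK.pow n).map_const] at h3
    rw [pow_succ, Module.End.mul_apply]
    refine h3.trans ?_
    simp only [Pi.add_apply, Pi.smul_apply, smul_eq_mul]
    have h4 : b / (1 - ρ) = ρ * (b / (1 - ρ)) + b := by field_simp; ring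
    rw [h4, pow_succ']
    linarith [mul_le_mul_of_nonneg_left (ih x) hρ0]

/-- Harris' theorem for a chain with a geometric drift condition and a reachable atom. -/
theorem IsMarkovOp.exists_stationary {K : (E → ℝ) →ₗ[ℝ] (E → ℝ)} (hK : IsMarkovOp K) {V : E → ℝ}
    (hV : 0 ≤ V) {ρ b : ℝ} (hρ0 : 0 ≤ ρ) (hρ1 : ρ < 1) (hb : 0 ≤ b)
    (hdrift : ∀ x, K V x ≤ ρ * V x + b) (o : E)
    (hminor : ∀ R : ℝ, ∃ m : ℕ, 1 ≤ m ∧ ∃ α : ℝ, 0 < α ∧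
      ∀ x, V x ≤ R → ∀ g, 0 ≤ g → α * g o ≤ (K ^ m) g x)
    (hfin : ∀ R : ℝ, {x | V x ≤ R}.Finite) :
    ∃ π : E → ℝ, (∀ x, 0 ≤ π x) ∧ HasSum π 1 ∧
      (∀ x y, Tendsto (fun n : ℕ => (K ^ n) (Set.indicator {y} 1) x) atTop (𝓝 (π y))) ∧
      ∀ (n : ℕ) (y : E), HasSum (fun x => π x * (K ^ n) (Set.indicator {y} 1) x) (π y) := by
  have h1ρ : 0 < 1 - ρ := by linarith
  set c : ℝ := b / (1 - ρ) with hc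
  have hc0 : 0 ≤ c := div_nonneg hb h1ρ.le
  have hpd := fun n x => hK.pow_drift hρ0 hρ1 hb hdrift n x
  -- The `1` added to `c` keeps the level positive even if `c = 0`. The contraction is applied to `K
  -- ^ m`, whose drift constants `ρ` and `c` do not depend on `m`.
  obtain ⟨m, hm1, α, hα0, hmin⟩ := hminor (4 * (c + 1) / (1 - ρ))
  have hTd : ∀ x, (K ^ m) V x ≤ ρ * V x + c := fun x => by
    have h1 := hpd m x
    have h2 := mul_le_mul_of_nonneg_right (pow_le_of_le_one hρ0 hρ1.le (by omega : m ≠ 0)) (hV x)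
    linarith
  obtain ⟨β, q, hβ0, hq0, hq1, hcontr⟩ := (hK.pow m).exists_contraction hV hρ0 hρ1 hc0 hTd
    (R := 4 * (c + 1) / (1 - ρ)) (by rw [mul_div_cancel₀ _ h1ρ.ne']; linarith) (by positivity) o
    hα0 hmin
  set a : ℕ → ℝ := fun n => q ^ (n / m) with ha
  have ha0 : Tendsto a atTop (𝓝 0) :=
    (tendsto_pow_atTop_nhds_zero_of_lt_one hq0 hq1).comp (Nat.tendsto_div_const_atTop (by omega))
  -- Write `n = m (n / m) + n % m`: the `n % m` leftover steps keep values in `[0, 1]`, and each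
  -- block of `m` steps contracts by `q`.
  have hosc : ∀ f : E → ℝ, 0 ≤ f → f ≤ 1 → ∀ n x y,
      (K ^ n) f x - (K ^ n) f y ≤ a n * (2 + β * (V x + V y)) := by
    intro f hf0 hf1 n
    have hj : ∀ j r, ∀ x y, ((K ^ m) ^ j) ((K ^ r) f) x - ((K ^ m) ^ j) ((K ^ r) f) y ≤
        q ^ j * (2 + β * (V x + V y)) := by
      intro j r
      induction j with
      | zero =>
        intro x y
        have h1 := (hK.pow r).nonneg f hf0 y
        have h2 := (hK.pow r).mono hf1 x
        rw [(hK.pow r).map_one] at h2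
        have h3 : 0 ≤ β * (V x + V y) := mul_nonneg hβ0.le (add_nonneg (hV x) (hV y))
        simp only [Pi.zero_apply, Pi.one_apply] at h1 h2
        simp only [pow_zero, Module.End.one_apply, one_mul]
        linarith
      | succ j ih =>
        intro x y
        have := hcontr _ _ (pow_nonneg hq0 j) ih x y
        rw [pow_succ' (K ^ m), Module.End.mul_apply, pow_succ' q]
        exact this
    have hn : K ^ n = (K ^ m) ^ (n / m) * K ^ (n % m) := by
      rw [← pow_mul, ← pow_add, Nat.div_add_mod]
    rw [hn]
    exact hj (n / m) (n % m)
  have hlim : ∀ f : E → ℝ, 0 ≤ f → f ≤ 1 → ∃ l : ℝ, ∀ x, Tendsto (fun n => (K ^ n) f x) atTop (𝓝 l) := by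
    intro f hf0 hf1
    -- `(K ^ (n + j)) f x - (K ^ n) f x` is the average, over the state after `j` steps, of the
    -- oscillation of `(K ^ n) f`; the mean of `V` after `j` steps is bounded uniformly in `j`.
    have hcauchy : ∀ x, CauchySeq fun n => (K ^ n) f x := by
      intro x
      refine cauchySeq_of_le_tendsto_0' (fun n => a n * (2 + β * (2 * V x + c))) ?_ ?_
      · intro n l hnl
        obtain ⟨j, rfl⟩ := Nat.exists_eq_add_of_le' hnl
        have hVj : (K ^ j) V x ≤ V x + c := (hpd j x).trans
          (add_le_add_left (mul_le_of_le_one_left (hV x) (pow_le_one₀ hρ0 hρ1.le)) _)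
        have hbnd : a n * (2 + β * ((K ^ j) V x + V x)) ≤ a n * (2 + β * (2 * V x + c)) := by
          refine mul_le_mul_of_nonneg_left ?_ (pow_nonneg hq0 _)
          have := mul_le_mul_of_nonneg_left hVj hβ0.le
          linarith
        have hconst : ∀ d : ℝ, (K ^ j) (fun y => a n * (2 + β * (V y + V x)) + d) x =
            a n * (2 + β * ((K ^ j) V x + V x)) + d := by
          intro d
          have : (fun y => a n * (2 + β * (V y + V x)) + d) =
              (a n * β) • V + fun _ => a n * (2 + β * V x) + d := by
            funext y
            simp only [Pi.add_apply, Pi.smul_apply, smul_eq_mul]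
            ring
          rw [this, map_add, map_smul, (hK.pow j).map_const]
          simp only [Pi.add_apply, Pi.smul_apply, smul_eq_mul]
          ring
        have hup : (K ^ j) ((K ^ n) f) x ≤ a n * (2 + β * ((K ^ j) V x + V x)) + (K ^ n) f x := by
          rw [← hconst]
          exact (hK.pow j).mono (fun y => by have := hosc f hf0 hf1 n y x; linarith) x
        have hlo : (K ^ n) f x - a n * (2 + β * ((K ^ j) V x + V x)) ≤ (K ^ j) ((K ^ n) f) x := by
          have h1 : (fun y => -(a n * (2 + β * (V y + V x)) + -(K ^ n) f x)) ≤ (K ^ n) f := fun y => by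
            have := hosc f hf0 hf1 n x y
            simp only
            rw [add_comm (V y)]
            linarith
          have h2 := (hK.pow j).mono h1 x
          have h3 : (fun y => -(a n * (2 + β * (V y + V x)) + -(K ^ n) f x)) =
            -(fun y => a n * (2 + β * (V y + V x)) + -(K ^ n) f x) := rfl
          rw [h3, map_neg, Pi.neg_apply, hconst] at h2
          linarith
        rw [dist_comm, Real.dist_eq, pow_add, Module.End.mul_apply, abs_le]
        constructor <;> linarith
      · simpa using ha0.mul_const (2 + β * (2 * V x + c))
    choose l hl using fun x => cauchySeq_tendsto_of_complete (hcauchy x)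
    have hle : ∀ x y, l x ≤ l y := fun x y => by
      have h1 := (hl x).sub (hl y)
      have h2 : Tendsto (fun n => a n * (2 + β * (V x + V y))) atTop (𝓝 0) := by
        simpa using ha0.mul_const (2 + β * (V x + V y))
      have := le_of_tendsto_of_tendsto' h1 h2 fun n => hosc f hf0 hf1 n x y
      linarith
    exact ⟨l o, fun x => (le_antisymm (hle x o) (hle o x)) ▸ hl x⟩
  have hind0 : ∀ B : Set E, (0 : E → ℝ) ≤ B.indicator 1 := fun B =>
    Set.indicator_nonneg fun _ _ => zero_le_one
  have hind1 : ∀ B : Set E, B.indicator 1 ≤ (1 : E → ℝ) := fun B =>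
    Set.indicator_le_self' fun _ _ => zero_le_one
  choose π hπ using fun y : E => hlim (Set.indicator {y} 1) (hind0 _) (hind1 _)
  have hπ0 : ∀ y, 0 ≤ π y := fun y => ge_of_tendsto' (hπ y o) fun n => hK.indicator_nonneg _ n o
  have hfinsum : ∀ (F : Finset E) (g : E → ℝ), Tendsto (fun n => (K ^ n)
      (fun x => ∑ y ∈ F, g y * Set.indicator {y} 1 x) o) atTop (𝓝 (∑ y ∈ F, π y * g y)) := by
    intro F g
    have h1 : ∀ n, (K ^ n) (fun x => ∑ y ∈ F, g y * Set.indicator {y} 1 x) o =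
        ∑ y ∈ F, (K ^ n) (Set.indicator {y} 1) o * g y := by
      intro n
      have : (fun x => ∑ y ∈ F, g y * Set.indicator {y} (1 : E → ℝ) x) =
          ∑ y ∈ F, g y • Set.indicator {y} (1 : E → ℝ) := by
        funext x
        simp [Finset.sum_apply]
      rw [this, map_sum, Finset.sum_apply]
      exact Finset.sum_congr rfl fun y _ => by rw [map_smul, Pi.smul_apply, smul_eq_mul, mul_comm]
    simp_rw [h1]
    exact tendsto_finsetSum _ fun y _ => (hπ y o).mul_const _
  have hsumF : ∀ (F : Finset E) (g : E → ℝ) (x : E), ∑ y ∈ F, g y * Set.indicator {y} 1 x =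
      (F : Set E).indicator g x := by
    classical
    intro F g x
    simp [Set.indicator_apply]
  have hle : ∀ g : E → ℝ, 0 ≤ g → ∀ l, Tendsto (fun n => (K ^ n) g o) atTop (𝓝 l) →
      ∀ F : Finset E, ∑ y ∈ F, π y * g y ≤ l := by
    intro g hg l hl F
    refine le_of_tendsto_of_tendsto' (hfinsum F g) hl fun n => (hK.pow n).mono (fun x => ?_) o
    rw [hsumF]
    exact Set.indicator_le_self' (fun _ _ => hg _) x
  have hone : Tendsto (fun n => (K ^ n) 1 o) atTop (𝓝 1) := by
    simp_rw [(hK.pow _).map_one]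
    exact tendsto_const_nhds
  have hsummable : Summable π := summable_of_sum_le (c := 1) hπ0 fun F => by
    simpa using hle 1 zero_le_one 1 hone F
  have htsum1 : ∑' x, π x = 1 := by
    refine le_antisymm (hsummable.tsum_le_of_sum_le fun F => by
      simpa using hle 1 zero_le_one 1 hone F) ?_
    -- Tightness: by Markov's inequality at most `(V o + c) / (n + 1)` of the mass ever lies outside
    -- the finite set `V ≤ n + 1`, so no mass escapes in the limit.
    have hR : ∀ n : ℕ, 1 - (V o + c) / (n + 1) ≤ ∑' x, π x := by
      intro n
      have hn : (0 : ℝ) < n + 1 := by positivity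
      have h1 := hfinsum (hfin (n + 1)).toFinset 1
      refine le_trans ?_ (hsummable.sum_le_tsum (hfin (n + 1)).toFinset fun x _ => hπ0 x)
      rw [show ∑ y ∈ (hfin (n + 1)).toFinset, π y =
        ∑ y ∈ (hfin (n + 1)).toFinset, π y * (1 : E → ℝ) y by simp]
      refine ge_of_tendsto' h1 fun j => ?_
      have h2 : (1 : E → ℝ) - ((n + 1 : ℝ)⁻¹) • V ≤ fun x => ∑ y ∈ (hfin (n + 1)).toFinset,
          (1 : E → ℝ) y * Set.indicator {y} 1 x := by
        intro x
        change _ ≤ ∑ y ∈ (hfin (n + 1)).toFinset, (1 : E → ℝ) y * Set.indicator {y} 1 x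
        rw [hsumF]
        simp only [Pi.sub_apply, Pi.one_apply, Pi.smul_apply, smul_eq_mul]
        by_cases hx : V x ≤ n + 1
        · rw [Set.indicator_of_mem (by simpa using hx), Pi.one_apply]
          have := mul_nonneg (inv_nonneg.2 hn.le) (hV x)
          linarith
        · rw [Set.indicator_of_notMem (by simpa using hx)]
          have : 1 ≤ (n + 1 : ℝ)⁻¹ * V x := by
            rw [inv_mul_eq_div, le_div_iff₀ hn]
            linarith
          linarith
      have h3 := (hK.pow j).mono h2 o
      rw [map_sub, map_smul, (hK.pow j).map_one] at h3
      refine le_trans ?_ h3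
      have hVj : (K ^ j) V o ≤ V o + c := (hpd j o).trans
          (add_le_add_left (mul_le_of_le_one_left (hV o) (pow_le_one₀ hρ0 hρ1.le)) _)
      simp only [Pi.sub_apply, Pi.one_apply, Pi.smul_apply, smul_eq_mul]
      rw [div_eq_inv_mul]
      have := mul_le_mul_of_nonneg_left hVj (inv_nonneg.2 hn.le)
      linarith
    have hlim0 : Tendsto (fun n : ℕ => 1 - (V o + c) / ((n : ℝ) + 1)) atTop (𝓝 (1 - 0)) :=
      tendsto_const_nhds.sub (tendsto_const_nhds.div_atTop
        (tendsto_natCast_atTop_atTop.atTop_add tendsto_const_nhds))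
    rw [sub_zero] at hlim0
    exact le_of_tendsto' hlim0 hR
  -- Finite partial sums give only one inequality; applied to both `g` and `1 - g`, whose limits add
  -- up to the total mass, they give equality.
  have hexp : ∀ g : E → ℝ, 0 ≤ g → g ≤ 1 → ∀ l, Tendsto (fun n => (K ^ n) g o) atTop (𝓝 l) →
      HasSum (fun x => π x * g x) l := by
    intro g hg0 hg1 l hl
    have hs : ∀ g : E → ℝ, 0 ≤ g → g ≤ 1 → Summable fun x => π x * g x := fun g hg0 hg1 =>
      hsummable.of_nonneg_of_le (fun x => mul_nonneg (hπ0 x) (hg0 x))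
        fun x => mul_le_of_le_one_right (hπ0 x) (hg1 x)
    have hs1 := hs g hg0 hg1
    have hs2 := hs (1 - g) (sub_nonneg.2 hg1) (sub_le_self _ hg0)
    have h1 := hs1.tsum_le_of_sum_le (hle g hg0 l hl)
    have hl' : Tendsto (fun n => (K ^ n) (1 - g) o) atTop (𝓝 (1 - l)) := by
      have : ∀ n, (K ^ n) (1 - g) o = (K ^ n) 1 o - (K ^ n) g o := fun n => by
        rw [map_sub, Pi.sub_apply]
      simp_rw [this]
      exact hone.sub hl
    have h2 := hs2.tsum_le_of_sum_le (hle (1 - g) (sub_nonneg.2 hg1) _ hl')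
    have h3 : ∑' x, π x * g x + ∑' x, π x * (1 - g) x = 1 := by
      rw [← hs1.tsum_add hs2, ← htsum1]
      refine tsum_congr fun x => ?_
      simp only [Pi.sub_apply, Pi.one_apply]
      ring
    have h4 : ∑' x, π x * g x = l := by linarith
    exact h4 ▸ hs1.hasSum
  have hsum1 := hsummable.hasSum
  rw [htsum1] at hsum1
  refine ⟨π, hπ0, hsum1, fun x y => hπ y x, fun n y => ?_⟩
  refine hexp _ (fun x => hK.indicator_nonneg _ n x) (fun x => hK.indicator_le_one _ n x) _ ?_
  -- Invariance: the averages of `(K ^ n) 1_{y}` over the law after `j` steps are the probabilities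
  -- after `j + n` steps, with the same limit.
  have h1 := (tendsto_add_atTop_iff_nat n).2 (hπ y o)
  refine h1.congr fun j => ?_
  rw [pow_add, Module.End.mul_apply]

end Harris

/-! ### From the uniformized chain to continuous time -/

section Stability
variable {E : Type*}

lemma tendsto_poissonWeight {γ : ℝ} (hγ : 0 < γ) (k : ℕ) :
    Tendsto (fun t : ℝ≥0 => poissonWeight γ k t) atTop (𝓝 0) := by
  have h1 := (Real.tendsto_pow_mul_exp_neg_atTop_nhds_zero k).div_const (k ! : ℝ)
  rw [zero_div] at h1
  have h2 : Tendsto (fun t : ℝ≥0 => γ * (t : ℝ)) atTop atTop :=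
    (NNReal.tendsto_coe_atTop.2 tendsto_id).const_mul_atTop hγ
  refine (h1.comp h2).congr fun t => ?_
  simp only [Function.comp_apply, poissonWeight]
  ring

/-- The Poisson law of mean `γ t` leaves every finite set of indices as `t → ∞`, so only the tail of
the bounded sequence counts. -/
lemma tendsto_poisson_average {γ : ℝ} (hγ : 0 < γ) {a : ℕ → ℝ} {l : ℝ} (h0 : ∀ k, 0 ≤ a k)
    (h1 : ∀ k, a k ≤ 1) (ha : Tendsto a atTop (𝓝 l)) :
    Tendsto (fun t : ℝ≥0 => ∑' k, poissonWeight γ k t * a k) atTop (𝓝 l) := by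
  have hl0 : 0 ≤ l := ge_of_tendsto' ha h0
  have hl1 : l ≤ 1 := le_of_tendsto' ha h1
  refine Metric.tendsto_atTop.2 fun ε hε => ?_
  obtain ⟨n, hn⟩ := Metric.tendsto_atTop.1 ha (ε / 2) (half_pos hε)
  have hsmall : Tendsto (fun t : ℝ≥0 => ∑ k ∈ Finset.range n, poissonWeight γ k t) atTop (𝓝 0) := by
    simpa using tendsto_finsetSum (Finset.range n) fun k _ => tendsto_poissonWeight hγ k
  obtain ⟨t₀, ht₀⟩ := eventually_atTop.1 (hsmall.eventually_lt_const (half_pos hε))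
  refine ⟨t₀, fun t ht => ?_⟩
  have hw := hasSum_poissonWeight hγ t.coe_nonneg
  have hw0 := poissonWeight_nonneg hγ t.coe_nonneg
  have hs1 : Summable fun k => poissonWeight γ k t * a k :=
    hw.summable.of_nonneg_of_le (fun k => mul_nonneg (hw0 k) (h0 k))
      fun k => mul_le_of_le_one_right (hw0 k) (h1 k)
  have hd : ∀ k, |a k - l| ≤ 1 := fun k => by
    rw [abs_le]
    constructor <;> linarith [h0 k, h1 k]
  have hdiff : ∑' k, poissonWeight γ k t * a k - l = ∑' k, poissonWeight γ k t * (a k - l) := by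
    have : l = ∑' k, poissonWeight γ k t * l := by rw [tsum_mul_right, hw.tsum_eq, one_mul]
    conv_lhs => rw [this]
    rw [← hs1.tsum_sub (hw.summable.mul_right l)]
    exact tsum_congr fun k => by ring
  have hbound : ∀ k, ‖poissonWeight γ k t * (a k - l)‖ ≤ poissonWeight γ k t * (ε / 2) +
      (if k ∈ Finset.range n then poissonWeight γ k t else 0) := by
    intro k
    rw [norm_mul, Real.norm_of_nonneg (hw0 k), Real.norm_eq_abs]
    split_ifs with hk
    · have := mul_le_mul_of_nonneg_left (hd k) (hw0 k)
      have := mul_nonneg (hw0 k) (half_pos hε).le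
      linarith
    · rw [add_zero]
      refine mul_le_mul_of_nonneg_left ?_ (hw0 k)
      have := hn k (by simpa using hk)
      rw [Real.dist_eq] at this
      exact this.le
  have hsum : HasSum (fun k => poissonWeight γ k t * (ε / 2) +
      (if k ∈ Finset.range n then poissonWeight γ k t else 0))
      (1 * (ε / 2) + ∑ k ∈ Finset.range n, poissonWeight γ k t) := by
    refine (hw.mul_right _).add ?_
    have h : HasSum (fun k => if k ∈ Finset.range n then poissonWeight γ k t else 0)
        (∑ k ∈ Finset.range n, if k ∈ Finset.range n then poissonWeight γ k t else 0) :=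
      hasSum_sum_of_ne_finset_zero fun k hk => if_neg hk
    rwa [Finset.sum_congr rfl fun k hk => if_pos hk] at h
  rw [dist_eq_norm, hdiff]
  refine (tsum_of_norm_bounded hsum hbound).trans_lt ?_
  have := ht₀ t ht
  linarith

/-- Stability of a uniformizable chain with a geometric drift condition and a reachable atom. -/
theorem isErgodicallyStable_of_drift {K : (E → ℝ) →ₗ[ℝ] (E → ℝ)} (hK : IsMarkovOp K) {γ : ℝ}
    (hγ : 0 < γ) {L : Generator E} (hL : ∀ f, L f = γ • (K f - f)) {V : E → ℝ}
    (hV : 0 ≤ V) {ρ b : ℝ} (hρ0 : 0 ≤ ρ) (hρ1 : ρ < 1) (hb : 0 ≤ b)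
    (hdrift : ∀ x, K V x ≤ ρ * V x + b) (o : E)
    (hminor : ∀ R : ℝ, ∃ m : ℕ, 1 ≤ m ∧ ∃ α : ℝ, 0 < α ∧
      ∀ x, V x ≤ R → ∀ g, 0 ≤ g → α * g o ≤ (K ^ m) g x)
    (hfin : ∀ R : ℝ, {x | V x ≤ R}.Finite) : IsErgodicallyStable L := by
  obtain ⟨π, hπ0, hπ1, hπlim, hπinv⟩ :=
    hK.exists_stationary hV hρ0 hρ1 hb hdrift o hminor hfin
  have hw := fun t : ℝ≥0 => hasSum_poissonWeight hγ t.coe_nonneg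
  have hw0 := fun t : ℝ≥0 => poissonWeight_nonneg hγ t.coe_nonneg
  have hs : ∀ (t : ℝ≥0) x y, Summable fun k =>
      poissonWeight γ k t * (K ^ k) (Set.indicator {y} 1) x := fun t x y =>
    (hw t).summable.of_nonneg_of_le (fun k => mul_nonneg (hw0 t k) (hK.indicator_nonneg _ _ _))
      fun k => mul_le_of_le_one_right (hw0 t k) (hK.indicator_le_one _ _ _)
  have htp := fun (t : ℝ≥0) (x y : E) => transProb_eq_tsum hK hL t x y
  have htp0 : ∀ (t : ℝ≥0) x y, 0 ≤ transProb L t x y := fun t x y => by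
    rw [htp]
    exact tsum_nonneg fun k => mul_nonneg (hw0 t k) (hK.indicator_nonneg _ _ _)
  have htp1 : ∀ (t : ℝ≥0) x y, transProb L t x y ≤ 1 := fun t x y => by
    rw [htp, ← (hw t).tsum_eq]
    exact (hs t x y).tsum_le_tsum
      (fun k => mul_le_of_le_one_right (hw0 t k) (hK.indicator_le_one _ _ _)) (hw t).summable
  have hlim : ∀ x y, Tendsto (fun t : ℝ≥0 => transProb L t x y) atTop (𝓝 (π y)) := by
    intro x y
    simp_rw [htp]
    exact tendsto_poisson_average hγ (fun k => hK.indicator_nonneg _ _ _)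
      (fun k => hK.indicator_le_one _ _ _) (hπlim x y)
  refine ⟨π, ⟨hπ0, hπ1, fun t y => ?_⟩, fun π' hπ' => funext fun y => ?_, hlim⟩
  -- Invariance at time `t` is the Poisson mixture of the invariances under `K ^ k`; absolute
  -- summability over pairs justifies the exchange of sums.
  · have hprod : Summable fun p : E × ℕ => π p.1 * poissonWeight γ p.2 t :=
      hπ1.summable.mul_of_nonneg (hw t).summable hπ0 (hw0 t)
    have hF : Summable fun p : E × ℕ =>
        π p.1 * (poissonWeight γ p.2 t * (K ^ p.2) (Set.indicator {y} 1) p.1) := by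
      refine hprod.of_nonneg_of_le (fun p => mul_nonneg (hπ0 _)
        (mul_nonneg (hw0 t _) (hK.indicator_nonneg _ _ _))) fun p => ?_
      exact mul_le_mul_of_nonneg_left
        (mul_le_of_le_one_right (hw0 t _) (hK.indicator_le_one _ _ _)) (hπ0 _)
    have h1 := hF.hasSum.prod_fiberwise fun x => ((hs t x y).hasSum.mul_left (π x))
    have h2 := ((Equiv.prodComm ℕ E).hasSum_iff.2 hF.hasSum).prod_fiberwise
      (g := fun k => poissonWeight γ k t * π y) fun k => by
        have h := (hπinv k y).mul_left (poissonWeight γ k t)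
        have heq : (fun x => poissonWeight γ k t * (π x * (K ^ k) (Set.indicator {y} 1) x)) =
            fun x => π x * (poissonWeight γ k t * (K ^ k) (Set.indicator {y} 1) x) :=
          funext fun x => mul_left_comm _ _ _
        rw [heq] at h
        exact h
    have h3 := h2.unique ((hw t).mul_right (π y))
    rw [h3, one_mul] at h1
    simpa only [htp] using h1
  -- Uniqueness: the `π'`-average of the transition probabilities is constant in `t` and, by
  -- dominated convergence, tends to `π y`.
  · have h1 : Tendsto (fun t : ℝ≥0 => ∑' x, π' x * transProb L t x y) atTop
        (𝓝 (∑' x, π' x * π y)) := by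
      refine tendsto_tsum_of_dominated_convergence hπ'.hasSum_one.summable
        (fun x => (hlim x y).const_mul _) (Eventually.of_forall fun t x => ?_)
      rw [norm_mul, Real.norm_of_nonneg (hπ'.nonneg x), Real.norm_of_nonneg (htp0 t x y)]
      exact mul_le_of_le_one_right (hπ'.nonneg x) (htp1 t x y)
    simp_rw [fun t => (hπ'.invariant t y).tsum_eq] at h1
    rw [tsum_mul_right, hπ'.hasSum_one.tsum_eq, one_mul] at h1
    exact tendsto_nhds_unique tendsto_const_nhds h1

end Stability

/-! ### Tail sums under arrivals and departures matched by rank -/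

section TailSums
variable {N : ℕ}

/-- `∑_{i ≥ m} Q̄_i`, in closed form. -/
def excess (c : Fin N → ℕ) (m : ℕ) : ℕ := ∑ n, (c n + 1 - m)

lemma tailSums_eq_excess (c : Fin N → ℕ) (m : ℕ+) : tailSums c m = excess c m := by
  have hB : ∀ n, c n < Finset.univ.sup c + 1 := fun n =>
    Nat.lt_succ_of_le (Finset.le_sup (f := c) (Finset.mem_univ n))
  rw [tailSums, tsum_eq_sum (s := Finset.range (Finset.univ.sup c + 1))]
  · simp only [occupancy, Finset.card_filter, excess]
    rw [Finset.sum_comm]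
    refine Finset.sum_congr rfl fun n _ => ?_
    rw [← Finset.card_filter]
    have : (Finset.range (Finset.univ.sup c + 1)).filter (fun i => (m : ℕ) + i ≤ c n) =
        Finset.range (c n + 1 - m) := by
      ext i
      have := hB n
      have := m.pos
      simp only [Finset.mem_filter, Finset.mem_range]
      omega
    rw [this, Finset.card_range]
  · intro i hi
    rw [occupancy, Finset.card_eq_zero, Finset.filter_eq_empty_iff]
    intro n _ h
    have := hB n
    have : Finset.univ.sup c + 1 ≤ i := by simpa using hi
    omega

lemma excess_succ (c : Fin N → ℕ) (m : ℕ) : excess c m = occupancy c m + excess c (m + 1) := by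
  rw [excess, excess, occupancy, Finset.card_filter, ← Finset.sum_add_distrib]
  refine Finset.sum_congr rfl fun n _ => ?_
  split_ifs <;> omega

lemma sum_update_add {c : Fin N → ℕ} (f : ℕ → ℕ) (k : Fin N) (v : ℕ) :
    ∑ n, f (Function.update c k v n) + f (c k) = ∑ n, f (c n) + f v := by
  rw [← Finset.add_sum_erase _ _ (Finset.mem_univ k),
    ← Finset.add_sum_erase Finset.univ (fun n => f (c n)) (Finset.mem_univ k),
    Function.update_self,
    Finset.sum_congr rfl fun n hn => by rw [Function.update_of_ne (Finset.ne_of_mem_erase hn)]]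
  ring

lemma excess_inc (c : Fin N → ℕ) (k : Fin N) (m : ℕ) :
    excess (Function.update c k (c k + 1)) m = excess c m + if m ≤ c k + 1 then 1 else 0 := by
  have h := sum_update_add (c := c) (fun v => v + 1 - m) k (c k + 1)
  unfold excess
  split_ifs <;> omega

lemma excess_dec (c : Fin N → ℕ) (k : Fin N) {m : ℕ} (hm : 1 ≤ m) :
    excess (Function.update c k (c k - 1)) m + (if m ≤ c k then 1 else 0) = excess c m := by
  have h := sum_update_add (c := c) (fun v => v + 1 - m) k (c k - 1)
  unfold excess
  split_ifs <;> omega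

lemma occupancy_comp_perm (c : Fin N → ℕ) (σ : Equiv.Perm (Fin N)) (m : ℕ) :
    occupancy (c ∘ σ) m = occupancy c m := by
  simp only [occupancy, Finset.card_filter, Function.comp_apply]
  exact Equiv.sum_comp σ fun n => if m ≤ c n then 1 else 0

/-- The server of the second system with the same rank as server `k` of the first. -/
def rankMatch (c d : Fin N → ℕ) : Equiv.Perm (Fin N) := (Tuple.sort c).symm.trans (Tuple.sort d)

/-- In `d`, servers with at least `m` jobs have rank above `r`; in `c`, all those ranks and `r`
itself carry at least `m` jobs. -/
lemma occupancy_lt_of_rank {c d : Fin N → ℕ} {σ τ : Equiv.Perm (Fin N)} (hc : Monotone (c ∘ σ))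
    (hd : Monotone (d ∘ τ)) (r : Fin N) {m : ℕ} (h1 : d (τ r) < m) (h2 : m ≤ c (σ r)) :
    occupancy d m < occupancy c m := by
  rw [← occupancy_comp_perm d τ, ← occupancy_comp_perm c σ]
  refine Finset.card_lt_card (Finset.ssubset_iff_subset_ne.2 ⟨fun i hi => ?_, fun h => ?_⟩)
  · simp only [Finset.mem_filter, Finset.mem_univ, true_and] at hi ⊢
    rcases le_or_gt i r with hir | hir
    · have := hd hir
      simp only [Function.comp_apply] at this hi
      omega
    · exact h2.trans (hc hir.le)
  · have h3 : r ∈ Finset.univ.filter fun n => m ≤ (c ∘ σ) n := by simpa using h2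
    rw [← h] at h3
    simp only [Finset.mem_filter, Finset.mem_univ, true_and, Function.comp_apply] at h3
    omega

lemma occupancy_lt_of_lt_left {c d : Fin N → ℕ} (k : Fin N) {m : ℕ} (h1 : d (rankMatch c d k) < m)
    (h2 : m ≤ c k) : occupancy d m < occupancy c m :=
  occupancy_lt_of_rank (Tuple.monotone_sort c) (Tuple.monotone_sort d) ((Tuple.sort c).symm k) h1
    (by simpa using h2)

lemma occupancy_lt_of_lt_right {c d : Fin N → ℕ} (k : Fin N) {m : ℕ} (h1 : c k < m)
    (h2 : m ≤ d (rankMatch c d k)) : occupancy c m < occupancy d m :=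
  occupancy_lt_of_rank (Tuple.monotone_sort d) (Tuple.monotone_sort c) ((Tuple.sort c).symm k)
    (by simpa using h1) h2

lemma tailSums_le_iff {c d : Fin N → ℕ} :
    tailSums c ≤ tailSums d ↔ ∀ m, 1 ≤ m → excess c m ≤ excess d m := by
  constructor
  · intro h m hm
    have := h (Nat.toPNat m hm)
    rwa [tailSums_eq_excess, tailSums_eq_excess] at this
  · intro h m
    rw [tailSums_eq_excess, tailSums_eq_excess]
    exact h m m.pos

/-- The order can only be threatened at an `m` where the left tail sum grows and the right one does
not. Then at level `l = m - 1` the partner of `k` has fewer than `l` jobs while `c k ≥ c j ≥ l`, so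
strictly fewer servers of `d` than of `c` reach `l`. The inequality of tail sums at `l` is therefore
strict at `l + 1`, leaving room for one job. -/
lemma tailSums_le_inc {c d : Fin N → ℕ} (h : tailSums c ≤ tailSums d) {j k : Fin N}
    (hjk : c j ≤ c k) : tailSums (Function.update c j (c j + 1)) ≤
      tailSums (Function.update d (rankMatch c d k) (d (rankMatch c d k) + 1)) := by
  rw [tailSums_le_iff] at h ⊢
  intro m hm
  rw [excess_inc, excess_inc]
  have hm' := h m hm
  by_cases hbad : m ≤ c j + 1 ∧ ¬ m ≤ d (rankMatch c d k) + 1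
  · obtain ⟨l, rfl⟩ : ∃ l, m = l + 1 := ⟨m - 1, by omega⟩
    have h1 := occupancy_lt_of_lt_left (c := c) (d := d) k (m := l) (by omega) (by omega)
    have h2 := h l (by omega)
    rw [excess_succ c l, excess_succ d l] at h2
    split_ifs <;> omega
  · split_ifs <;> omega

lemma tailSums_le_inc_right {c d : Fin N → ℕ} (h : tailSums c ≤ tailSums d) (k : Fin N) :
    tailSums c ≤ tailSums (Function.update d k (d k + 1)) := by
  rw [tailSums_le_iff] at h ⊢
  intro m hm
  rw [excess_inc]
  exact (h m hm).trans (Nat.le_add_right _ _)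

/-- The dangerous `m` are those where only the right tail sum drops, that is `c k < m ≤ d (rankMatch
c d k)`. Then more servers of `d` than of `c` reach `m`, and the inequality at `m + 1` makes that at
`m` strict. -/
lemma tailSums_le_dec {c d : Fin N → ℕ} (h : tailSums c ≤ tailSums d) (k : Fin N) :
    tailSums (Function.update c k (c k - 1)) ≤
      tailSums (Function.update d (rankMatch c d k) (d (rankMatch c d k) - 1)) := by
  rw [tailSums_le_iff] at h ⊢
  intro m hm
  have hc := excess_dec c k hm
  have hd := excess_dec d (rankMatch c d k) hm
  have hm' := h m hm
  by_cases hbad : m ≤ d (rankMatch c d k) ∧ ¬ m ≤ c k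
  · have h1 := occupancy_lt_of_lt_right (c := c) (d := d) k (m := m) (by omega) hbad.1
    have h2 := h (m + 1) (by omega)
    rw [excess_succ c m, excess_succ d m] at hm'
    rw [excess_succ c m] at hc
    rw [excess_succ d m] at hd
    rw [if_neg hbad.2] at hc
    rw [if_pos hbad.1] at hd
    omega
  · split_ifs at hc hd <;> omega

end TailSums

/-! ### Attainment of the min–max rate -/

section MinMax
variable {N : ℕ} {lam : Finset (Fin N) → ℝ}

/-- A split that vanishes where it is not relevant. -/
structure IsProperSplit (lam : Finset (Fin N) → ℝ) (p : Finset (Fin N) → Fin N → ℝ) : Prop where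
  nonneg : ∀ S n, 0 ≤ p S n
  sum_eq_one : ∀ S, 0 < lam S → ∑ n, p S n = 1
  eq_zero : ∀ S n, ¬ (0 < lam S ∧ n ∈ S) → p S n = 0

lemma IsProperSplit.isSplit {p : Finset (Fin N) → Fin N → ℝ} (hp : IsProperSplit lam p) :
    IsSplit lam p := fun S hS => ⟨fun n _ => hp.nonneg S n, by
  rw [← hp.sum_eq_one S hS]
  exact Finset.sum_subset (Finset.subset_univ S) fun n _ hn => hp.eq_zero S n fun h => hn h.2⟩

lemma IsProperSplit.splitRate_eq {p : Finset (Fin N) → Fin N → ℝ} (hp : IsProperSplit lam p)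
    (n : Fin N) : splitRate lam p n = ∑ S, lam S * p S n := by
  rw [splitRate, Finset.sum_filter]
  refine Finset.sum_congr rfl fun S _ => ?_
  split_ifs with h
  · rfl
  · rw [hp.eq_zero S n h, mul_zero]

/-- Irrelevant entries of a general split are unconstrained, which spoils compactness; setting them
to zero leaves a closed subset of a cube and does not change the rates. -/
lemma isCompact_properSplits : IsCompact {p | IsProperSplit lam p} := by
  have hK : IsCompact (Set.univ.pi fun _ : Finset (Fin N) => Set.univ.pi fun _ : Fin N =>
      Set.Icc (0 : ℝ) 1) :=
    isCompact_univ_pi fun _ => isCompact_univ_pi fun _ => isCompact_Icc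
  have hcont : ∀ S n, Continuous fun p : Finset (Fin N) → Fin N → ℝ => p S n := fun S n =>
    (continuous_apply n).comp (continuous_apply S)
  have hclosed : IsClosed {p | IsProperSplit lam p} := by
    have : {p | IsProperSplit lam p} = (⋂ S, ⋂ n, {p | 0 ≤ p S n}) ∩
        (⋂ S, ⋂ _ : 0 < lam S, {p | ∑ n, p S n = 1}) ∩
        ⋂ S, ⋂ n, ⋂ _ : ¬ (0 < lam S ∧ n ∈ S), {p | p S n = 0} := by
      ext p
      simp only [Set.mem_ofPred_eq, Set.mem_inter_iff, Set.mem_iInter]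
      exact ⟨fun h => ⟨⟨h.nonneg, h.sum_eq_one⟩, h.eq_zero⟩, fun h => ⟨h.1.1, h.1.2, h.2⟩⟩
    rw [this]
    refine ((isClosed_iInter fun S => isClosed_iInter fun n => ?_).inter
      (isClosed_iInter fun S => isClosed_iInter fun _ => ?_)).inter
      (isClosed_iInter fun S => isClosed_iInter fun n => isClosed_iInter fun _ => ?_)
    · exact isClosed_le continuous_const (hcont S n)
    · exact isClosed_eq (continuous_finsetSum _ fun n _ => hcont S n) continuous_const
    · exact isClosed_eq (hcont S n) continuous_const
  refine hK.of_isClosed_subset hclosed fun p hp S _ n _ => ⟨hp.nonneg S n, ?_⟩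
  by_cases h : 0 < lam S ∧ n ∈ S
  · rw [← hp.sum_eq_one S h.1]
    exact Finset.single_le_sum (f := p S) (fun i _ => hp.nonneg S i) (Finset.mem_univ n)
  · rw [hp.eq_zero S n h]
    exact zero_le_one

lemma exists_properSplit (hempty : lam ∅ = 0) : ∃ p, IsProperSplit lam p := by
  classical
  refine ⟨fun S n => if 0 < lam S ∧ n ∈ S then (S.card : ℝ)⁻¹ else 0, fun S n => ?_, fun S hS => ?_,
    fun S n h => if_neg h⟩
  · split_ifs <;> positivity
  · have hne : S.Nonempty := by
      rw [Finset.nonempty_iff_ne_empty]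
      rintro rfl
      exact hS.ne' hempty
    simp only [hS, true_and]
    rw [Finset.sum_ite_mem, Finset.univ_inter, Finset.sum_const, nsmul_eq_mul,
      mul_inv_cancel₀ (Nat.cast_ne_zero.2 hne.card_pos.ne')]

lemma IsSplit.exists_properSplit {p : Finset (Fin N) → Fin N → ℝ} (hp : IsSplit lam p) :
    ∃ p', IsProperSplit lam p' ∧ ∀ n, splitRate lam p' n = splitRate lam p n := by
  classical
  refine ⟨fun S n => if 0 < lam S ∧ n ∈ S then p S n else 0, ⟨fun S n => ?_, fun S hS => ?_,
    fun S n h => if_neg h⟩, fun n => ?_⟩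
  · split_ifs with h
    exacts [(hp S h.1).1 n h.2, le_rfl]
  · simp only [hS, true_and]
    rw [Finset.sum_ite_mem, Finset.univ_inter, (hp S hS).2]
  · refine Finset.sum_congr rfl fun S hS => ?_
    simp only
    rw [if_pos (Finset.mem_filter.1 hS).2]

/-- The minimum that defines `λ₀` is attained. -/
theorem exists_optimal_split (hN : 0 < N) (hempty : lam ∅ = 0) :
    IsLeast (maxRates lam) (minMaxRate lam) ∧
      ∃ p, IsProperSplit lam p ∧ ∀ n, splitRate lam p n ≤ minMaxRate lam := by
  have : Nonempty (Fin N) := ⟨⟨0, hN⟩⟩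
  have hcont : Continuous fun p : Finset (Fin N) → Fin N → ℝ => ⨆ n, splitRate lam p n := by
    simp_rw [← Finset.sup'_univ_eq_ciSup]
    refine Continuous.finset_sup'_apply _ fun n _ => ?_
    unfold splitRate
    exact continuous_finsetSum _ fun S _ =>
      continuous_const.mul ((continuous_apply n).comp (continuous_apply S))
  obtain ⟨p, hp, hmin⟩ := (isCompact_properSplits (lam := lam)).exists_isMinOn
    (exists_properSplit hempty) hcont.continuousOn
  have hleast : IsLeast (maxRates lam) (⨆ n, splitRate lam p n) := by
    refine ⟨⟨p, IsProperSplit.isSplit hp, rfl⟩, ?_⟩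
    rintro _ ⟨p', hp', rfl⟩
    obtain ⟨p'', hp'', heq⟩ := hp'.exists_properSplit
    simp_rw [← heq]
    exact hmin hp''
  have heq : minMaxRate lam = ⨆ n, splitRate lam p n := hleast.csInf_eq
  rw [heq]
  exact ⟨hleast, p, hp, fun n => le_ciSup (Set.finite_range _).bddAbove n⟩

end MinMax

/-! ### Event representations of both systems and of the coupling -/

section Events
variable {N : ℕ} (μ₁ μ₂ r : ℝ) (lam : Finset (Fin N) → ℝ)
  (alloc : AffState N → Finset (Fin N) → Fin N → ℝ) (p : Finset (Fin N) → Fin N → ℝ)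

/-- The rates of arrivals of each selection at each server, and of departures. -/
def affRate (x : AffState N) : (Finset (Fin N) × Fin N) ⊕ Fin N → ℝ
  | .inl (S, n) => lam S * alloc x S n
  | .inr n => if 0 < (x n).1 then μ₁ else if 0 < (x n).2 then μ₂ else 0

/-- The state after a departure from server `n`. -/
def affDepart (x : AffState N) (n : Fin N) : AffState N :=
  if 0 < (x n).1 then Function.update x n ((x n).1 - 1, (x n).2)
  else Function.update x n ((x n).1, (x n).2 - 1)

/-- The effect of the events of the affinity-scheduling system. -/
def affStep (x : AffState N) : (Finset (Fin N) × Fin N) ⊕ Fin N → AffState N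
  | .inl (S, n) => joinServer x S n
  | .inr n => affDepart x n

/-- The rates of arrivals and departures at each server of the reference system. -/
def raRate (_y : RefState N) : Fin N ⊕ Fin N → ℝ
  | .inl _ => r
  | .inr _ => μ₁

/-- The effect of the events of the reference system; a departure from an empty server has none. -/
def raStep (y : RefState N) : Fin N ⊕ Fin N → RefState N
  | .inl n => Function.update y n (y n + 1)
  | .inr n => Function.update y n (y n - 1)

/-- The rates of the coupled system: joint arrivals, arrivals in the reference system only,
joint (potential) departures, and departures of type II jobs. -/
def coupledRate (z : AffState N × RefState N) :
    (Finset (Fin N) × Fin N × Fin N) ⊕ Fin N ⊕ Fin N ⊕ Fin N → ℝ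
  | .inl (S, n, k) => lam S * alloc z.1 S n * p S k
  | .inr (.inl k) => r - splitRate lam p k
  | .inr (.inr (.inl _)) => μ₁
  | .inr (.inr (.inr n)) => if (z.1 n).1 = 0 ∧ 0 < (z.1 n).2 then μ₂ else 0

/-- The effect of the events of the coupled system, in which servers of equal rank are matched. -/
def coupledStep (z : AffState N × RefState N) :
    (Finset (Fin N) × Fin N × Fin N) ⊕ Fin N ⊕ Fin N ⊕ Fin N → AffState N × RefState N
  | .inl (S, n, k) => (joinServer z.1 S n, raStep z.2 (.inl (rankMatch (typeI z.1) z.2 k)))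
  | .inr (.inl k) => (z.1, raStep z.2 (.inl (rankMatch (typeI z.1) z.2 k)))
  | .inr (.inr (.inl n)) => (Function.update z.1 n ((z.1 n).1 - 1, (z.1 n).2),
      raStep z.2 (.inr (rankMatch (typeI z.1) z.2 n)))
  | .inr (.inr (.inr n)) => (Function.update z.1 n ((z.1 n).1, (z.1 n).2 - 1), z.2)

lemma affGenerator_eq :
    affGenerator μ₁ μ₂ lam alloc = eventGenerator (affRate μ₁ μ₂ lam alloc) affStep := by
  funext f x
  simp only [affGenerator, eventGenerator, Fintype.sum_sum_type, Fintype.sum_prod_type, affRate,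
    affStep, Finset.mul_sum, mul_assoc]
  congr 1
  refine Finset.sum_congr rfl fun n _ => ?_
  unfold affDepart
  split_ifs <;> simp

lemma raGenerator_eq (hN : 0 < N) : raGenerator (N := N) μ₁ r = eventGenerator (raRate μ₁ r) raStep := by
  funext f y
  have hN' : (N : ℝ) ≠ 0 := Nat.cast_ne_zero.2 hN.ne'
  simp only [raGenerator, eventGenerator, Fintype.sum_sum_type, raRate, raStep, Finset.mul_sum]
  congr 1
  · refine Finset.sum_congr rfl fun n _ => ?_
    field_simp
  · refine Finset.sum_congr rfl fun n _ => ?_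
    split_ifs with h
    · rfl
    · have : y n - 1 = y n := by omega
      rw [this, Function.update_eq_self, sub_self, mul_zero]

variable {μ₁ μ₂ r lam alloc p}

lemma affRate_nonneg (hμ₁ : 0 < μ₁) (hμ₂ : 0 < μ₂) (hlam : ∀ S, 0 ≤ lam S) (hempty : lam ∅ = 0)
    (halloc : IsAllocationRule alloc) (x : AffState N) (a) : 0 ≤ affRate μ₁ μ₂ lam alloc x a := by
  rcases a with ⟨S, n⟩ | n
  · rcases S.eq_empty_or_nonempty with rfl | hS
    · simp [affRate, hempty]
    · exact mul_nonneg (hlam S) (halloc.nonneg x S n hS)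
  · simp only [affRate]
    split_ifs <;> linarith

lemma lam_mul_sum_alloc (hempty : lam ∅ = 0) (halloc : IsAllocationRule alloc) (x : AffState N)
    (S : Finset (Fin N)) : lam S * ∑ n, alloc x S n = lam S := by
  rcases S.eq_empty_or_nonempty with rfl | hS
  · simp [hempty]
  · rw [halloc.sum_eq_one x S hS, mul_one]

lemma lam_mul_sum_split (hlam : ∀ S, 0 ≤ lam S) (hp : IsProperSplit lam p)
    (S : Finset (Fin N)) : lam S * ∑ n, p S n = lam S := by
  rcases (hlam S).eq_or_lt with h | h
  · simp [← h]
  · rw [hp.sum_eq_one S h, mul_one]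

lemma sum_affRate_le (hμ₂ : 0 < μ₂) (hμ : μ₂ < μ₁) (hempty : lam ∅ = 0)
    (halloc : IsAllocationRule alloc) (x : AffState N) :
    ∑ a, affRate μ₁ μ₂ lam alloc x a ≤ ∑ S, lam S + N * μ₁ := by
  simp only [Fintype.sum_sum_type, Fintype.sum_prod_type, affRate, ← Finset.mul_sum,
    lam_mul_sum_alloc hempty halloc]
  refine add_le_add_right ?_ _
  calc _ ≤ ∑ _n : Fin N, μ₁ := Finset.sum_le_sum fun n _ => by split_ifs <;> linarith
    _ = N * μ₁ := by simp

lemma coupledRate_nonneg (hμ₁ : 0 < μ₁) (hμ₂ : 0 < μ₂) (hlam : ∀ S, 0 ≤ lam S) (hempty : lam ∅ = 0)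
    (halloc : IsAllocationRule alloc) (hp : IsProperSplit lam p)
    (hr : ∀ n, splitRate lam p n ≤ r) (z : AffState N × RefState N) (a) :
    0 ≤ coupledRate μ₁ μ₂ r lam alloc p z a := by
  rcases a with ⟨S, n, k⟩ | k | n | n
  · rcases S.eq_empty_or_nonempty with rfl | hS
    · simp [coupledRate, hempty]
    · exact mul_nonneg (mul_nonneg (hlam S) (halloc.nonneg z.1 S n hS)) (hp.nonneg S k)
  · exact sub_nonneg.2 (hr k)
  · exact hμ₁.le
  · simp only [coupledRate]
    split_ifs <;> linarith

lemma splitRate_nonneg (hlam : ∀ S, 0 ≤ lam S) (hp : IsProperSplit lam p) (n : Fin N) :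
    0 ≤ splitRate lam p n :=
  Finset.sum_nonneg fun S _ => mul_nonneg (hlam S) (hp.nonneg S n)

lemma sum_coupledRate_le (hμ₂ : 0 < μ₂) (hlam : ∀ S, 0 ≤ lam S) (hempty : lam ∅ = 0)
    (halloc : IsAllocationRule alloc) (hp : IsProperSplit lam p) (z : AffState N × RefState N) :
    ∑ a, coupledRate μ₁ μ₂ r lam alloc p z a ≤ ∑ S, lam S + (N * r + (N * μ₁ + N * μ₂)) := by
  simp only [Fintype.sum_sum_type, Fintype.sum_prod_type, coupledRate, ← Finset.mul_sum,
    ← Finset.sum_mul]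
  have h1 : ∀ S, lam S * (∑ n, alloc z.1 S n) * ∑ k, p S k = lam S := fun S => by
    rw [lam_mul_sum_alloc hempty halloc, lam_mul_sum_split hlam hp]
  simp only [h1]
  refine add_le_add_right (add_le_add ?_ (add_le_add (by simp) ?_)) _
  · calc _ ≤ ∑ _n : Fin N, r := Finset.sum_le_sum fun n _ => by
          linarith [splitRate_nonneg hlam hp n]
      _ = N * r := by simp
  · calc _ ≤ ∑ _n : Fin N, μ₂ := Finset.sum_le_sum fun n _ => by split_ifs <;> linarith
      _ = N * μ₂ := by simp

/-- The auxiliary server `k` is summed out because `p S` has total mass one, and events of the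
reference system alone contribute nothing. -/
lemma coupled_fst (hlam : ∀ S, 0 ≤ lam S) (hp : IsProperSplit lam p) (f : AffState N → ℝ)
    (z : AffState N × RefState N) :
    eventGenerator (coupledRate μ₁ μ₂ r lam alloc p) coupledStep (f ∘ Prod.fst) z =
      affGenerator μ₁ μ₂ lam alloc f z.1 := by
  simp only [eventGenerator, affGenerator, Fintype.sum_sum_type, Fintype.sum_prod_type,
    coupledRate, coupledStep, Function.comp_apply, sub_self, mul_zero, Finset.sum_const_zero,
    zero_add, ← Finset.sum_add_distrib]
  congr 1
  · refine Finset.sum_congr rfl fun S _ => ?_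
    simp only [Finset.mul_sum]
    refine Finset.sum_congr rfl fun n _ => ?_
    rw [← Finset.sum_mul, ← Finset.mul_sum]
    conv_rhs => rw [← lam_mul_sum_split hlam hp S]
    ring
  · refine Finset.sum_congr rfl fun n _ => ?_
    rcases Nat.eq_zero_or_pos (z.1 n).1 with h | h
    -- By truncated subtraction, a potential departure from a server without type I jobs does
    -- nothing; the separate type II event then accounts for the service at rate `μ₂`.
    · have : ((z.1 n).1 - 1, (z.1 n).2) = z.1 n := by ext <;> simp [h]
      rw [this, Function.update_eq_self, sub_self, mul_zero, zero_add]
      simp only [h, true_and, lt_irrefl, if_false]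
      split_ifs <;> simp
    · simp [h, h.ne']

/-- Summing out the selection and the allocation leaves rate `splitRate lam p k + (r - splitRate lam
p k) = r` at the partner of `k`; as `k` varies, the partners run through all servers, since the
matching is a permutation. -/
lemma coupled_snd (hN : 0 < N) (hempty : lam ∅ = 0) (halloc : IsAllocationRule alloc)
    (hp : IsProperSplit lam p) (f : RefState N → ℝ) (z : AffState N × RefState N) :
    eventGenerator (coupledRate μ₁ μ₂ r lam alloc p) coupledStep (f ∘ Prod.snd) z =
      raGenerator μ₁ r f z.2 := by
  rw [raGenerator_eq _ _ hN]
  simp only [eventGenerator, Fintype.sum_sum_type, Fintype.sum_prod_type,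
    coupledRate, coupledStep, Function.comp_apply, sub_self, mul_zero, Finset.sum_const_zero,
    add_zero, raRate]
  rw [← add_assoc]
  congr 1
  · rw [← Equiv.sum_comp (rankMatch (typeI z.1) z.2) fun k =>
      r * (f (raStep z.2 (Sum.inl k)) - f z.2)]
    have h1 : ∀ S, ∑ n, ∑ k, lam S * alloc z.1 S n * p S k *
        (f (raStep z.2 (Sum.inl (rankMatch (typeI z.1) z.2 k))) - f z.2) =
        ∑ k, lam S * p S k *
        (f (raStep z.2 (Sum.inl (rankMatch (typeI z.1) z.2 k))) - f z.2) := by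
      intro S
      rw [Finset.sum_comm]
      refine Finset.sum_congr rfl fun k _ => ?_
      rw [← Finset.sum_mul, ← Finset.sum_mul, ← Finset.mul_sum,
        lam_mul_sum_alloc hempty halloc]
    simp only [h1]
    rw [Finset.sum_comm, ← Finset.sum_add_distrib]
    refine Finset.sum_congr rfl fun k _ => ?_
    rw [← Finset.sum_mul, ← add_mul, hp.splitRate_eq, add_sub_cancel]
  · exact Equiv.sum_comp (rankMatch (typeI z.1) z.2) fun k =>
      μ₁ * (f (raStep z.2 (Sum.inr k)) - f z.2)

lemma typeI_joinServer_of_mem {x : AffState N} {S : Finset (Fin N)} {n : Fin N} (h : n ∈ S) :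
    typeI (joinServer x S n) = Function.update (typeI x) n (typeI x n + 1) := by
  funext i
  by_cases hi : i = n
  · subst hi; simp [typeI, joinServer, h]
  · simp [typeI, joinServer, hi]

lemma typeI_joinServer_of_notMem {x : AffState N} {S : Finset (Fin N)} {n : Fin N} (h : n ∉ S) :
    typeI (joinServer x S n) = typeI x := by
  funext i
  by_cases hi : i = n
  · subst hi; simp [typeI, joinServer, h]
  · simp [typeI, joinServer, hi]

lemma typeI_update (x : AffState N) (n : Fin N) (v : ℕ × ℕ) :
    typeI (Function.update x n v) = Function.update (typeI x) n v.1 := by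
  funext i
  by_cases hi : i = n
  · subst hi; simp [typeI]
  · simp [typeI, hi]

lemma Eligible.typeI_le {x : AffState N} {S : Finset (Fin N)} {n k : Fin N} (h : Eligible x S n)
    (hn : n ∈ S) (hk : k ∈ S) : typeI x n ≤ typeI x k := by
  rcases h with ⟨-, -, h⟩ | ⟨-, -, h, -⟩ | ⟨-, -, h⟩
  · simp [typeI, h]
  · exact absurd hn h
  · rcases h k hk with h | h
    · exact h.le
    · exact h.1.le

/-- A positive rate forces `k ∈ S` through the split and eligibility of `n` through the allocation
rule, which together give the comparison of type I counts needed for joint arrivals. -/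
lemma coupledStep_mem (halloc : IsAllocationRule alloc)
    (hp : IsProperSplit lam p) {z : AffState N × RefState N}
    (hz : tailSums (typeI z.1) ≤ tailSums z.2) (a)
    (ha : coupledRate μ₁ μ₂ r lam alloc p z a ≠ 0) :
    tailSums (typeI (coupledStep z a).1) ≤ tailSums (coupledStep z a).2 := by
  rcases a with ⟨S, n, k⟩ | k | n | n
  · simp only [coupledRate, mul_ne_zero_iff] at ha
    have hk : 0 < lam S ∧ k ∈ S := by
      by_contra h
      exact ha.2 (hp.eq_zero S k h)
    have hS : S.Nonempty := ⟨k, hk.2⟩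
    have hel := halloc.eligible z.1 S n hS ha.1.2
    simp only [coupledStep, raStep]
    by_cases hn : n ∈ S
    · rw [typeI_joinServer_of_mem hn]
      exact tailSums_le_inc hz (hel.typeI_le hn hk.2)
    · rw [typeI_joinServer_of_notMem hn]
      exact tailSums_le_inc_right hz _
  · exact tailSums_le_inc_right hz _
  · simp only [coupledStep, raStep, typeI_update]
    exact tailSums_le_dec hz n
  · simp only [coupledStep, typeI_update]
    have : Function.update (typeI z.1) n (z.1 n).1 = typeI z.1 := Function.update_eq_self n (typeI z.1)
    rwa [this]

end Events

/-! ### Lifting couplings through maps -/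

section Gluing
variable {α E F : Type*} [MeasurableSpace α] [MeasurableSpace E] [MeasurableSpace F]

lemma ae_condDistrib_id_eq [MeasurableEq α] [StandardBorelSpace E] [Nonempty E] {ν : Measure E}
    [IsProbabilityMeasure ν] {a : E → α} (ha : Measurable a) :
    ∀ᵐ s ∂(ν.map a), ∀ᵐ x ∂(condDistrib id a ν s), a x = s := by
  refine Measure.ae_ae_of_ae_compProd (p := fun q : α × E => a q.2 = q.1) ?_
  rw [compProd_map_condDistrib aemeasurable_id, ae_map_iff (by fun_prop)]
  · exact ae_of_all _ fun _ => rfl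
  · exact measurableSet_eq_fun (by fun_prop) (by fun_prop)

/-- A coupling of the images of two laws lifts to a coupling of the laws themselves. -/
lemma exists_coupling_of_map [MeasurableEq α] [StandardBorelSpace E] [Nonempty E]
    [StandardBorelSpace F] [Nonempty F] {ν₁ : Measure E} {ν₂ : Measure F} [IsProbabilityMeasure ν₁]
    [IsProbabilityMeasure ν₂] {a : E → α} {b : F → α} (ha : Measurable a) (hb : Measurable b)
    {ρ : Measure (α × α)} (h1 : ρ.map Prod.fst = ν₁.map a) (h2 : ρ.map Prod.snd = ν₂.map b)
    {r : α → α → Prop} (hr : ∀ᵐ z ∂ρ, r z.1 z.2)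
    (hm : MeasurableSet {z : E × F | r (a z.1) (b z.2)}) :
    ∃ ν : Measure (E × F), IsProbabilityMeasure ν ∧ ν.map Prod.fst = ν₁ ∧ ν.map Prod.snd = ν₂ ∧
      ∀ᵐ z ∂ν, r (a z.1) (b z.2) := by
  -- Draw the pair of images from `ρ` and then, independently given this pair, the two originals
  -- from their conditional laws. These laws sit on the fibres, so the relation is inherited.
  set κ₁ : Kernel (α × α) E := (condDistrib id a ν₁).comap Prod.fst measurable_fst with hκ₁
  set κ₂ : Kernel (α × α) F := (condDistrib id b ν₂).comap Prod.snd measurable_snd with hκ₂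
  have hm1 : (κ₁ ∘ₘ ρ) = ν₁ := by
    have : κ₁ ∘ₘ ρ = condDistrib id a ν₁ ∘ₘ ρ.map Prod.fst := by
      rw [← Measure.deterministic_comp_eq_map measurable_fst, Measure.comp_assoc,
        Kernel.comp_deterministic_eq_comap]
    rw [this, h1, condDistrib_comp_map ha.aemeasurable aemeasurable_id, Measure.map_id]
  have hm2 : (κ₂ ∘ₘ ρ) = ν₂ := by
    have : κ₂ ∘ₘ ρ = condDistrib id b ν₂ ∘ₘ ρ.map Prod.snd := by
      rw [← Measure.deterministic_comp_eq_map measurable_snd, Measure.comp_assoc,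
        Kernel.comp_deterministic_eq_comap]
    rw [this, h2, condDistrib_comp_map hb.aemeasurable aemeasurable_id, Measure.map_id]
  have hf : ((κ₁ ×ₖ κ₂) ∘ₘ ρ).map Prod.fst = ν₁ := by
    rw [Measure.map_comp _ _ measurable_fst, ← Kernel.fst_eq, Kernel.fst_prod, hm1]
  have hs : ((κ₁ ×ₖ κ₂) ∘ₘ ρ).map Prod.snd = ν₂ := by
    rw [Measure.map_comp _ _ measurable_snd, ← Kernel.snd_eq, Kernel.snd_prod, hm2]
  refine ⟨(κ₁ ×ₖ κ₂) ∘ₘ ρ, ?_, hf, hs, ?_⟩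
  · have : IsProbabilityMeasure (((κ₁ ×ₖ κ₂) ∘ₘ ρ).map Prod.fst) := by rw [hf]; infer_instance
    exact Measure.isProbabilityMeasure_of_map Prod.fst
  · refine Measure.ae_comp_of_ae_ae hm ?_
    have e1 : ∀ᵐ z ∂ρ, ∀ᵐ x ∂(condDistrib id a ν₁ z.1), a x = z.1 :=
      ae_of_ae_map measurable_fst.aemeasurable (h1 ▸ ae_condDistrib_id_eq ha)
    have e2 : ∀ᵐ z ∂ρ, ∀ᵐ x ∂(condDistrib id b ν₂ z.2), b x = z.2 :=
      ae_of_ae_map measurable_snd.aemeasurable (h2 ▸ ae_condDistrib_id_eq hb)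
    filter_upwards [hr, e1, e2] with z hz hz1 hz2
    rw [Kernel.prod_apply]
    have q1 : ∀ᵐ w ∂((κ₁ z).prod (κ₂ z)), a w.1 = z.1 := Measure.quasiMeasurePreserving_fst.ae hz1
    have q2 : ∀ᵐ w ∂((κ₁ z).prod (κ₂ z)), b w.2 = z.2 := Measure.quasiMeasurePreserving_snd.ae hz2
    filter_upwards [q1, q2] with w hw1 hw2
    rwa [hw1, hw2]

end Gluing

/-! ### Dominance of the processes -/

section Processes

/-- A chain given by finitely many kinds of events of bounded total rate exists, for every initial
law. -/
theorem exists_isMarkovJumpProcess {E A : Type} [Fintype A] [Nonempty E] [Countable E]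
    [MeasurableSpace E] [MeasurableSingletonClass E] [TopologicalSpace E] [DiscreteTopology E]
    {γ : ℝ} {rate : E → A → ℝ} {step : E → A → E} (hγ : 0 < γ) (hrate : ∀ x a, 0 ≤ rate x a)
    (hle : ∀ x, ∑ a, rate x a ≤ γ) (ν : Measure E) [IsProbabilityMeasure ν] :
    ∃ (Ω : Type) (_ : MeasurableSpace Ω) (P : Measure Ω) (X : ℝ≥0 → Ω → E),
      IsProbabilityMeasure P ∧ P.map (X 0) = ν ∧
        IsMarkovJumpProcess (eventGenerator rate step) P X := by
  have := isProbabilityMeasure_eventKernel (step := step) hγ hrate hle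
  obtain ⟨Ω, _, P, X, hP, h0, hX, hcad, hmarkov, -⟩ :=
    exists_jumpProcess (κ := eventKernel γ rate step) ν hγ
  exact ⟨Ω, _, P, X, hP, h0, IsMarkovJumpProcess.comp id hX hcad
    (g := fun h B x => (jumpProb γ (eventKernel γ rate step) h B x).toReal) hmarkov fun h y x =>
    jumpProb_eq_transProb hγ hrate hle (isMarkovOp_uniformized hγ hrate hle)
      (eventGenerator_eq hγ rate step) id (fun _ _ => rfl) h y x⟩

lemma IsMarkovJumpProcess.map_comp_eq {E α Ω₁ Ω₂ : Type*} [MeasurableSpace E] [TopologicalSpace E]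
    [Countable E] [MeasurableSingletonClass E] [MeasurableSpace α]
    [MeasurableSpace Ω₁] [MeasurableSpace Ω₂] {L : Generator E} {P₁ : Measure Ω₁}
    {P₂ : Measure Ω₂} [IsProbabilityMeasure P₁] [IsProbabilityMeasure P₂] {X : ℝ≥0 → Ω₁ → E}
    {Y : ℝ≥0 → Ω₂ → E} (hX : IsMarkovJumpProcess L P₁ X) (hY : IsMarkovJumpProcess L P₂ Y)
    (h0 : P₁.map (X 0) = P₂.map (Y 0)) (f : E → α) :
    P₁.map (fun ω t => f (X t ω)) = P₂.map (fun ω t => f (Y t ω)) := by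
  have hf : Measurable fun (w : ℝ≥0 → E) t => f (w t) :=
    measurable_pi_lambda _ fun t => (Measurable.of_discrete (f := f)).comp (measurable_pi_apply t)
  have h := congrArg (Measure.map fun (w : ℝ≥0 → E) t => f (w t)) (hX.map_eq hY h0)
  rwa [Measure.map_map hf (measurable_pi_lambda _ hX.measurable),
    Measure.map_map hf (measurable_pi_lambda _ hY.measurable)] at h

variable {N : ℕ} {μ₁ μ₂ r : ℝ} {lam : Finset (Fin N) → ℝ}
  {alloc : AffState N → Finset (Fin N) → Fin N → ℝ} {p : Finset (Fin N) → Fin N → ℝ}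

lemma sum_raRate (y : RefState N) : ∑ a, raRate μ₁ r y a = N * r + N * μ₁ := by
  simp [raRate]

/-- Dominance of the tail sums at time zero propagates, through the coupled system. -/
theorem processStochLE_of_stochLE (hN : 0 < N) (hμ₂ : 0 < μ₂) (hμ : μ₂ < μ₁)
    (hlam : ∀ S, 0 ≤ lam S) (hempty : lam ∅ = 0) (halloc : IsAllocationRule alloc)
    (hp : IsProperSplit lam p) (hr : ∀ n, splitRate lam p n ≤ r)
    {Ω₁ Ω₂ : Type*} [MeasurableSpace Ω₁] [MeasurableSpace Ω₂]
    {P₁ : Measure Ω₁} {P₂ : Measure Ω₂} [IsProbabilityMeasure P₁] [IsProbabilityMeasure P₂]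
    {X : ℝ≥0 → Ω₁ → AffState N} {Y : ℝ≥0 → Ω₂ → RefState N}
    (hX : IsMarkovJumpProcess (affGenerator μ₁ μ₂ lam alloc) P₁ X)
    (hY : IsMarkovJumpProcess (raGenerator μ₁ r) P₂ Y)
    (h : StochLE (P₁.map fun ω => tailSums (typeI (X 0 ω))) (P₂.map fun ω => tailSums (Y 0 ω))) :
    ProcessStochLE P₁ (fun t ω => tailSums (typeI (X t ω))) P₂ (fun t ω => tailSums (Y t ω)) := by
  have hμ₁ : 0 < μ₁ := hμ₂.trans hμ
  have hr0 : 0 ≤ r := (splitRate_nonneg hlam hp ⟨0, hN⟩).trans (hr _)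
  have hlam0 : 0 ≤ ∑ S, lam S := Finset.sum_nonneg fun S _ => hlam S
  -- One rate that dominates the coupled chain and both marginal chains, so that all three are
  -- uniformized by the same clock.
  set γ : ℝ := ∑ S, lam S + (N * r + (N * μ₁ + N * μ₂)) + 1 with hγdef
  have hNr : 0 ≤ N * r := by positivity
  have hN1 : 0 ≤ N * μ₁ := by positivity
  have hN2 : 0 ≤ N * μ₂ := by positivity
  have hγ : 0 < γ := by positivity
  have ha0 := affRate_nonneg hμ₁ hμ₂ hlam hempty halloc
  have hale : ∀ x, ∑ a, affRate μ₁ μ₂ lam alloc x a ≤ γ := fun x => by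
    linarith [sum_affRate_le hμ₂ hμ hempty halloc x]
  have hra0 : ∀ (y : RefState N) a, 0 ≤ raRate μ₁ r y a := by
    rintro y (n | n)
    exacts [hr0, hμ₁.le]
  have hrale : ∀ y : RefState N, ∑ a, raRate μ₁ r y a ≤ γ := fun y => by
    rw [sum_raRate]; linarith
  have hc0 := coupledRate_nonneg hμ₁ hμ₂ hlam hempty halloc hp hr
  have hcle : ∀ z, ∑ a, coupledRate μ₁ μ₂ r lam alloc p z a ≤ γ := fun z => by
    linarith [sum_coupledRate_le (μ₁ := μ₁) (r := r) hμ₂ hlam hempty halloc hp z]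
  obtain ⟨ρ, hρ1, hρ2, hρ⟩ := h
  have hX0 := hX.measurable 0
  have hY0 := hY.measurable 0
  have := Measure.isProbabilityMeasure_map (μ := P₁) hX0.aemeasurable
  have := Measure.isProbabilityMeasure_map (μ := P₂) hY0.aemeasurable
  have ht1 : Measurable fun x : AffState N => tailSums (typeI x) := .of_discrete
  have ht2 : Measurable fun y : RefState N => tailSums y := .of_discrete
  -- The hypothesis couples only the tail sums at time zero; the coupled chain needs ordered initial
  -- configurations.
  obtain ⟨ν, hν, hν1, hν2, hνr⟩ := exists_coupling_of_map (ν₁ := P₁.map (X 0)) (ν₂ := P₂.map (Y 0))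
    ht1 ht2 (hρ1.trans (Measure.map_map ht1 hX0).symm) (hρ2.trans (Measure.map_map ht2 hY0).symm)
    (r := (· ≤ ·)) hρ .of_discrete
  have := isProbabilityMeasure_eventKernel (step := coupledStep) hγ hc0 hcle
  obtain ⟨Ω, mΩ, P, Z, hP, hZ0, hZ, hcad, hmarkov, hinv⟩ := exists_jumpProcess
    (κ := eventKernel γ (coupledRate μ₁ μ₂ r lam alloc p) coupledStep) ν hγ
  let g : ℝ≥0 → Set (AffState N × RefState N) → AffState N × RefState N → ℝ := fun h B x =>
    (jumpProb γ (eventKernel γ (coupledRate μ₁ μ₂ r lam alloc p) coupledStep) h B x).toReal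
  have hA : IsMarkovJumpProcess (affGenerator μ₁ μ₂ lam alloc) P fun t ω => (Z t ω).1 :=
    IsMarkovJumpProcess.comp Prod.fst hZ hcad (g := g) hmarkov fun h y x =>
      jumpProb_eq_transProb hγ hc0 hcle (isMarkovOp_uniformized hγ ha0 hale)
        (fun f => by rw [affGenerator_eq]; exact eventGenerator_eq hγ _ _ f) Prod.fst
        (fun f z => coupled_fst hlam hp f z) h y x
  have hB : IsMarkovJumpProcess (raGenerator μ₁ r) P fun t ω => (Z t ω).2 :=
    IsMarkovJumpProcess.comp Prod.snd hZ hcad (g := g) hmarkov fun h y x =>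
      jumpProb_eq_transProb hγ hc0 hcle (isMarkovOp_uniformized hγ hra0 hrale)
        (fun f => by rw [raGenerator_eq _ _ hN]; exact eventGenerator_eq hγ _ _ f) Prod.snd
        (fun f z => coupled_snd hN hempty halloc hp f z) h y x
  have hA0 : P.map (fun ω => (Z 0 ω).1) = P₁.map (X 0) := by
    rw [← hν1, ← hZ0, Measure.map_map measurable_fst (hZ 0)]; rfl
  have hB0 : P.map (fun ω => (Z 0 ω).2) = P₂.map (Y 0) := by
    rw [← hν2, ← hZ0, Measure.map_map measurable_snd (hZ 0)]; rfl
  -- The order holds initially and survives every event of positive rate, hence almost surely at all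
  -- times simultaneously.
  have hord := hinv {z | tailSums (typeI z.1) ≤ tailSums z.2}
    (fun z hz => eventKernel_compl_eq_zero hz fun a ha => coupledStep_mem halloc hp hz a ha) hνr
  refine ⟨Ω, mΩ, P, fun t ω => tailSums (typeI (Z t ω).1), fun t ω => tailSums (Z t ω).2, hP,
    fun t => ht1.comp (hA.measurable t), fun t => ht2.comp (hB.measurable t),
    hA.map_comp_eq hX hA0 fun x => tailSums (typeI x), hB.map_comp_eq hY hB0 tailSums, ?_⟩
  have hct1 : Continuous fun x : AffState N => tailSums (typeI x) := continuous_of_discreteTopology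
  have hct2 : Continuous fun y : RefState N => tailSums y := continuous_of_discreteTopology
  filter_upwards [hA.cadlag, hB.cadlag, hord] with ω h1 h2 h3 t
  obtain ⟨c1, l1, hl1⟩ := h1 t
  obtain ⟨c2, l2, hl2⟩ := h2 t
  exact ⟨(hct1.tendsto _).comp c1, ⟨_, (hct1.tendsto l1).comp hl1⟩, (hct2.tendsto _).comp c2,
    ⟨_, (hct2.tendsto l2).comp hl2⟩, h3 t⟩

end Processes

/-! ### Drift estimates for the affinity-scheduling system -/

section Lyapunov
variable {N : ℕ} {μ₁ μ₂ r : ℝ} {lam : Finset (Fin N) → ℝ}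
  {alloc : AffState N → Finset (Fin N) → Fin N → ℝ} {p : Finset (Fin N) → Fin N → ℝ}

lemma sum_comp_update_add {ι α M : Type*} [Fintype ι] [DecidableEq ι] [AddCommMonoid M]
    (f : α → M) (x : ι → α) (k : ι) (v : α) :
    ∑ n, f (Function.update x k v n) + f (x k) = ∑ n, f (x n) + f v := by
  rw [← Finset.add_sum_erase _ _ (Finset.mem_univ k),
    ← Finset.add_sum_erase Finset.univ (fun n => f (x n)) (Finset.mem_univ k),
    Function.update_self,
    Finset.sum_congr rfl fun n hn => by rw [Function.update_of_ne (Finset.ne_of_mem_erase hn)]]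
  abel

/-- The contribution of server `n` to the generator of the affinity-scheduling system. -/
def departTerm (μ₁ μ₂ : ℝ) (f : AffState N → ℝ) (x : AffState N) (n : Fin N) : ℝ :=
  if 0 < (x n).1 then μ₁ * (f (Function.update x n ((x n).1 - 1, (x n).2)) - f x)
  else if 0 < (x n).2 then μ₂ * (f (Function.update x n ((x n).1, (x n).2 - 1)) - f x)
  else 0

/-- Increments need to be bounded only where the rate can be positive, that is at eligible servers.
-/
lemma affGenerator_le (hlam : ∀ S, 0 ≤ lam S) (hempty : lam ∅ = 0) (halloc : IsAllocationRule alloc)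
    {f : AffState N → ℝ} {x : AffState N} {a : Finset (Fin N) → Fin N → ℝ} {d : Fin N → ℝ}
    (ha : ∀ S n, 0 < lam S → Eligible x S n → f (joinServer x S n) - f x ≤ a S n)
    (hd : ∀ n, departTerm μ₁ μ₂ f x n ≤ d n) :
    affGenerator μ₁ μ₂ lam alloc f x ≤ ∑ S, lam S * ∑ n, alloc x S n * a S n + ∑ n, d n := by
  refine add_le_add (Finset.sum_le_sum fun S _ => ?_) (Finset.sum_le_sum fun n _ => hd n)
  rcases (hlam S).eq_or_lt with h | h
  · simp [← h]
  refine mul_le_mul_of_nonneg_left (Finset.sum_le_sum fun n _ => ?_) h.le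
  have hS : S.Nonempty := by
    rw [Finset.nonempty_iff_ne_empty]
    rintro rfl
    exact h.ne' hempty
  by_cases h0 : alloc x S n = 0
  · simp [h0]
  · exact mul_le_mul_of_nonneg_left (ha S n h (halloc.eligible x S n hS h0)) (halloc.nonneg x S n hS)

lemma affGenerator_add_mul (C η : ℝ) (f g : AffState N → ℝ) (x : AffState N) :
    affGenerator μ₁ μ₂ lam alloc (fun x => C + η * f x + g x) x =
      η * affGenerator μ₁ μ₂ lam alloc f x + affGenerator μ₁ μ₂ lam alloc g x := by
  simp only [affGenerator_eq, eventGenerator, Finset.mul_sum, ← Finset.sum_add_distrib]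
  exact Finset.sum_congr rfl fun a _ => by ring

/-- An exponential weight of the numbers of type I jobs. -/
def expWeight (z : ℝ) (x : AffState N) : ℝ := ∑ n, z ^ (x n).1

/-- The number of type I jobs. -/
def jobsI (x : AffState N) : ℕ := ∑ n, (x n).1

/-- The number of type II jobs, not counting one at every server. -/
def backlogII (x : AffState N) : ℕ := ∑ n, ((x n).2 - 1)

lemma expWeight_update (z : ℝ) (x : AffState N) (n : Fin N) (v : ℕ × ℕ) :
    expWeight z (Function.update x n v) = expWeight z x - z ^ (x n).1 + z ^ v.1 := by
  have := sum_comp_update_add (fun q : ℕ × ℕ => z ^ q.1) x n v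
  simp only [expWeight]
  linarith

lemma jobsI_update (x : AffState N) (n : Fin N) (v : ℕ × ℕ) :
    jobsI (Function.update x n v) + (x n).1 = jobsI x + v.1 :=
  sum_comp_update_add (fun q : ℕ × ℕ => q.1) x n v

lemma backlogII_update (x : AffState N) (n : Fin N) (v : ℕ × ℕ) :
    backlogII (Function.update x n v) + ((x n).2 - 1) = backlogII x + (v.2 - 1) :=
  sum_comp_update_add (fun q : ℕ × ℕ => q.2 - 1) x n v

lemma card_add_jobsI_le_expWeight {z : ℝ} (hz : 1 < z) (x : AffState N) :
    N + (z - 1) * jobsI x ≤ expWeight z x := by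
  have h : ∀ n ∈ Finset.univ, 1 + (z - 1) * ((x n).1 : ℝ) ≤ z ^ (x n).1 := fun n _ => by
    have := one_add_mul_le_pow (a := z - 1) (by linarith) (x n).1
    rw [add_sub_cancel] at this
    linarith
  have := Finset.sum_le_sum h
  rw [Finset.sum_add_distrib, ← Finset.mul_sum] at this
  simpa [expWeight, jobsI] using this

/-- A type I arrival goes to a shortest queue of `S`, so its increment is at most the `p S`-average
of the increments over `S`; averaging over selections replaces it by at most `r (z - 1) z ^ (x k).1`
per server. Departures contribute `-μ₁ (1 - 1 / z) z ^ (x n).1`; writing the same for servers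
without type I jobs costs the additive constant. -/
lemma affGenerator_expWeight_le (hμ₁ : 0 < μ₁) (hlam : ∀ S, 0 ≤ lam S) (hempty : lam ∅ = 0)
    (halloc : IsAllocationRule alloc) (hp : IsProperSplit lam p) (hr : ∀ n, splitRate lam p n ≤ r)
    {z : ℝ} (hz : 1 < z) (x : AffState N) :
    affGenerator μ₁ μ₂ lam alloc (expWeight z) x ≤
      -((z - 1) * (μ₁ / z - r)) * expWeight z x + N * (μ₁ * (1 - 1 / z)) := by
  have hz0 : 0 < z := by linarith
  have hpos : ∀ n, 0 < (z - 1) * z ^ (x n).1 := fun n => mul_pos (by linarith) (pow_pos hz0 _)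
  refine (affGenerator_le (a := fun S _ => ∑ k, p S k * ((z - 1) * z ^ (x k).1))
    (d := fun n => -(μ₁ * (1 - 1 / z)) * z ^ (x n).1 + μ₁ * (1 - 1 / z)) hlam hempty halloc ?_ ?_).trans ?_
  · intro S n hS hel
    by_cases hn : n ∈ S
    · rw [joinServer, if_pos hn, expWeight_update]
      calc _ = ∑ k, p S k * ((z - 1) * z ^ (x n).1) := by
            rw [← Finset.sum_mul, hp.sum_eq_one S hS]
            ring
        _ ≤ _ := Finset.sum_le_sum fun k _ => ?_
      by_cases hk : k ∈ S
      · have : (x n).1 ≤ (x k).1 := hel.typeI_le hn hk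
        exact mul_le_mul_of_nonneg_left (mul_le_mul_of_nonneg_left
          (pow_le_pow_right₀ hz.le this) (by linarith)) (hp.nonneg S k)
      · rw [hp.eq_zero S k fun h => hk h.2, zero_mul, zero_mul]
    · rw [joinServer, if_neg hn, expWeight_update]
      have : 0 ≤ ∑ k, p S k * ((z - 1) * z ^ (x k).1) :=
        Finset.sum_nonneg fun k _ => mul_nonneg (hp.nonneg S k) (hpos k).le
      linarith
  · intro n
    have h1z : 0 ≤ μ₁ * (1 - 1 / z) := by
      have : 1 / z ≤ 1 := (div_le_one hz0).2 hz.le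
      exact mul_nonneg hμ₁.le (by linarith)
    unfold departTerm
    split_ifs with h1 h2
    · obtain ⟨m, hm⟩ := Nat.exists_eq_succ_of_ne_zero h1.ne'
      rw [expWeight_update]
      simp only [hm, Nat.succ_eq_add_one, Nat.add_sub_cancel]
      have : μ₁ * (expWeight z x - z ^ (m + 1) + z ^ m - expWeight z x) =
          -(μ₁ * (1 - 1 / z)) * z ^ (m + 1) := by
        rw [pow_succ]
        field_simp
        ring
      linarith
    · rw [expWeight_update]
      have : (x n).1 = 0 := by omega
      simp [this]
    · have : (x n).1 = 0 := by omega
      simp [this]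
  · have h1 : ∀ S, lam S * ∑ n, alloc x S n * ∑ k, p S k * ((z - 1) * z ^ (x k).1) =
        ∑ k, lam S * p S k * ((z - 1) * z ^ (x k).1) := fun S => by
      rw [← Finset.sum_mul, ← mul_assoc, lam_mul_sum_alloc hempty halloc, Finset.mul_sum]
      exact Finset.sum_congr rfl fun k _ => by ring
    simp only [h1]
    rw [Finset.sum_comm]
    simp only [← Finset.sum_mul, ← hp.splitRate_eq]
    have h2 : ∑ n, splitRate lam p n * ((z - 1) * z ^ (x n).1) ≤ ∑ n, r * ((z - 1) * z ^ (x n).1) :=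
      Finset.sum_le_sum fun n _ => mul_le_mul_of_nonneg_right (hr n) (hpos n).le
    rw [← Finset.mul_sum, ← Finset.mul_sum] at h2
    rw [Finset.sum_add_distrib, ← Finset.mul_sum]
    simp only [Finset.sum_const, Finset.card_univ, Fintype.card_fin, nsmul_eq_mul]
    rw [← expWeight] at h2 ⊢
    have h3 : -((z - 1) * (μ₁ / z - r)) * expWeight z x =
        r * ((z - 1) * expWeight z x) + -(μ₁ * (1 - 1 / z)) * expWeight z x := by
      field_simp
      ring
    linarith

/-- An arrival raises `-ρ ^ T` by at most `(1 - ρ) ρ ^ T`, whereas a type I departure lowers it by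
that amount divided by `ρ`. If `T ≠ 0`, at least one server completes type I jobs, at rate `μ₁`. -/
lemma affGenerator_neg_pow_jobsI_le (hμ₁ : 0 < μ₁) (hlam : ∀ S, 0 ≤ lam S) (hempty : lam ∅ = 0)
    (halloc : IsAllocationRule alloc) {ρ : ℝ} (hρ0 : 0 < ρ) (hρ1 : ρ ≤ 1) (x : AffState N) :
    affGenerator μ₁ μ₂ lam alloc (fun x => -ρ ^ jobsI x) x ≤
      (1 - ρ) * ρ ^ jobsI x * (∑ S, lam S - if jobsI x = 0 then 0 else μ₁ / ρ) := by
  have he : 0 ≤ (1 - ρ) * ρ ^ jobsI x := mul_nonneg (by linarith) (pow_nonneg hρ0.le _)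
  refine (affGenerator_le (a := fun S _ => (1 - ρ) * ρ ^ jobsI x)
    (d := fun n => if 0 < (x n).1 then -((1 - ρ) * ρ ^ jobsI x * (μ₁ / ρ)) else 0)
    hlam hempty halloc ?_ ?_).trans ?_
  · intro S n _ _
    by_cases hn : n ∈ S
    · rw [joinServer, if_pos hn]
      have h := jobsI_update x n ((x n).1 + 1, (x n).2)
      have h : jobsI (Function.update x n ((x n).1 + 1, (x n).2)) = jobsI x + 1 := by
        simp only at h
        omega
      rw [h, pow_succ]
      apply le_of_eq
      ring
    · rw [joinServer, if_neg hn]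
      have h := jobsI_update x n ((x n).1, (x n).2 + 1)
      have h : jobsI (Function.update x n ((x n).1, (x n).2 + 1)) = jobsI x := by
        simp only at h
        omega
      rwa [h, sub_self]
  · intro n
    unfold departTerm
    split_ifs with h1 h2
    · have h := jobsI_update x n ((x n).1 - 1, (x n).2)
      have h : jobsI x = jobsI (Function.update x n ((x n).1 - 1, (x n).2)) + 1 := by
        simp only at h
        omega
      beta_reduce
      rw [h, pow_succ]
      apply le_of_eq
      field_simp
      ring
    · have h := jobsI_update x n ((x n).1, (x n).2 - 1)
      have h : jobsI (Function.update x n ((x n).1, (x n).2 - 1)) = jobsI x := by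
        simp only at h
        omega
      beta_reduce
      rw [h, sub_self, mul_zero]
    · exact le_rfl
  · have e : ∀ S, lam S * ∑ n, alloc x S n * ((1 - ρ) * ρ ^ jobsI x) =
        lam S * ((1 - ρ) * ρ ^ jobsI x) := fun S => by
      rw [← Finset.sum_mul, ← mul_assoc, lam_mul_sum_alloc hempty halloc]
    simp only [e]
    rw [← Finset.sum_mul, mul_sub,
      sub_eq_add_neg ((1 - ρ) * ρ ^ jobsI x * ∑ S, lam S)]
    refine add_le_add (le_of_eq (mul_comm _ _)) ?_
    have hneg : -((1 - ρ) * ρ ^ jobsI x * (μ₁ / ρ)) ≤ 0 := by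
      have := mul_nonneg he (div_pos hμ₁ hρ0).le
      linarith
    split_ifs with h
    · rw [mul_zero, neg_zero]
      exact Finset.sum_nonpos fun n _ => by split_ifs <;> first | exact hneg | exact le_rfl
    · obtain ⟨n, -, hn⟩ := Finset.exists_ne_zero_of_sum_ne_zero (show ∑ n, (x n).1 ≠ 0 from h)
      have h3 := Finset.sum_le_sum_of_subset_of_nonneg (Finset.subset_univ {n})
        (f := fun n => if 0 < (x n).1 then (1 - ρ) * ρ ^ jobsI x * (μ₁ / ρ) else 0)
        (fun n _ _ => by split_ifs <;> linarith)
      rw [Finset.sum_singleton, if_pos (Nat.pos_of_ne_zero hn)] at h3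
      have h4 : ∑ n, (if 0 < (x n).1 then -((1 - ρ) * ρ ^ jobsI x * (μ₁ / ρ)) else 0) =
          -∑ n, (if 0 < (x n).1 then (1 - ρ) * ρ ^ jobsI x * (μ₁ / ρ) else 0) := by
        rw [← Finset.sum_neg_distrib]
        exact Finset.sum_congr rfl fun n _ => by split_ifs <;> simp
      rw [h4]
      exact neg_le_neg h3

/-- Arrivals leave the backlog unchanged: a type II job joins an idle server, whose first type II
job is not counted. With no type I jobs and a positive backlog, some server has two or more type II
jobs and serves them, which halves the factor `2 ^ backlogII` at rate `μ₂`. -/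
lemma affGenerator_mul_two_pow_le (hμ₂ : 0 < μ₂) (hlam : ∀ S, 0 ≤ lam S) (hempty : lam ∅ = 0)
    (halloc : IsAllocationRule alloc) {A : AffState N → ℝ} (hA : 0 ≤ A)
    (htypeI : ∀ x y : AffState N, typeI x = typeI y → A x = A y) (x : AffState N) :
    affGenerator μ₁ μ₂ lam alloc (fun x => A x * 2 ^ backlogII x) x ≤
      2 ^ backlogII x * affGenerator μ₁ μ₂ lam alloc A x -
        if jobsI x = 0 ∧ 0 < backlogII x then μ₂ * (A x * 2 ^ backlogII x) / 2 else 0 := by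
  have hV : 0 ≤ A x * 2 ^ backlogII x := mul_nonneg (hA x) (by positivity)
  have hVμ : 0 ≤ μ₂ * (A x * 2 ^ backlogII x) / 2 := by positivity
  refine (affGenerator_le (a := fun S n => 2 ^ backlogII x * (A (joinServer x S n) - A x))
    (d := fun n => 2 ^ backlogII x * departTerm μ₁ μ₂ A x n -
      if (x n).1 = 0 ∧ 2 ≤ (x n).2 then μ₂ * (A x * 2 ^ backlogII x) / 2 else 0)
    hlam hempty halloc ?_ ?_).trans ?_
  · intro S n hS hel
    have : backlogII (joinServer x S n) = backlogII x := by
      by_cases hn : n ∈ S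
      · rw [joinServer, if_pos hn]
        have h := backlogII_update x n ((x n).1 + 1, (x n).2)
        simp only at h
        omega
      · rw [joinServer, if_neg hn]
        have h := backlogII_update x n ((x n).1, (x n).2 + 1)
        have h0 : x n = (0, 0) := by
          rcases hel with ⟨-, h, -⟩ | ⟨-, -, -, h⟩ | ⟨-, h, -⟩
          exacts [absurd h hn, h, absurd h hn]
        simp only [h0] at h ⊢
        omega
    rw [this]
    apply le_of_eq
    ring
  · intro n
    unfold departTerm
    rcases Nat.eq_zero_or_pos (x n).1 with h1 | h1
    · simp only [h1, lt_irrefl, if_false, true_and]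
      have hA' : A (Function.update x n (0, (x n).2 - 1)) = A x := by
        refine htypeI _ _ ?_
        rw [typeI_update]
        exact Function.update_eq_self_iff.2 h1.symm
      have h := backlogII_update x n (0, (x n).2 - 1)
      simp only at h
      rw [hA', sub_self, mul_zero, ite_self, mul_zero]
      split_ifs with h2 h3 h3
      · have h4 : backlogII x = backlogII (Function.update x n (0, (x n).2 - 1)) + 1 := by omega
        rw [h4, pow_succ]
        apply le_of_eq
        ring
      · have h4 : backlogII (Function.update x n (0, (x n).2 - 1)) = backlogII x := by omega
        rw [h4]
        simp
      · omega
      · simp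
    · have h := backlogII_update x n ((x n).1 - 1, (x n).2)
      have h4 : backlogII (Function.update x n ((x n).1 - 1, (x n).2)) = backlogII x := by
        simp only at h
        omega
      simp only [if_pos h1, h4, h1.ne', false_and, if_false]
      apply le_of_eq
      ring
  · rw [Finset.sum_sub_distrib, ← Finset.mul_sum, affGenerator, mul_add, Finset.mul_sum]
    have e : ∀ S, lam S * ∑ n, alloc x S n * (2 ^ backlogII x * (A (joinServer x S n) - A x)) =
        2 ^ backlogII x * (lam S * ∑ n, alloc x S n * (A (joinServer x S n) - A x)) := fun S => by
      simp only [Finset.mul_sum]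
      exact Finset.sum_congr rfl fun n _ => by ring
    simp only [e]
    rw [← Finset.mul_sum, ← Finset.mul_sum, ← add_sub_assoc]
    refine sub_le_sub le_rfl ?_
    have hnn : ∀ n : Fin N, 0 ≤ if (x n).1 = 0 ∧ 2 ≤ (x n).2 then
        μ₂ * (A x * 2 ^ backlogII x) / 2 else 0 := fun n => by
      split_ifs
      exacts [hVμ, le_rfl]
    split_ifs with h
    · obtain ⟨n, -, hn⟩ := Finset.exists_ne_zero_of_sum_ne_zero
        (show ∑ n, ((x n).2 - 1) ≠ 0 from h.2.ne')
      have h0 : (x n).1 = 0 := Finset.sum_eq_zero_iff.1 h.1 n (Finset.mem_univ n)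
      have h3 := Finset.single_le_sum (f := fun n => if (x n).1 = 0 ∧ 2 ≤ (x n).2 then
        μ₂ * (A x * 2 ^ backlogII x) / 2 else 0) (fun n _ => hnn n) (Finset.mem_univ n)
      rwa [if_pos ⟨h0, by omega⟩] at h3
    · exact Finset.sum_nonneg fun n _ => hnn n

end Lyapunov

/-! ### The Lyapunov function and stability -/

section Stability
variable {N : ℕ} {μ₁ μ₂ r : ℝ} {lam : Finset (Fin N) → ℝ}
  {alloc : AffState N → Finset (Fin N) → Fin N → ℝ} {p : Finset (Fin N) → Fin N → ℝ}

/-- The number of jobs of both types. -/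
def jobs (x : AffState N) : ℕ := ∑ n, ((x n).1 + (x n).2)

lemma finite_jobs_le (M : ℕ) : {x : AffState N | jobs x ≤ M}.Finite := by
  refine (Set.finite_Icc (0 : AffState N) fun _ => (M, M)).subset fun x hx => ?_
  refine ⟨zero_le, fun n => ?_⟩
  have h : (x n).1 + (x n).2 ≤ jobs x :=
    Finset.single_le_sum (f := fun n => (x n).1 + (x n).2) (fun _ _ => Nat.zero_le _)
      (Finset.mem_univ n)
  have h' : jobs x ≤ M := hx
  exact ⟨by simp only; omega, by simp only; omega⟩

lemma jobs_le (x : AffState N) : jobs x ≤ jobsI x + backlogII x + N := by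
  have : ∑ n : Fin N, ((x n).1 + (x n).2) ≤ ∑ n : Fin N, ((x n).1 + ((x n).2 - 1) + 1) :=
    Finset.sum_le_sum fun n _ => by omega
  simpa [jobs, jobsI, backlogII, Finset.sum_add_distrib] using this

lemma jobs_affDepart {x : AffState N} {n : Fin N} (h : (x n).1 + (x n).2 ≠ 0) :
    jobs (affDepart x n) + 1 = jobs x := by
  have key := sum_comp_update_add (fun q : ℕ × ℕ => q.1 + q.2) x n
  unfold affDepart jobs
  split_ifs
  · have := key ((x n).1 - 1, (x n).2)
    simp only at this
    omega
  · have := key ((x n).1, (x n).2 - 1)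
    simp only at this
    omega

/-- The empty configuration is reached with positive probability. -/
lemma uniformized_pow_ge (hμ₂ : 0 < μ₂) (hμ : μ₂ < μ₁) (hlam : ∀ S, 0 ≤ lam S)
    (hempty : lam ∅ = 0) (halloc : IsAllocationRule alloc) {γ : ℝ}
    (hγ : ∑ S, lam S + N * μ₁ + 1 ≤ γ) (hγ0 : 0 < γ) (m : ℕ) (x : AffState N) (hx : jobs x ≤ m)
    (g : AffState N → ℝ) (hg : 0 ≤ g) :
    (min μ₂ 1 / γ) ^ m * g 0 ≤ (uniformized γ (affRate μ₁ μ₂ lam alloc) affStep ^ m) g x := by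
  have hrate := affRate_nonneg (hμ₂.trans hμ) hμ₂ hlam hempty halloc
  have hle1 : ∀ x, ∑ a, affRate μ₁ μ₂ lam alloc x a + 1 ≤ γ := fun x => by
    linarith [sum_affRate_le hμ₂ hμ hempty halloc x]
  have hle : ∀ x, ∑ a, affRate μ₁ μ₂ lam alloc x a ≤ γ := fun x => by linarith [hle1 x]
  have hK := isMarkovOp_uniformized (step := affStep) hγ0 hrate hle
  have hδ : 0 ≤ min μ₂ 1 / γ := div_nonneg (le_min hμ₂.le zero_le_one) hγ0.le
  have hzero : ∀ {x : AffState N}, (∀ n, (x n).1 + (x n).2 = 0) → x = 0 := fun {x} h => by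
    funext n
    have := h n
    ext
    · exact (Nat.add_eq_zero_iff.1 this).1
    · exact (Nat.add_eq_zero_iff.1 this).2
  induction m generalizing x with
  | zero =>
    have : x = 0 := hzero fun n => Finset.sum_eq_zero_iff.1 (Nat.le_zero.1 hx) n (Finset.mem_univ n)
    simp [this]
  | succ m ih =>
    rw [pow_succ', pow_succ', Module.End.mul_apply, mul_assoc]
    have hnn := (hK.pow m).nonneg g hg
    -- The number of steps is fixed although fewer may be needed: an empty system waits, thanks to
    -- the slack `1` in `γ`; otherwise one departure brings it closer to empty.
    by_cases h : ∀ n, (x n).1 + (x n).2 = 0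
    · have hx0 := hzero h
      have h0 : jobs (0 : AffState N) ≤ m := by simp [jobs]
      subst hx0
      refine le_trans ?_ (uniformized_ge_self hγ0 hrate hle1 hnn 0)
      refine mul_le_mul (div_le_div_of_nonneg_right (min_le_right _ _) hγ0.le) (ih 0 h0) ?_ (by positivity)
      exact mul_nonneg (pow_nonneg hδ _) (hg 0)
    · push Not at h
      obtain ⟨n, hn⟩ := h
      refine le_trans ?_ (uniformized_ge_step hγ0 hrate hle hnn x (.inr n))
      have hd := jobs_affDepart hn
      have hr : min μ₂ 1 ≤ affRate μ₁ μ₂ lam alloc x (.inr n) := by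
        simp only [affRate]
        have := min_le_left μ₂ 1
        split_ifs
        · linarith
        · exact this
        · omega
      refine mul_le_mul (div_le_div_of_nonneg_right hr hγ0.le) (ih _ ?_) ?_
        (div_nonneg (hrate _ _) hγ0.le)
      · simp only [affStep]
        omega
      · exact mul_nonneg (pow_nonneg hδ _) (hg 0)

/-- A Lyapunov function for the affinity-scheduling system. -/
lemma exists_lyapunov (hN : 0 < N) (hμ₂ : 0 < μ₂) (hμ : μ₂ < μ₁) (hlam : ∀ S, 0 ≤ lam S)
    (hempty : lam ∅ = 0) (halloc : IsAllocationRule alloc)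
    (hp : IsProperSplit lam p) (hr : ∀ n, splitRate lam p n ≤ r) (hrμ : r < μ₁) :
    ∃ (V : AffState N → ℝ) (κ b : ℝ), 0 ≤ V ∧ 0 < κ ∧ 0 ≤ b ∧
      (∀ x, affGenerator μ₁ μ₂ lam alloc V x ≤ -κ * V x + b) ∧
      ∀ R : ℝ, ∃ M : ℕ, ∀ x, V x ≤ R → jobs x ≤ M := by
  have hμ₁ : 0 < μ₁ := hμ₂.trans hμ
  have hr0 : 0 ≤ r := (splitRate_nonneg hlam hp ⟨0, hN⟩).trans (hr _)
  set Λ : ℝ := ∑ S, lam S with hΛ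
  have hΛ0 : 0 ≤ Λ := Finset.sum_nonneg fun S _ => hlam S
  obtain ⟨z, hz, hzr⟩ : ∃ z : ℝ, 1 < z ∧ r < μ₁ / z := by
    rcases hr0.eq_or_lt with h | h
    · exact ⟨2, by norm_num, by rw [← h]; positivity⟩
    · obtain ⟨z, h1, h2⟩ := exists_between ((one_lt_div h).2 hrμ)
      exact ⟨z, h1, by rw [lt_div_iff₀ (by linarith)]; rw [lt_div_iff₀ h] at h2; linarith⟩
  set κ : ℝ := (z - 1) * (μ₁ / z - r) with hκ
  have hκ0 : 0 < κ := mul_pos (by linarith) (by linarith)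
  set b₁ : ℝ := N * (μ₁ * (1 - 1 / z)) with hb₁
  have hb₁0 : 0 ≤ b₁ := by
    have : 1 / z ≤ 1 := (div_le_one (by linarith)).2 hz.le
    have : 0 ≤ 1 - 1 / z := by linarith
    positivity
  -- This makes `Λ - μ₁ / ρ = -Λ - 2 μ₁` negative.
  set ρ : ℝ := μ₁ / (2 * (Λ + μ₁)) with hρ
  have hρ0 : 0 < ρ := by positivity
  have hρ1 : ρ < 1 := by
    rw [hρ, div_lt_one (by positivity)]
    linarith
  have hμρ : μ₁ / ρ = 2 * (Λ + μ₁) := by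
    rw [hρ]
    field_simp
  -- If `W ≥ 2 b₁ / κ`, half of the drift of `W` absorbs `b₁`. Otherwise `T ≤ M`, and `η` is so
  -- small that the drift of `-ρ ^ T`, bounded away from zero for these `T`, absorbs `η b₁`.
  obtain ⟨M, hM⟩ := exists_nat_ge (2 * b₁ / κ / (z - 1))
  obtain ⟨η, hη0, hη⟩ : ∃ η : ℝ, 0 < η ∧ η * b₁ ≤ (1 - ρ) * ρ ^ M * μ₁ := by
    have h1 : 0 < 1 - ρ := by linarith
    refine ⟨(1 - ρ) * ρ ^ M * μ₁ / (b₁ + 1), by positivity, ?_⟩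
    rw [div_mul_eq_mul_div, div_le_iff₀ (by linarith)]
    exact mul_le_mul_of_nonneg_left (by linarith) (by positivity)
  set b₂ : ℝ := η * b₁ + Λ with hb₂
  have hb₂0 : 0 ≤ b₂ := by positivity
  -- Large enough that `b₂ ≤ μ₂ / 4 * A`: the upward drift at `T = 0` uses at most half of the gain
  -- `μ₂ / 2 * A` from a shrinking backlog.
  set C : ℝ := 2 + 4 * b₂ / μ₂ with hC
  have hC2 : 2 ≤ C := by
    have : 0 ≤ 4 * b₂ / μ₂ := by positivity
    linarith
  set A : AffState N → ℝ := fun x => C + η * expWeight z x + -ρ ^ jobsI x with hA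
  have hW : ∀ x : AffState N, 1 + (z - 1) * jobsI x ≤ expWeight z x := fun x => by
    have : (1 : ℝ) ≤ N := by exact_mod_cast hN
    linarith [card_add_jobsI_le_expWeight hz x]
  have hW1 : ∀ x : AffState N, 1 ≤ expWeight z x := fun x => by
    have : 0 ≤ (z - 1) * (jobsI x : ℝ) := mul_nonneg (by linarith) (Nat.cast_nonneg _)
    linarith [hW x]
  have he0 : ∀ x : AffState N, 0 ≤ ρ ^ jobsI x := fun x => pow_nonneg hρ0.le _
  have he1 : ∀ x : AffState N, ρ ^ jobsI x ≤ 1 := fun x => pow_le_one₀ hρ0.le hρ1.le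
  have hAlow : ∀ x, C - 1 + η * expWeight z x ≤ A x := fun x => by
    simp only [hA]
    linarith [he1 x]
  have hAup : ∀ x, A x ≤ (C + η) * expWeight z x := fun x => by
    simp only [hA]
    nlinarith [he0 x, hW1 x]
  have hA1 : ∀ x, 1 ≤ A x := fun x => by
    have := mul_nonneg hη0.le (zero_le_one.trans (hW1 x))
    linarith [hAlow x]
  have hLA : ∀ x, affGenerator μ₁ μ₂ lam alloc A x ≤ η * (-κ * expWeight z x + b₁) +
      (1 - ρ) * ρ ^ jobsI x * (Λ - if jobsI x = 0 then 0 else μ₁ / ρ) := fun x => by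
    rw [hA, affGenerator_add_mul]
    exact add_le_add (mul_le_mul_of_nonneg_left
      (affGenerator_expWeight_le hμ₁ hlam hempty halloc hp hr hz x) hη0.le)
      (affGenerator_neg_pow_jobsI_le hμ₁ hlam hempty halloc hρ0 hρ1.le x)
  have hLA0 : ∀ x, jobsI x = 0 → affGenerator μ₁ μ₂ lam alloc A x ≤ b₂ := fun x hx => by
    have h := hLA x
    rw [if_pos hx, hx, pow_zero] at h
    have : 0 ≤ η * (κ * expWeight z x) :=
      mul_nonneg hη0.le (mul_nonneg hκ0.le (zero_le_one.trans (hW1 x)))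
    nlinarith
  have hLA1 : ∀ x, jobsI x ≠ 0 →
      affGenerator μ₁ μ₂ lam alloc A x ≤ -(η * κ / 2) * expWeight z x := fun x hx => by
    have h := hLA x
    rw [if_neg hx, hμρ] at h
    have h1ρ : 0 ≤ (1 - ρ) * ρ ^ jobsI x := mul_nonneg (by linarith) (he0 x)
    suffices η * b₁ ≤ η * κ / 2 * expWeight z x + (1 - ρ) * ρ ^ jobsI x * μ₁ by
      have := mul_nonneg h1ρ hΛ0
      have := mul_nonneg h1ρ hμ₁.le
      linarith
    rcases le_total (2 * b₁ / κ) (expWeight z x) with h2 | h2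
    · rw [div_le_iff₀ hκ0] at h2
      have := mul_le_mul_of_nonneg_left h2 hη0.le
      have := mul_nonneg h1ρ hμ₁.le
      linarith
    · have h3 : (jobsI x : ℝ) ≤ M := by
        refine le_trans ?_ hM
        rw [le_div_iff₀ (by linarith)]
        linarith [hW x]
      have h4 : ρ ^ M ≤ ρ ^ jobsI x :=
        pow_le_pow_of_le_one hρ0.le hρ1.le (by exact_mod_cast h3)
      have h5 : (1 - ρ) * ρ ^ M * μ₁ ≤ (1 - ρ) * ρ ^ jobsI x * μ₁ :=
        mul_le_mul_of_nonneg_right (mul_le_mul_of_nonneg_left h4 (by linarith)) hμ₁.le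
      have : 0 ≤ η * κ / 2 * expWeight z x :=
        mul_nonneg (by positivity) (zero_le_one.trans (hW1 x))
      linarith
  -- The first bound serves `T = 0 < J`; the second serves `T ≠ 0`, where `A ≤ (C + η) W`. When `T =
  -- J = 0`, the value of `V` is bounded and goes into the constant.
  set κ' : ℝ := min (μ₂ / 4) (η * κ / 2 / (C + η)) with hκ'
  have hCη : 0 < C + η := by linarith
  have hκ'0 : 0 < κ' := lt_min (by positivity) (by positivity)
  have hA0 : 0 ≤ A := fun x => zero_le_one.trans (hA1 x)
  have hAtypeI : ∀ x y : AffState N, typeI x = typeI y → A x = A y := fun x y h => by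
    have h' : ∀ n, (x n).1 = (y n).1 := fun n => congrFun h n
    simp only [hA, expWeight, jobsI, h']
  have h2J : ∀ x : AffState N, (1 : ℝ) ≤ 2 ^ backlogII x := fun x => one_le_pow₀ (by norm_num)
  refine ⟨fun x => A x * 2 ^ backlogII x, κ', b₂ + κ' * (C + η * N), fun x => ?_, hκ'0, ?_,
    fun x => ?_, fun R => ?_⟩
  · exact mul_nonneg (hA0 x) (by positivity)
  · positivity
  · refine (affGenerator_mul_two_pow_le hμ₂ hlam hempty halloc hA0 hAtypeI x).trans ?_
    have hbpos : 0 ≤ κ' * (C + η * N) := by positivity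
    have hJ := h2J x
    have hJ0 : (0 : ℝ) ≤ 2 ^ backlogII x := by positivity
    have hVx : 0 ≤ A x * 2 ^ backlogII x := mul_nonneg (hA0 x) hJ0
    by_cases hT : jobsI x = 0
    · rcases Nat.eq_zero_or_pos (backlogII x) with hb | hb
      · simp only [hT, hb, lt_irrefl, and_false, if_false, pow_zero, one_mul, mul_one, sub_zero]
        have hWN : expWeight z x = N := by
          have : ∀ n, (x n).1 = 0 := fun n => Finset.sum_eq_zero_iff.1 hT n (Finset.mem_univ n)
          simp [expWeight, this]
        have h1 : A x ≤ C + η * N := by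
          simp only [hA, hWN]
          linarith [he0 x]
        have h2 := mul_le_mul_of_nonneg_left h1 hκ'0.le
        linarith [hLA0 x hT]
      · rw [if_pos ⟨hT, hb⟩]
        have h1 : b₂ ≤ μ₂ / 4 * A x := by
          have h2 : C - 1 ≤ A x := by
            have := mul_nonneg hη0.le (zero_le_one.trans (hW1 x))
            linarith [hAlow x]
          have h3 : μ₂ / 4 * (C - 2) = b₂ := by
            rw [hC]
            field_simp
            ring
          rw [← h3]
          exact mul_le_mul_of_nonneg_left (by linarith) (by positivity)
        have h2 := mul_le_mul_of_nonneg_left ((hLA0 x hT).trans h1) hJ0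
        have h3 := mul_le_mul_of_nonneg_right (min_le_left (μ₂ / 4) (η * κ / 2 / (C + η))) hVx
        rw [← hκ'] at h3
        linarith
    · rw [if_neg fun h => hT h.1, sub_zero]
      have h1 : κ' * A x ≤ η * κ / 2 * expWeight z x := by
        calc _ ≤ η * κ / 2 / (C + η) * ((C + η) * expWeight z x) :=
              mul_le_mul (min_le_right _ _) (hAup x) (hA0 x) (by positivity)
          _ = _ := by field_simp
      have h2 := mul_le_mul_of_nonneg_left ((hLA1 x hT).trans (neg_mul (η * κ / 2) _ ▸ neg_le_neg h1)) hJ0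
      linarith
  -- The first factor controls the type I jobs and the power of two the backlog, which misses at
  -- most one type II job per server.
  · obtain ⟨M₁, hM₁⟩ := exists_nat_ge (R / (η * (z - 1)))
    obtain ⟨M₂, hM₂⟩ := exists_nat_ge R
    refine ⟨M₁ + M₂ + N, fun x hx => (jobs_le x).trans ?_⟩
    have hz1 : 0 < z - 1 := by linarith
    have h1 : A x ≤ R := (le_mul_of_one_le_right (hA0 x) (h2J x)).trans hx
    have h2 : (2 : ℝ) ^ backlogII x ≤ R :=
      (le_mul_of_one_le_left (by positivity) (hA1 x)).trans hx
    have h3 : (jobsI x : ℝ) ≤ M₁ := by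
      refine le_trans ?_ hM₁
      rw [le_div_iff₀ (by positivity)]
      have := mul_le_mul_of_nonneg_left (hW x) hη0.le
      linarith [hAlow x]
    have h4 : (backlogII x : ℝ) ≤ M₂ := by
      have : (backlogII x : ℝ) < 2 ^ backlogII x := by exact_mod_cast Nat.lt_two_pow_self
      linarith
    have h3' : jobsI x ≤ M₁ := by exact_mod_cast h3
    have h4' : backlogII x ≤ M₂ := by exact_mod_cast h4
    omega

/-- The affinity-scheduling system is stable if some split of the arrivals leaves every server
underloaded. -/
theorem isErgodicallyStable_affGenerator (hN : 0 < N) (hμ₂ : 0 < μ₂) (hμ : μ₂ < μ₁)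
    (hlam : ∀ S, 0 ≤ lam S) (hempty : lam ∅ = 0) (halloc : IsAllocationRule alloc)
    (hp : IsProperSplit lam p) (hr : ∀ n, splitRate lam p n ≤ r) (hrμ : r < μ₁) :
    IsErgodicallyStable (affGenerator μ₁ μ₂ lam alloc) := by
  have hμ₁ : 0 < μ₁ := hμ₂.trans hμ
  obtain ⟨V, κ, b, hV, hκ, hb, hdrift, hcpt⟩ :=
    exists_lyapunov hN hμ₂ hμ hlam hempty halloc hp hr hrμ
  -- The added `1` is the slack that lets the uniformized chain hold at the empty configuration.
  set γ : ℝ := ∑ S, lam S + N * μ₁ + 1 with hγ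
  have hΛ0 : 0 ≤ ∑ S, lam S := Finset.sum_nonneg fun S _ => hlam S
  have hγ0 : 0 < γ := by positivity
  have hle : ∀ x, ∑ a, affRate μ₁ μ₂ lam alloc x a ≤ γ := fun x => by
    linarith [sum_affRate_le hμ₂ hμ hempty halloc x]
  have hK := isMarkovOp_uniformized (step := affStep) hγ0
    (affRate_nonneg hμ₁ hμ₂ hlam hempty halloc) hle
  have hδ : 0 < min μ₂ 1 / γ := div_pos (lt_min hμ₂ one_pos) hγ0
  refine isErgodicallyStable_of_drift hK hγ0
    (fun f => by rw [affGenerator_eq]; exact eventGenerator_eq hγ0 _ _ f) hV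
    -- The maximum with zero covers the case `κ > γ`.
    (ρ := max (1 - κ / γ) 0) (b := b / γ) (le_max_right _ _)
    (max_lt (by linarith [div_pos hκ hγ0]) one_pos) (by positivity) (fun x => ?_) 0 (fun R => ?_)
    fun R => ?_
  · have h1 := hdrift x
    rw [affGenerator_eq] at h1
    rw [uniformized_apply]
    have h2 := mul_le_mul_of_nonneg_left h1 (inv_pos.2 hγ0).le
    have h3 := mul_le_mul_of_nonneg_right (le_max_left (1 - κ / γ) 0) (hV x)
    have h4 : γ⁻¹ * (-κ * V x + b) = -(κ / γ) * V x + b / γ := by ring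
    have h5 : (1 - κ / γ) * V x = V x + -(κ / γ) * V x := by ring
    linarith
  · obtain ⟨M, hM⟩ := hcpt R
    -- One step more than the bound on the number of jobs, since a positive number of steps is
    -- required.
    exact ⟨M + 1, by omega, (min μ₂ 1 / γ) ^ (M + 1), pow_pos hδ _, fun x hx g hg =>
      uniformized_pow_ge hμ₂ hμ hlam hempty halloc le_rfl hγ0 (M + 1) x
        ((hM x hx).trans (Nat.le_succ M)) g hg⟩
  · obtain ⟨M, hM⟩ := hcpt R
    exact (finite_jobs_le M).subset hM

end Stability

end

theorem theorem1 (N : ℕ) (hN : 0 < N) (μ₁ μ₂ : ℝ) (hμ₂ : 0 < μ₂) (hμ : μ₂ < μ₁)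
    (lam : Finset (Fin N) → ℝ) (hlam : ∀ S, 0 ≤ lam S) (hempty : lam ∅ = 0)
    (alloc : AffState N → Finset (Fin N) → Fin N → ℝ) (halloc : IsAllocationRule alloc) :
    -- the minimum that defines the rate is attained
    IsLeast (maxRates lam) (minMaxRate lam) ∧
    -- both systems exist, for every initial law
    (∀ ν : Measure (AffState N), IsProbabilityMeasure ν →
      ∃ (Ω : Type) (_ : MeasurableSpace Ω) (P : Measure Ω) (X : ℝ≥0 → Ω → AffState N),
        IsProbabilityMeasure P ∧ P.map (X 0) = ν ∧
        IsMarkovJumpProcess (affGenerator μ₁ μ₂ lam alloc) P X) ∧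
    (∀ ν : Measure (RefState N), IsProbabilityMeasure ν →
      ∃ (Ω : Type) (_ : MeasurableSpace Ω) (P : Measure Ω) (Y : ℝ≥0 → Ω → RefState N),
        IsProbabilityMeasure P ∧ P.map (Y 0) = ν ∧
        IsMarkovJumpProcess (raGenerator μ₁ (minMaxRate lam)) P Y) ∧
    -- dominance at time zero implies dominance of the processes
    (∀ (Ω₁ Ω₂ : Type*) [MeasurableSpace Ω₁] [MeasurableSpace Ω₂]
      (P₁ : Measure Ω₁) (P₂ : Measure Ω₂) [IsProbabilityMeasure P₁] [IsProbabilityMeasure P₂]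
      (X : ℝ≥0 → Ω₁ → AffState N) (Y : ℝ≥0 → Ω₂ → RefState N),
      IsMarkovJumpProcess (affGenerator μ₁ μ₂ lam alloc) P₁ X →
      IsMarkovJumpProcess (raGenerator μ₁ (minMaxRate lam)) P₂ Y →
      StochLE (P₁.map fun ω => tailSums (typeI (X 0 ω))) (P₂.map fun ω => tailSums (Y 0 ω)) →
      ProcessStochLE P₁ (fun t ω => tailSums (typeI (X t ω))) P₂ (fun t ω => tailSums (Y t ω))) ∧
    -- stability
    (minMaxRate lam < μ₁ → IsErgodicallyStable (affGenerator μ₁ μ₂ lam alloc)) := by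
  obtain ⟨hleast, p, hp, hr⟩ := exists_optimal_split hN hempty
  have hμ₁ : 0 < μ₁ := hμ₂.trans hμ
  have hr0 : 0 ≤ minMaxRate lam := (splitRate_nonneg hlam hp ⟨0, hN⟩).trans (hr _)
  have hlam0 : 0 ≤ ∑ S, lam S := Finset.sum_nonneg fun S _ => hlam S
  refine ⟨hleast, fun ν _ => ?_, fun ν _ => ?_, ?_,
    isErgodicallyStable_affGenerator hN hμ₂ hμ hlam hempty halloc hp hr⟩
  · rw [affGenerator_eq]
    have hγ : 0 < ∑ S, lam S + N * μ₁ := by positivity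
    exact exists_isMarkovJumpProcess hγ (affRate_nonneg hμ₁ hμ₂ hlam hempty halloc)
      (sum_affRate_le hμ₂ hμ hempty halloc) ν
  · rw [raGenerator_eq _ _ hN]
    have hγ : 0 < N * minMaxRate lam + N * μ₁ := by positivity
    refine exists_isMarkovJumpProcess hγ ?_ (fun y => (sum_raRate y).le) ν
    rintro y (n | n)
    exacts [hr0, hμ₁.le]
  · intro Ω₁ Ω₂ _ _ P₁ P₂ _ _ X Y hX hY h
    exact processStochLE_of_stochLE hN hμ₂ hμ hlam hempty halloc hp hr hX hY h
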